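/- \textbf{Definitions.} A \emph{constraint language} over a finite domain $\mathcal D$ is a set of relations (of finite arities) over $\mathcal D$; as an input to an algorithm it is a finite list of relations, each given by an explicit list of its tuples, together with the explicitly listed domain $\mathcal D$. Operations are given by their full value tables, and a CSP instance by its variables, its domain and the list of its constraints (a scope together with an explicitly listed relation). The language $\mathcal L(I)$ of an instance $I$ is the set of relations of its constraints. An operation $f:\mathcal D^k\to\mathcal D$ is a \emph{polymorphism} of $\Gamma$ if it preserves (componentwise) every relation of $\Gamma$, and it is \emph{conservative} if $f(x_1,\dots,x_k)\in\{x_1,\dots,x_k\}$ for all $x_1,\dots,x_k\in\mathcal D$. The \emph{conservative extension} $\overline\Gamma$ is $\Gamma$ together with all unary relations over $\mathcal D$. A \emph{linear strong Mal'tsev condition} $\mathcal M$ is a finite set of identities, each of the form $f(x_1,\dots,x_k)\approx g(y_1,\dots,y_c)$ or $f(x_1,\dots,x_k)\approx y$, over finitely many operation symbols $f_1,\dots,f_m$ of fixed arities. A language \emph{satisfies} $\mathcal M$ if it has polymorphisms $f_1,\dots,f_m$ that satisfy every identity of $\mathcal M$ under all assignments of values to the variables. A \emph{semiuniform polynomial-time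 algorithm} for $\mathcal M$ is an algorithm that, given a CSP instance $I$ together with polymorphisms $f_1,\dots,f_m$ of $\mathcal L(I)$ that satisfy $\mathcal M$, decides in time polynomial in the size of this input whether $I$ is satisfiable (nothing is required on other inputs). \textbf{Theorem.} Let $\mathcal M$ be a linear strong Mal'tsev condition that admits a semiuniform polynomial-time algorithm. Then there is a polynomial-time algorithm that, given as input a constraint language $\Gamma$ over a finite domain $\mathcal D$, decides whether $\overline\Gamma$ satisfies $\mathcal M$ (that is, whether $\Gamma$ has conservative polymorphisms that satisfy $\mathcal M$) and, if so, outputs conservative polymorphisms $f_1,\dots,f_m$ of $\Gamma$ that satisfy $\mathcal M$. The running time is polynomial in the size of the input, that is, in the size of $\mathcal D$ plus the total size of the listed relations; the algorithm and the polynomial may depend on $\mathcal M$. -/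

import Mathlib

namespace ConservativeCSP

/-! ### Constraint languages, polymorphisms, CSP instances -/

/-- A constraint language over `D`: a set of relations over `D`, each with its arity. -/
abbrev ConstraintLanguage (D : Type) : Type := Set (Σ k : ℕ, Set (Fin k → D))

/-- The `a`-ary operation `f` is a polymorphism of `L`: applied componentwise to `a` tuples of a
relation of `L`, it gives a tuple of that relation. -/
def IsPolymorphism {D : Type} (L : ConstraintLanguage D) {a : ℕ} (f : (Fin a → D) → D) : Prop :=
  ∀ R ∈ L, ∀ t : Fin a → Fin R.1 → D, (∀ j, t j ∈ R.2) → (fun i => f fun j => t j i) ∈ R.2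

/-- `f` always returns one of its arguments. -/
def IsConservative {D : Type} {a : ℕ} (f : (Fin a → D) → D) : Prop :=
  ∀ x : Fin a → D, ∃ j, f x = x j

/-- The language `L` together with all unary relations over `D`. -/
def conservativeExtension {D : Type} (L : ConstraintLanguage D) : ConstraintLanguage D :=
  L ∪ {R | R.1 = 1}

/-- A relation over `{0, …, d - 1}` given by an explicit list of tuples. -/
structure TableRelation (d : ℕ) where
  arity : ℕ
  tuples : List (Fin arity → Fin d)

/-- The relation that the list of tuples presents. -/
def TableRelation.toRelation {d : ℕ} (R : TableRelation d) : Σ k : ℕ, Set (Fin k → Fin d) :=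
  ⟨R.arity, {t | t ∈ R.tuples}⟩

/-- The constraint language presented by a list of explicitly listed relations. -/
def languageOf {d : ℕ} (G : List (TableRelation d)) : ConstraintLanguage (Fin d) :=
  {R | ∃ S ∈ G, R = S.toRelation}

/-- A constraint: a relation and a scope, over `n` variables. -/
structure Constraint (n d : ℕ) where
  rel : TableRelation d
  scope : Fin rel.arity → Fin n

/-- A CSP instance with variables `0, …, n - 1` and values `0, …, d - 1`. -/
structure Instance where
  n : ℕ
  d : ℕ
  constraints : List (Constraint n d)

/-- The language of an instance: the set of relations of its constraints. -/
def Instance.language (I : Instance) : ConstraintLanguage (Fin I.d) :=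
  languageOf (I.constraints.map Constraint.rel)

/-- The instance has a satisfying assignment. -/
def Instance.Satisfiable (I : Instance) : Prop :=
  ∃ φ : Fin I.n → Fin I.d, ∀ C ∈ I.constraints, (fun i => φ (C.scope i)) ∈ C.rel.tuples

/-! ### Linear strong Mal'tsev conditions -/

/-- A linear identity over operation symbols `0, …, m - 1` of the given arities, with variables
named by natural numbers: `f(x₁, …) ≈ g(y₁, …)` or `f(x₁, …) ≈ v`. -/
inductive LinearIdentity {m : ℕ} (arity : Fin m → ℕ) : Type
  | opOp (f : Fin m) (x : Fin (arity f) → ℕ) (g : Fin m) (y : Fin (arity g) → ℕ)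
  | opVar (f : Fin m) (x : Fin (arity f) → ℕ) (v : ℕ)

/-- A linear strong Mal'tsev condition: finitely many operation symbols with arities, and finitely
many linear identities. -/
structure MaltsevCondition where
  m : ℕ
  arity : Fin m → ℕ
  identities : List (LinearIdentity arity)

/-- An interpretation on `D` of the operation symbols of `M`. -/
abbrev MaltsevCondition.Interpretation (M : MaltsevCondition) (D : Type) : Type :=
  (i : Fin M.m) → (Fin (M.arity i) → D) → D

/-- The identity holds for every assignment of values to its variables. -/
def LinearIdentity.Holds {m : ℕ} {arity : Fin m → ℕ} {D : Type}
    (F : (i : Fin m) → (Fin (arity i) → D) → D) : LinearIdentity arity → Prop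
  | .opOp f x g y => ∀ ρ : ℕ → D, F f (fun j => ρ (x j)) = F g (fun j => ρ (y j))
  | .opVar f x v => ∀ ρ : ℕ → D, F f (fun j => ρ (x j)) = ρ v

/-- The operations satisfy every identity of `M`. -/
def MaltsevCondition.SatisfiedBy (M : MaltsevCondition) {D : Type} (F : M.Interpretation D) :
    Prop :=
  ∀ e ∈ M.identities, e.Holds F

/-- The operations are polymorphisms of `L` that satisfy `M`. -/
def MaltsevCondition.IsPolymorphismTuple (M : MaltsevCondition) {D : Type}
    (L : ConstraintLanguage D) (F : M.Interpretation D) : Prop :=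
  (∀ i, IsPolymorphism L (F i)) ∧ M.SatisfiedBy F

/-- The constraint language `L` satisfies `M`. -/
def LanguageSatisfies {D : Type} (L : ConstraintLanguage D) (M : MaltsevCondition) : Prop :=
  ∃ F : M.Interpretation D, M.IsPolymorphismTuple L F

/-! ### Programs and their running time

Programs compute on binary trees. A primitive operation costs one more than the size of the tree
it is applied to, and every other construct costs one more than the total cost of its parts, so
the cost of a run is at least the size of every tree that occurs in it. Polynomial time in this
model is polynomial time on Turing machines. -/

/-- Binary trees, the data of the programs. -/
inductive Data : Type
  | nil
  | cons (a b : Data)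

namespace Data

/-- The number of nodes, leaves included. -/
def size : Data → ℕ
  | nil => 1
  | cons a b => a.size + b.size + 1

/-- The left subtree. -/
def head : Data → Data
  | nil => nil
  | cons a _ => a

/-- The right subtree. -/
def tail : Data → Data
  | nil => nil
  | cons _ b => b

/-- A natural number, in unary. -/
def ofNat : ℕ → Data
  | 0 => nil
  | k + 1 => cons nil (ofNat k)

/-- A list. -/
def ofList : List Data → Data
  | [] => nil
  | a :: l => cons a (ofList l)

end Data

/-- Programs; each maps an input tree to an output tree. -/
inductive Prog : Type
  | id
  | nil
  | head
  | tail
  | pair (p q : Prog)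
  | comp (p q : Prog)
  | cond (c p q : Prog)
  | loop (c p : Prog)

/-- `Runs p x y t`: started on input `x`, the program `p` halts with output `y` at cost `t`.
Here `comp p q` runs `q` first and then `p`, the program `cond c p q` runs `p` if the output of `c`
is not `nil`, and `q` if it is, and `loop c p` repeats `p` as long as the output of `c` on the
current tree is not `nil`. -/
inductive Runs : Prog → Data → Data → ℕ → Prop
  | id (x : Data) : Runs .id x x (x.size + 1)
  | nil (x : Data) : Runs .nil x .nil (x.size + 1)
  | head (x : Data) : Runs .head x x.head (x.size + 1)
  | tail (x : Data) : Runs .tail x x.tail (x.size + 1)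
  | pair {p q : Prog} {x y z : Data} {s t : ℕ} :
      Runs p x y s → Runs q x z t → Runs (.pair p q) x (.cons y z) (s + t + 1)
  | comp {p q : Prog} {x y z : Data} {s t : ℕ} :
      Runs q x y s → Runs p y z t → Runs (.comp p q) x z (s + t + 1)
  | cond_true {c p q : Prog} {x u v y : Data} {s t : ℕ} :
      Runs c x (.cons u v) s → Runs p x y t → Runs (.cond c p q) x y (s + t + 1)
  | cond_false {c p q : Prog} {x y : Data} {s t : ℕ} :
      Runs c x .nil s → Runs q x y t → Runs (.cond c p q) x y (s + t + 1)
  | loop_stop {c p : Prog} {x : Data} {s : ℕ} :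
      Runs c x .nil s → Runs (.loop c p) x x (s + 1)
  | loop_step {c p : Prog} {x u v y z : Data} {r s t : ℕ} :
      Runs c x (.cons u v) r → Runs p x y s → Runs (.loop c p) y z t →
      Runs (.loop c p) x z (r + s + t + 1)

/-! ### Encodings of inputs and outputs -/

/-- A tuple, as the list of its entries. -/
def encodeTuple {k n : ℕ} (t : Fin k → Fin n) : Data :=
  Data.ofList (List.ofFn fun i => Data.ofNat (t i))

/-- A relation, as its arity and the list of its tuples. -/
def encodeRelation {d : ℕ} (R : TableRelation d) : Data :=
  .cons (Data.ofNat R.arity) (Data.ofList (R.tuples.map encodeTuple))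

/-- A constraint language, as the domain size (in unary) and the list of its relations. -/
def encodeLanguage {d : ℕ} (G : List (TableRelation d)) : Data :=
  .cons (Data.ofNat d) (Data.ofList (G.map encodeRelation))

/-- A constraint, as its scope and its relation. -/
def encodeConstraint {n d : ℕ} (C : Constraint n d) : Data :=
  .cons (encodeTuple C.scope) (encodeRelation C.rel)

/-- An instance, as the number of variables and the domain size (both in unary) and the list of
its constraints. -/
def encodeInstance (I : Instance) : Data :=
  .cons (Data.ofNat I.n) (.cons (Data.ofNat I.d) (Data.ofList (I.constraints.map encodeConstraint)))

/-- The full value table of an operation, as an array nested to depth the arity: the entry of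
index `x` is the table of `f(x, …)`. -/
def encodeOperation {d : ℕ} : {a : ℕ} → ((Fin a → Fin d) → Fin d) → Data
  | 0, f => Data.ofNat (f Fin.elim0)
  | _ + 1, f => Data.ofList (List.ofFn fun x => encodeOperation fun t => f (Fin.cons x t))

/-- The list of the value tables of an interpretation of the operation symbols of `M`. -/
def encodeInterpretation {M : MaltsevCondition} {d : ℕ} (F : M.Interpretation (Fin d)) : Data :=
  Data.ofList (List.ofFn fun i => encodeOperation (F i))

/-! ### The two algorithmic properties -/

/-- `M` admits a semiuniform polynomial-time algorithm: a program which, given any CSP instance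
together with polymorphisms of its language that satisfy `M`, decides in polynomial time whether
the instance is satisfiable (the output is not `nil` if and only if it is). Nothing is required
on other inputs. -/
def HasSemiuniformAlgorithm (M : MaltsevCondition) : Prop :=
  ∃ (p : Prog) (P : Polynomial ℕ), ∀ (I : Instance) (F : M.Interpretation (Fin I.d)),
    M.IsPolymorphismTuple I.language F →
      ∃ (y : Data) (t : ℕ),
        Runs p (.cons (encodeInstance I) (encodeInterpretation F)) y t ∧
        t ≤ P.eval (Data.size (.cons (encodeInstance I) (encodeInterpretation F))) ∧
        (y ≠ .nil ↔ I.Satisfiable)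

end ConservativeCSP

open ConservativeCSP

namespace ConservativeCSP

/-! ### Polynomial-time functions between encoded types -/

/-! Call a pair of an operation symbol of `M` and an argument tuple over `D` a cell. Conservative
polymorphisms satisfying `M` are the solutions of a CSP whose variables are the cells: the value of
a cell is one of its arguments, a symbol applied to rows of a listed relation gives a row, and every
instance of an identity forces two cells to be equal or one cell to have a given value. The arities
are fixed by `M`, so this CSP has polynomial size. To solve it with the semiuniform algorithm one
would need polymorphisms satisfying `M`, which is what is sought. The circle is broken by enlarging,
block by block, the set of tuples on which operations are known.

A block is a short list of elements of `D`; a cell is covered if its arguments lie in one processed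
block. The invariant `Solver.Inv` says that the current table `A` is conservative and satisfies all
constraints as far as covered cells are concerned. For a new block `b`, each of the constantly many
conservative patterns on `b` is tested: does it extend to all cells covered by the earlier blocks?
The extension is sought afresh, and `A` only supplies the polymorphisms that the oracle asks for.
Hence no backtracking is needed: the restriction of a global solution to `b` always passes
(`Solver.step_isSome`). A pattern that passes is completed cell by cell by self-reduction and gives
the next table (`Solver.pinAll_spec`, `Solver.step_spec`). In the end all cells are covered and the
table is a solution; a step without a passing pattern shows that there is none.

For the test to be a legitimate oracle input, its domain is the disjoint union of the argument lists
`X` of covered cells, a free cell over `X` taking values in the copy of `X`. A conservative model of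
`M` on two elements, applied to the indicators of the components, selects a component `X`; arguments
outside `X` are replaced by a fixed element of `X`, and `A` is applied inside `X`. Identities hold
because they hold in the two-element model and, for `A`, on tuples over `X`
(`Solver.Inv.satisfiedBy`). Relations are preserved because `A` preserves them on covered columns
and fixes constants (`Solver.Inv.interpretation_mem`). Together this gives `Solver.Inv.test_iff`.

The two-element model arises by restricting conservative operations to two elements of `D`; if `M`
has none, only domains with at most one element remain (`exists_bool_model`). On the machine side,
`PolyTime` is closed under the constructions used, and the oracle, which is correct only under a
promise, is made total by a clock (`clocked`). -/

/-- A type whose elements are encoded by trees. -/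
class Enc (α : Type) where
  enc : α → Data

open Enc

/-- The size of the encoding of an element. -/
def esize {α : Type} [Enc α] (a : α) : ℕ := (enc a).size

instance : Enc Data := ⟨fun x => x⟩
instance : Enc Unit := ⟨fun _ => .nil⟩
instance : Enc ℕ := ⟨Data.ofNat⟩
instance : Enc Bool := ⟨fun b => if b then .cons .nil .nil else .nil⟩
instance {α β : Type} [Enc α] [Enc β] : Enc (α × β) := ⟨fun p => .cons (enc p.1) (enc p.2)⟩
instance {α : Type} [Enc α] : Enc (List α) := ⟨fun l => Data.ofList (l.map enc)⟩
instance {α : Type} [Enc α] : Enc (Option α) := ⟨fun o => o.elim .nil fun a => .cons .nil (enc a)⟩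

theorem eval_mono (P : Polynomial ℕ) {a b : ℕ} (h : a ≤ b) : P.eval a ≤ P.eval b := by
  simp only [Polynomial.eval_eq_sum_range]
  gcongr

theorem Data.size_pos (x : Data) : 0 < x.size := by cases x <;> simp [Data.size]

/-- Every primitive pays for the size of its input, so a time bound is also a size bound. This keeps
compositions polynomial. -/
theorem Runs.size_le {p : Prog} {x y : Data} {t : ℕ} (h : Runs p x y t) :
    x.size ≤ t ∧ y.size ≤ t := by
  induction h with
  | id x => simp
  | nil x => simp [Data.size]
  | head x => cases x <;> simp [Data.size, Data.head]; omega
  | tail x => cases x <;> simp [Data.size, Data.tail]; omega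
  | pair _ _ h1 h2 => simp only [Data.size]; omega
  | comp _ _ h1 h2 => omega
  | cond_true _ _ h1 h2 => omega
  | cond_false _ _ h1 h2 => omega
  | loop_stop _ h1 => omega
  | loop_step _ _ _ h1 h2 h3 => omega

/-- `f` is computed by a program in polynomial time. -/
@[fun_prop]
def PolyTime {α β : Type} [Enc α] [Enc β] (f : α → β) : Prop :=
  ∃ (p : Prog) (P : Polynomial ℕ), ∀ a, ∃ t, Runs p (enc a) (enc (f a)) t ∧ t ≤ P.eval (esize a)

/-- `b` is bounded by a polynomial in the size of its argument. -/
def PolyBounded {α : Type} [Enc α] (b : α → ℕ) : Prop :=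
  ∃ P : Polynomial ℕ, ∀ a, b a ≤ P.eval (esize a)

variable {α β γ δ σ τ : Type} [Enc α] [Enc β] [Enc γ] [Enc δ] [Enc σ] [Enc τ]

namespace PolyBounded

theorem mono {b c : α → ℕ} (hc : PolyBounded c) (h : ∀ a, b a ≤ c a) : PolyBounded b :=
  hc.imp fun _ hP a => (h a).trans (hP a)

theorem const (k : ℕ) : PolyBounded fun _ : α => k :=
  ⟨Polynomial.C k, fun a => by simp⟩

theorem add {b c : α → ℕ} (hb : PolyBounded b) (hc : PolyBounded c) :
    PolyBounded fun a => b a + c a := by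
  obtain ⟨P, hP⟩ := hb
  obtain ⟨Q, hQ⟩ := hc
  exact ⟨P + Q, fun a => by simpa using add_le_add (hP a) (hQ a)⟩

theorem mul {b c : α → ℕ} (hb : PolyBounded b) (hc : PolyBounded c) :
    PolyBounded fun a => b a * c a := by
  obtain ⟨P, hP⟩ := hb
  obtain ⟨Q, hQ⟩ := hc
  exact ⟨P * Q, fun a => by simpa using Nat.mul_le_mul (hP a) (hQ a)⟩

theorem eval {b : α → ℕ} (hb : PolyBounded b) (Q : Polynomial ℕ) :
    PolyBounded fun a => Q.eval (b a) := by
  obtain ⟨P, hP⟩ := hb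
  exact ⟨Q.comp P, fun a => by simpa using eval_mono Q (hP a)⟩

theorem of_polyTime {f : α → β} (hf : PolyTime f) : PolyBounded fun a => esize (f a) := by
  obtain ⟨p, P, h⟩ := hf
  refine ⟨P, fun a => ?_⟩
  obtain ⟨t, h1, h2⟩ := h a
  exact h1.size_le.2.trans h2

end PolyBounded

namespace PolyTime

@[fun_prop]
theorem id : PolyTime fun a : α => a :=
  ⟨.id, Polynomial.X + 1, fun a => ⟨_, .id _, by simp [esize]⟩⟩

/-- A function that does not change the encoding. -/
theorem of_enc_eq {f : α → β} (h : ∀ a, enc (f a) = enc a) : PolyTime f :=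
  ⟨.id, Polynomial.X + 1, fun a => ⟨(enc a).size + 1, by rw [h]; exact .id _, by simp [esize]⟩⟩

/-- Programs for a function between trees lift to functions with the same effect on codes. -/
theorem of_enc {g : Data → Data} (hg : PolyTime g) {f : α → β}
    (h : ∀ a, enc (f a) = g (enc a)) : PolyTime f := by
  obtain ⟨p, P, hp⟩ := hg
  refine ⟨p, P, fun a => ?_⟩
  rw [h]
  exact hp (enc a)

theorem comp' {g : β → γ} {f : α → β} (hg : PolyTime g) (hf : PolyTime f) :
    PolyTime fun a => g (f a) := by
  obtain ⟨p, P, hp⟩ := hg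
  obtain ⟨q, Q, hq⟩ := hf
  refine ⟨.comp p q, Q + P.comp Q + 1, fun a => ?_⟩
  obtain ⟨s, h1, h2⟩ := hq a
  obtain ⟨t, h3, h4⟩ := hp (f a)
  refine ⟨_, .comp h1 h3, ?_⟩
  have := h4.trans (eval_mono P (h1.size_le.2.trans h2))
  simp
  omega

@[fun_prop]
theorem comp {g : β → γ} {f : α → β} (hg : PolyTime g) (hf : PolyTime f) :
    PolyTime fun a => g (f a) := comp' hg hf

@[fun_prop]
theorem prodMk {f : α → β} {g : α → γ} (hf : PolyTime f) (hg : PolyTime g) :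
    PolyTime fun a => (f a, g a) := by
  obtain ⟨p, P, hp⟩ := hf
  obtain ⟨q, Q, hq⟩ := hg
  refine ⟨.pair p q, P + Q + 1, fun a => ?_⟩
  obtain ⟨s, h1, h2⟩ := hp a
  obtain ⟨t, h3, h4⟩ := hq a
  exact ⟨_, .pair h1 h3, by simp; omega⟩

theorem dataHead : PolyTime Data.head :=
  ⟨.head, Polynomial.X + 1, fun a => ⟨_, .head _, by simp [esize, enc]⟩⟩

theorem dataTail : PolyTime Data.tail :=
  ⟨.tail, Polynomial.X + 1, fun a => ⟨_, .tail _, by simp [esize, enc]⟩⟩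

@[fun_prop]
theorem fst {f : α → β × γ} (hf : PolyTime f) : PolyTime fun a => (f a).1 :=
  (dataHead.of_enc fun _ => rfl : PolyTime (Prod.fst : β × γ → β)).comp' hf

@[fun_prop]
theorem snd {f : α → β × γ} (hf : PolyTime f) : PolyTime fun a => (f a).2 :=
  (dataTail.of_enc fun _ => rfl : PolyTime (Prod.snd : β × γ → γ)).comp' hf

theorem dataConst (x : Data) : PolyTime fun _ : α => x := by
  induction x with
  | nil => exact ⟨.nil, Polynomial.X + 1, fun a => ⟨_, .nil _, by simp [esize]⟩⟩
  | cons x y hx hy =>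
    exact (of_enc_eq fun _ => rfl : PolyTime fun p : Data × Data => Data.cons p.1 p.2).comp'
      (hx.prodMk hy)

@[fun_prop]
theorem const (b : β) : PolyTime fun _ : α => b :=
  (dataConst (α := Data) (enc b)).of_enc fun _ => rfl

@[fun_prop]
theorem dataCons {f g : α → Data} (hf : PolyTime f) (hg : PolyTime g) :
    PolyTime fun a => Data.cons (f a) (g a) :=
  (of_enc_eq fun _ => rfl : PolyTime fun p : Data × Data => Data.cons p.1 p.2).comp' (hf.prodMk hg)

@[fun_prop]
theorem encode {f : α → β} (hf : PolyTime f) : PolyTime fun a => enc (f a) :=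
  (of_enc_eq fun _ => rfl : PolyTime fun b : β => enc b).comp' hf

@[fun_prop]
theorem listCons {f : α → β} {g : α → List β} (hf : PolyTime f) (hg : PolyTime g) :
    PolyTime fun a => f a :: g a :=
  (of_enc_eq fun _ => rfl : PolyTime fun p : β × List β => p.1 :: p.2).comp' (hf.prodMk hg)

@[fun_prop]
theorem optionSome {f : α → β} (hf : PolyTime f) : PolyTime fun a => some (f a) := by
  have : PolyTime fun b : β => some b :=
    ((const Data.nil).dataCons id : PolyTime fun x : Data => Data.cons .nil x).of_enc fun _ => rfl
  exact this.comp' hf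

@[fun_prop]
theorem natSucc {f : α → ℕ} (hf : PolyTime f) : PolyTime fun a => f a + 1 := by
  have : PolyTime fun b : ℕ => b + 1 :=
    ((const Data.nil).dataCons id : PolyTime fun x : Data => Data.cons .nil x).of_enc fun _ => rfl
  exact this.comp' hf

/-- Definition by cases on the code of a value. -/
theorem cond_enc {l : α → Data} {f r : α → β} {g : γ → β}
    (hl : PolyTime l) (hf : PolyTime f) (hg : PolyTime g)
    (h0 : ∀ a, l a = .nil → r a = f a)
    (h1 : ∀ a x y, l a = .cons x y → ∃ c : γ, enc c = .cons (enc a) (.cons x y) ∧ r a = g c) :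
    PolyTime r := by
  obtain ⟨p, P, hp⟩ := hl
  obtain ⟨q, Q, hq⟩ := hf
  obtain ⟨s, S, hs⟩ := hg
  -- The code `l a` is computed twice, once as the test and once to be handed to the branch together
  -- with the input; hence `2 * P`.
  refine ⟨.cond p (.comp s (.pair .id p)) q, 2 * P + Q + S.comp (Polynomial.X + P + 1) +
    Polynomial.X + 4, fun a => ?_⟩
  obtain ⟨t1, h2, h3⟩ := hp a
  obtain ⟨t2, h4, h5⟩ := hq a
  rcases hla : l a with _ | ⟨x, y⟩
  · rw [hla] at h2
    rw [h0 a hla]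
    exact ⟨_, .cond_false h2 h4, by simp; omega⟩
  · rw [hla] at h2
    obtain ⟨c, hc, hr⟩ := h1 a x y hla
    obtain ⟨t3, h6, h7⟩ := hs c
    rw [hc] at h6
    rw [hr]
    refine ⟨_, .cond_true h2 (.comp (.pair (.id _) h2) h6), ?_⟩
    have := h7.trans (eval_mono S (b := esize a + P.eval (esize a) + 1) ?_)
    · simp [esize] at *; omega
    · have := h2.size_le.2
      have := esize.eq_1 c ▸ congrArg Data.size hc
      simp [esize, enc, Data.size] at *
      omega

@[fun_prop]
theorem ite {c : α → Prop} [∀ a, Decidable (c a)] {f g : α → β}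
    (hc : PolyTime fun a => decide (c a)) (hf : PolyTime f) (hg : PolyTime g) :
    PolyTime fun a => if c a then f a else g a := by
  -- The code of `true` is also the code of the pair of units, which makes `(a, (), ())` the
  -- argument of the branch.
  refine cond_enc hc.encode hg (hf.comp' (fst (β := α) (γ := Unit × Unit) id))
    (fun a h => ?_) (fun a x y h => ⟨(a, (), ()), ?_, ?_⟩)
  all_goals by_cases hca : c a <;> simp_all [enc]
  exact h.1.symm.trans h.2

@[fun_prop]
theorem boolCond {c : α → Bool} {f g : α → β}
    (hc : PolyTime c) (hf : PolyTime f) (hg : PolyTime g) :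
    PolyTime fun a => bif c a then f a else g a := by
  have : PolyTime fun a => if c a = true then f a else g a := ite (by simpa using hc) hf hg
  simpa [Bool.cond_eq_ite] using this

end PolyTime

/-- Definition by cases on a list. -/
def listCases {α β : Type} (l : List α) (x : β) (f : α → List α → β) : β :=
  match l with
  | [] => x
  | a :: l => f a l

@[simp] theorem listCases_nil {α β : Type} (x : β) (f : α → List α → β) :
    listCases [] x f = x := rfl

@[simp] theorem listCases_cons {α β : Type} (a : α) (l : List α) (x : β) (f : α → List α → β) :
    listCases (a :: l) x f = f a l := rfl

namespace PolyTime

@[fun_prop]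
theorem listCases {l : α → List β} {f : α → γ} {g : α → β → List β → γ} (hl : PolyTime l)
    (hf : PolyTime f) (hg : PolyTime fun p : α × β × List β => g p.1 p.2.1 p.2.2) :
    PolyTime fun a => listCases (l a) (f a) (g a) := by
  refine cond_enc hl.encode hf hg (fun a h => ?_) (fun a x y h => ?_)
  · rcases hla : l a with _ | ⟨u, v⟩
    · rfl
    · simp [hla, enc, Data.ofList] at h
  · rcases hla : l a with _ | ⟨u, v⟩
    · simp [hla, enc, Data.ofList] at h
    · exact ⟨(a, u, v), by simp_all [enc, Data.ofList], rfl⟩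

@[fun_prop]
theorem optionElim {o : α → Option β} {f : α → γ} {g : α → β → γ} (ho : PolyTime o)
    (hf : PolyTime f) (hg : PolyTime fun p : α × β => g p.1 p.2) :
    PolyTime fun a => (o a).elim (f a) (g a) := by
  have hg' : PolyTime fun p : α × Unit × β => g p.1 p.2.2 := by fun_prop
  refine cond_enc ho.encode hf hg' (fun a h => ?_) (fun a x y h => ?_)
  · rcases hoa : o a with _ | u
    · rfl
    · simp [hoa, enc] at h
  · rcases hoa : o a with _ | u
    · simp [hoa, enc] at h
    · exact ⟨(a, (), u), by simp_all [enc], rfl⟩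

@[fun_prop]
theorem optionGetD {o : α → Option β} {f : α → β} (ho : PolyTime o) (hf : PolyTime f) :
    PolyTime fun a => (o a).getD (f a) := by
  have : PolyTime fun a => (o a).elim (f a) (fun b => b) := by fun_prop
  convert this using 2 with a
  cases o a <;> rfl

@[fun_prop]
theorem optionIsSome {o : α → Option β} (ho : PolyTime o) : PolyTime fun a => (o a).isSome := by
  have : PolyTime fun a => (o a).elim false (fun _ => true) := by fun_prop
  convert this using 2 with a
  cases o a <;> rfl

@[fun_prop]
theorem optionMap {o : α → Option β} {g : α → β → γ} (ho : PolyTime o)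
    (hg : PolyTime fun p : α × β => g p.1 p.2) : PolyTime fun a => (o a).map (g a) := by
  have : PolyTime fun a => (o a).elim none (fun b => some (g a b)) := by fun_prop
  convert this using 2 with a
  cases o a <;> rfl

@[fun_prop]
theorem optionBind {o : α → Option β} {g : α → β → Option γ} (ho : PolyTime o)
    (hg : PolyTime fun p : α × β => g p.1 p.2) : PolyTime fun a => (o a).bind (g a) := by
  have : PolyTime fun a => (o a).elim none (fun b => g a b) := by fun_prop
  convert this using 2 with a
  cases o a <;> rfl

@[fun_prop]
theorem listTail {l : α → List β} (hl : PolyTime l) : PolyTime fun a => (l a).tail := by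
  have : PolyTime fun a => ConservativeCSP.listCases (l a) [] (fun _ t => t) := by fun_prop
  convert this using 2 with a
  cases l a <;> rfl

@[fun_prop]
theorem listHeadD {l : α → List β} {f : α → β} (hl : PolyTime l) (hf : PolyTime f) :
    PolyTime fun a => (l a).headD (f a) := by
  have : PolyTime fun a => ConservativeCSP.listCases (l a) (f a) (fun b _ => b) := by fun_prop
  convert this using 2 with a
  cases l a <;> rfl

@[fun_prop]
theorem listHead? {l : α → List β} (hl : PolyTime l) : PolyTime fun a => (l a).head? := by
  have : PolyTime fun a => ConservativeCSP.listCases (l a) none (fun b _ => some b) := by fun_prop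
  convert this using 2 with a
  cases l a <;> rfl

@[fun_prop]
theorem listIsEmpty {l : α → List β} (hl : PolyTime l) : PolyTime fun a => (l a).isEmpty := by
  have : PolyTime fun a => ConservativeCSP.listCases (l a) true (fun _ _ => false) := by fun_prop
  convert this using 2 with a
  cases l a <;> rfl

@[fun_prop]
theorem not {c : α → Bool} (hc : PolyTime c) : PolyTime fun a => !(c a) := by
  have : PolyTime fun a => bif c a then false else true := by fun_prop
  convert this using 2 with a
  cases c a <;> rfl

@[fun_prop]
theorem and {c d : α → Bool} (hc : PolyTime c) (hd : PolyTime d) :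
    PolyTime fun a => c a && d a := by
  have : PolyTime fun a => bif c a then d a else false := by fun_prop
  convert this using 2 with a
  cases c a <;> rfl

@[fun_prop]
theorem or {c d : α → Bool} (hc : PolyTime c) (hd : PolyTime d) :
    PolyTime fun a => c a || d a := by
  have : PolyTime fun a => bif c a then true else d a := by fun_prop
  convert this using 2 with a
  cases c a <;> rfl

end PolyTime

/-! ### Loops with polynomially bounded states -/

namespace PolyTime

/-- Iteration of a polynomial-time step as long as a polynomial-time condition holds, if the number
of steps and the sizes of all states are polynomially bounded. -/
theorem iterate {c : σ → Bool} {s : σ → σ} {i : α → σ} {n B : α → ℕ} (hc : PolyTime c)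
    (hs : PolyTime s) (hi : PolyTime i) (hn : PolyBounded n) (hB : PolyBounded B)
    (hsize : ∀ a, ∀ j ≤ n a, esize (s^[j] (i a)) ≤ B a)
    (h1 : ∀ a, ∀ j < n a, c (s^[j] (i a)) = true) (h0 : ∀ a, c (s^[n a] (i a)) = false) :
    PolyTime fun a => s^[n a] (i a) := by
  obtain ⟨q, Q, hq⟩ := hc
  obtain ⟨p, P, hp⟩ := hs
  obtain ⟨r, R, hr⟩ := hi
  -- A round costs at most `P.eval (B a) + Q.eval (B a) + 1` and the last test at most `Q.eval (B a)
  -- + 1`; the factor 2 is slack.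
  obtain ⟨T, hT⟩ := ((PolyBounded.const 2).mul ((hB.eval P).add (hB.eval Q)) |>.add
    (.const 1) |>.mul hn |>.add ((hB.eval P).add (hB.eval Q)) |>.add (.const 1))
  refine ⟨.comp (.loop q p) r, R + T + 1, fun a => ?_⟩
  obtain ⟨t, ht, htR⟩ := hr a
  have key : ∀ m (x : σ), (∀ j ≤ m, esize (s^[j] x) ≤ B a) → (∀ j < m, c (s^[j] x) = true) →
      c (s^[m] x) = false → ∃ t, Runs (.loop q p) (enc x) (enc (s^[m] x)) t ∧
        t ≤ (2 * (P.eval (B a) + Q.eval (B a)) + 1) * m + (P.eval (B a) + Q.eval (B a)) + 1 := by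
    intro m
    induction m with
    | zero =>
      intro x hx _ h0
      obtain ⟨t, ht, htB⟩ := hq x
      have := htB.trans (eval_mono Q (hx 0 le_rfl))
      simp only [Function.iterate_zero, _root_.id] at h0
      rw [h0] at ht
      exact ⟨_, Runs.loop_stop ht, by omega⟩
    | succ m ih =>
      intro x hx h1 h0
      obtain ⟨t1, ht1, hB1⟩ := hq x
      obtain ⟨t2, ht2, hB2⟩ := hp x
      obtain ⟨t3, ht3, hB3⟩ := ih (s x) (fun i hi => hx (i + 1) (by omega))
        (fun i hi => h1 (i + 1) (by omega)) h0
      have hcx : c x = true := h1 0 (Nat.zero_lt_succ _)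
      have h3 := eval_mono Q (hx 0 (Nat.zero_le _))
      have h4 := eval_mono P (hx 0 (Nat.zero_le _))
      simp only [Function.iterate_zero, _root_.id] at h3 h4
      rw [hcx] at ht1
      refine ⟨_, .loop_step ht1 ht2 ht3, ?_⟩
      nlinarith
  obtain ⟨t', ht', h'⟩ := key (n a) (i a) (hsize a) (h1 a) (h0 a)
  refine ⟨_, .comp ht ht', ?_⟩
  have := h'.trans (hT a)
  simp
  omega

end PolyTime

/-! ### Sizes of encoded values -/

@[simp] theorem esize_nil : esize ([] : List α) = 1 := rfl

@[simp] theorem esize_cons (a : α) (l : List α) : esize (a :: l) = esize a + esize l + 1 := rfl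

@[simp] theorem esize_prod (a : α) (b : β) : esize (a, b) = esize a + esize b + 1 := rfl

@[simp] theorem esize_none : esize (none : Option α) = 1 := rfl

@[simp] theorem esize_some (a : α) : esize (some a) = esize a + 2 := by
  simp [esize, enc, Data.size]; omega

@[simp] theorem esize_nat (n : ℕ) : esize n = 2 * n + 1 := by
  induction n with
  | zero => rfl
  | succ n ih =>
    have : esize (n + 1) = 1 + esize n + 1 := rfl
    omega

theorem esize_pos (a : α) : 0 < esize a := Data.size_pos _

theorem esize_append (l l' : List α) : esize (l ++ l') + 1 = esize l + esize l' := by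
  induction l with
  | nil => simp; omega
  | cons a l ih => simp; omega

theorem esize_reverse (l : List α) : esize l.reverse = esize l := by
  induction l with
  | nil => rfl
  | cons a l ih =>
    have := esize_append l.reverse [a]
    simp at *; omega

theorem length_lt_esize (l : List α) : l.length < esize l := by
  induction l with
  | nil => simp
  | cons a l ih => simp; omega

theorem esize_mem {a : α} {l : List α} (h : a ∈ l) : esize a < esize l := by
  induction l with
  | nil => simp at h
  | cons b l ih =>
    rcases List.mem_cons.1 h with rfl | h
    · rw [esize_cons]; omega
    · have := ih h; rw [esize_cons]; omega

theorem esize_sublist {l l' : List α} (h : l.Sublist l') : esize l ≤ esize l' := by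
  induction h with
  | slnil => rfl
  | cons a _ ih => simp; omega
  | cons_cons a _ ih => simp; omega

theorem esize_list_le {l : List α} {B : ℕ} (h : ∀ a ∈ l, esize a ≤ B) :
    esize l ≤ l.length * (B + 1) + 1 := by
  induction l with
  | nil => simp
  | cons a l ih =>
    have := ih fun b hb => h b (by simp [hb])
    have := h a (by simp)
    simp [Nat.succ_mul]; omega

/-! ### Folds and list functions in polynomial time -/

namespace PolyTime

/-- The loop carries the parameter, the remaining list and the accumulator. A polynomial-time step
alone would not suffice, since accumulators could grow exponentially; hence the bound `B` on all
intermediate results. -/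
theorem foldl {l : α → List β} {i : α → τ} {f : α → τ → β → τ} (hl : PolyTime l) (hi : PolyTime i)
    (hf : PolyTime fun p : α × τ × β => f p.1 p.2.1 p.2.2) {B : α → ℕ} (hB : PolyBounded B)
    (h : ∀ a l', l' <+: l a → esize (l'.foldl (f a) (i a)) ≤ B a) :
    PolyTime fun a => (l a).foldl (f a) (i a) := by
  let s : α × List β × τ → α × List β × τ := fun q =>
    ConservativeCSP.listCases q.2.1 q fun b t => (q.1, t, f q.1 q.2.2 b)
  have hs : PolyTime s := by
    have : PolyTime fun p : (α × List β × τ) × β × List β => f p.1.1 p.1.2.2 p.2.1 :=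
      hf.comp' (f := fun p : (α × List β × τ) × β × List β => (p.1.1, p.1.2.2, p.2.1))
        (by fun_prop)
    fun_prop
  have hit : ∀ a j l t, s^[j] (a, l, t) = (a, l.drop j, (l.take j).foldl (f a) t) := by
    intro a j
    induction j with
    | zero => simp
    | succ j ih =>
      intro l t
      rw [Function.iterate_succ_apply]
      cases l with
      | nil => exact (ih [] t).trans (by simp)
      | cons b l => exact (ih l (f a t b)).trans (by simp)
  have := iterate (c := fun q => !q.2.1.isEmpty) (s := s) (i := fun a => (a, l a, i a))
    (n := fun a => (l a).length) (B := fun a => esize a + esize (l a) + B a + 2) (by fun_prop) hs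
    (by fun_prop) ((PolyBounded.of_polyTime hl).mono fun a => (length_lt_esize _).le)
    ((((PolyBounded.of_polyTime id).add (.of_polyTime hl)).add hB).add (.const 2)) ?_ ?_ ?_
  · simp only [hit] at this
    simpa using this.snd.snd
  · intro a j hj
    have h1 := h a _ (List.take_prefix j (l a))
    have h2 := esize_sublist (List.drop_sublist j (l a))
    simp [hit]; omega
  · intro a j hj
    simpa [hit] using hj
  · intro a
    simp [hit]

/-- Makes the output size uniform in a second argument of bounded size, as needed when `f a` is
applied to all entries of a list. -/
theorem exists_bound {f : α → β → γ} (hf : PolyTime fun p : α × β => f p.1 p.2)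
    {B : α → ℕ} (hB : PolyBounded B) :
    ∃ C : α → ℕ, PolyBounded C ∧ ∀ a b, esize b ≤ B a → esize (f a b) ≤ C a := by
  obtain ⟨P, hP⟩ := PolyBounded.of_polyTime hf
  refine ⟨fun a => P.eval (esize a + B a + 1),
    (((PolyBounded.of_polyTime id).add hB).add (.const 1)).eval P, fun a b h => ?_⟩
  exact (hP (a, b)).trans (eval_mono P (by simp; omega))

@[fun_prop]
theorem listReverse {l : α → List β} (hl : PolyTime l) : PolyTime fun a => (l a).reverse := by
  have := foldl (l := l) (i := fun _ => []) (f := fun _ t b => b :: t) hl (const _) (by fun_prop)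
    (PolyBounded.of_polyTime hl) (fun a l' h => by
      have : List.foldl (fun t b => b :: t) [] l' = l'.reverse := by simp
      rw [this, esize_reverse]
      exact esize_sublist h.sublist)
  simpa using this

theorem foldr {l : α → List β} {i : α → τ} {f : α → β → τ → τ} (hl : PolyTime l) (hi : PolyTime i)
    (hf : PolyTime fun p : α × β × τ => f p.1 p.2.1 p.2.2) {B : α → ℕ} (hB : PolyBounded B)
    (h : ∀ a l', l' <:+ l a → esize (l'.foldr (f a) (i a)) ≤ B a) :
    PolyTime fun a => (l a).foldr (f a) (i a) := by
  have hf' : PolyTime fun p : α × τ × β => f p.1 p.2.2 p.2.1 :=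
    hf.comp' (f := fun p : α × τ × β => (p.1, p.2.2, p.2.1)) (by fun_prop)
  have := foldl (f := fun a t b => f a b t) hl.listReverse hi hf' hB (fun a l' h' => by
    have h2 := h a l'.reverse (by simpa using List.reverse_suffix.2 h')
    simpa using h2)
  simpa using this

@[fun_prop]
theorem listAppend {l l' : α → List β} (hl : PolyTime l) (hl' : PolyTime l') :
    PolyTime fun a => l a ++ l' a := by
  have := foldr (l := l) (i := l') (f := fun _ b t => b :: t) hl hl' (by fun_prop)
    ((PolyBounded.of_polyTime hl).add (PolyBounded.of_polyTime hl')) (fun a m h => by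
      have := esize_append m (l' a)
      have := esize_sublist h.sublist
      simp; omega)
  simpa using this

@[fun_prop]
theorem listMap {l : α → List β} {f : α → β → γ} (hf : PolyTime fun p : α × β => f p.1 p.2)
    (hl : PolyTime l) : PolyTime fun a => (l a).map (f a) := by
  obtain ⟨C, hC, h⟩ := exists_bound hf (PolyBounded.of_polyTime hl)
  have := foldr (l := l) (i := fun _ => []) (f := fun a b t => f a b :: t) hl (const _)
    (.listCons (hf.comp' (f := fun p : α × β × List γ => (p.1, p.2.1)) (by fun_prop))
      (by fun_prop))
    (((PolyBounded.of_polyTime hl).mul (hC.add (.const 1))).add (.const 1)) (fun a m hm => by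
      have h1 : m.foldr (fun b t => f a b :: t) [] = m.map (f a) := by simp
      rw [h1]
      refine (esize_list_le (B := C a) ?_).trans ?_
      · simp only [List.mem_map, forall_exists_index, and_imp, forall_apply_eq_imp_iff₂]
        exact fun b hb => h a b (esize_mem (hm.subset hb)).le
      · have := (length_lt_esize m).le.trans (esize_sublist hm.sublist)
        simp only [List.length_map]
        gcongr)
  simpa using this

@[fun_prop]
theorem listFlatten {l : α → List (List β)} (hl : PolyTime l) :
    PolyTime fun a => (l a).flatten := by
  have := foldr (l := l) (i := fun _ => []) (f := fun _ b t => b ++ t) hl (const _) (by fun_prop)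
    (PolyBounded.of_polyTime hl) (fun a m h => by
      refine le_trans ?_ (esize_sublist h.sublist)
      clear h
      induction m with
      | nil => simp
      | cons b m ih =>
        have := esize_append b (m.foldr (fun b t => b ++ t) [])
        simp at *; omega)
  convert this using 2 with a
  induction l a with
  | nil => rfl
  | cons b m ih => simp [ih]

@[fun_prop]
theorem listFlatMap {l : α → List β} {f : α → β → List γ}
    (hf : PolyTime fun p : α × β => f p.1 p.2) (hl : PolyTime l) :
    PolyTime fun a => (l a).flatMap (f a) := by
  simp only [List.flatMap_def]
  fun_prop

@[fun_prop]
theorem listFilter {l : α → List β} {f : α → β → Bool}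
    (hf : PolyTime fun p : α × β => f p.1 p.2) (hl : PolyTime l) :
    PolyTime fun a => (l a).filter (f a) := by
  have : PolyTime fun a => (l a).flatMap fun b => bif f a b then [b] else [] := by fun_prop
  convert this using 2 with a
  induction l a with
  | nil => rfl
  | cons b m ih => cases h : f a b <;> simp [h, ih]

@[fun_prop]
theorem listFind? {l : α → List β} {f : α → β → Bool}
    (hf : PolyTime fun p : α × β => f p.1 p.2) (hl : PolyTime l) :
    PolyTime fun a => (l a).find? (f a) := by
  have : PolyTime fun a => ((l a).filter (f a)).head? := by fun_prop
  convert this using 2 with a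
  simp

@[fun_prop]
theorem listAny {l : α → List β} {f : α → β → Bool}
    (hf : PolyTime fun p : α × β => f p.1 p.2) (hl : PolyTime l) :
    PolyTime fun a => (l a).any (f a) := by
  have : PolyTime fun a => !((l a).filter (f a)).isEmpty := by fun_prop
  convert this using 2 with a
  induction l a with
  | nil => rfl
  | cons b m ih => cases h : f a b <;> simp [h, ih]

@[fun_prop]
theorem listAll {l : α → List β} {f : α → β → Bool}
    (hf : PolyTime fun p : α × β => f p.1 p.2) (hl : PolyTime l) :
    PolyTime fun a => (l a).all (f a) := by
  have : PolyTime fun a => !((l a).any fun b => !(f a b)) := by fun_prop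
  convert this using 2 with a
  rw [List.all_eq_not_any_not]

/-- A natural number as a list. -/
theorem replicateUnit {n : α → ℕ} (hn : PolyTime n) :
    PolyTime fun a => List.replicate (n a) () := by
  -- A unary number and a list of that many units have the same code, so counting loops are folds
  -- over lists.
  have : PolyTime fun n : ℕ => List.replicate n () := of_enc_eq fun n => by
    induction n with
    | zero => rfl
    | succ n ih =>
      simp only [enc, Data.ofNat, List.replicate_succ, List.map_cons, Data.ofList] at ih ⊢
      rw [ih]
  exact this.comp' hn

@[fun_prop]
theorem listLength {l : α → List β} (hl : PolyTime l) : PolyTime fun a => (l a).length := by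
  have h : PolyTime fun n : List Unit => n.length := of_enc_eq fun n => by
    induction n with
    | nil => rfl
    | cons _ n ih =>
      simp only [enc, Data.ofNat, List.length_cons, List.map_cons, Data.ofList] at ih ⊢
      rw [ih]
  have := h.comp' (listMap (f := fun _ _ => ()) (by fun_prop) hl)
  simpa using this

theorem natIterate {n : α → ℕ} {i : α → τ} {f : α → τ → τ} (hn : PolyTime n) (hi : PolyTime i)
    (hf : PolyTime fun p : α × τ => f p.1 p.2) {B : α → ℕ} (hB : PolyBounded B)
    (h : ∀ a, ∀ j ≤ n a, esize ((f a)^[j] (i a)) ≤ B a) :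
    PolyTime fun a => (f a)^[n a] (i a) := by
  have key : ∀ a (l : List Unit) t, l.foldl (fun t _ => f a t) t = (f a)^[l.length] t := by
    intro a l
    induction l with
    | nil => simp
    | cons _ l ih => simp [ih]
  have := foldl (f := fun a t _ => f a t) (replicateUnit hn) hi
    (hf.comp' (f := fun p : α × τ × Unit => (p.1, p.2.1)) (by fun_prop)) hB (fun a l' h' => by
      rw [key]
      exact h a _ (by simpa using h'.length_le))
  simpa [key] using this

@[fun_prop]
theorem listRange {n : α → ℕ} (hn : PolyTime n) : PolyTime fun a => List.range (n a) := by
  have key : ∀ j, (fun t : List ℕ => 0 :: t.map (· + 1))^[j] [] = List.range j := by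
    intro j
    induction j with
    | zero => rfl
    | succ j ih => rw [Function.iterate_succ_apply', ih, List.range_succ_eq_map]
  have := natIterate (i := fun _ => []) (f := fun _ t => 0 :: t.map (· + 1)) hn (const _)
    (by fun_prop) (((PolyBounded.of_polyTime hn).mul ((PolyBounded.of_polyTime hn).add
      (.const 1))).add (.const 1)) (fun a j hj => by
      rw [key]
      refine (esize_list_le (B := esize (n a)) ?_).trans ?_
      · intro b hb
        simp at *; omega
      · gcongr
        simp; omega)
  simpa [key] using this

@[fun_prop]
theorem listDrop {n : α → ℕ} {l : α → List β} (hn : PolyTime n) (hl : PolyTime l) :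
    PolyTime fun a => (l a).drop (n a) := by
  have key : ∀ j (l : List β), List.tail^[j] l = l.drop j := by
    intro j l
    induction j with
    | zero => rfl
    | succ j ih => rw [Function.iterate_succ_apply', ih, List.tail_drop]
  have := natIterate (f := fun _ t => t.tail) hn hl (by fun_prop) (PolyBounded.of_polyTime hl)
    (fun a j _ => by
      rw [key]
      exact esize_sublist (List.drop_sublist _ _))
  simpa [key] using this

@[fun_prop]
theorem listGetD {n : α → ℕ} {l : α → List β} {d : α → β} (hn : PolyTime n) (hl : PolyTime l)
    (hd : PolyTime d) : PolyTime fun a => (l a).getD (n a) (d a) := by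
  have : PolyTime fun a => ((l a).drop (n a)).headD (d a) := by fun_prop
  convert this using 2 with a
  simp [List.headD_eq_head?_getD, List.getD_eq_getElem?_getD]

@[fun_prop]
theorem listFindIdx {l : α → List β} {f : α → β → Bool}
    (hf : PolyTime fun p : α × β => f p.1 p.2) (hl : PolyTime l) :
    PolyTime fun a => (l a).findIdx (f a) := by
  have key : ∀ a (l : List β), l.foldr (fun b t => bif f a b then 0 else t + 1) 0 =
      l.findIdx (f a) := by
    intro a l
    induction l with
    | nil => rfl
    | cons b l ih => rw [List.findIdx_cons, List.foldr_cons, ih]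
  have hf' : PolyTime fun p : α × β × ℕ => f p.1 p.2.1 :=
    hf.comp' (f := fun p : α × β × ℕ => (p.1, p.2.1)) (by fun_prop)
  have := foldr (l := l) (i := fun _ => 0) (f := fun a b t => bif f a b then 0 else t + 1) hl
    (const _) (by fun_prop) ((PolyBounded.const 2).mul (.of_polyTime hl) |>.add (.const 1))
    (fun a m hm => by
      rw [key, esize_nat]
      have := (length_lt_esize m).trans_le (esize_sublist hm.sublist)
      have := List.findIdx_le_length (xs := m) (p := f a)
      omega)
  simpa [key] using this

@[fun_prop]
theorem listZip {l : α → List β} {l' : α → List γ} (hl : PolyTime l) (hl' : PolyTime l') :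
    PolyTime fun a => (l a).zip (l' a) := by
  have key : ∀ (m : List β) (m' : List γ) (acc : List (β × γ)),
      m.foldl (fun (t : List γ × List (β × γ)) b =>
        ConservativeCSP.listCases t.1 t fun c r => (r, (b, c) :: t.2)) (m', acc) =
      (m'.drop m.length, (m.zip m').reverse ++ acc) := by
    intro m
    induction m with
    | nil => simp
    | cons b m ih =>
      intro m' acc
      cases m' with
      | nil => simpa using ih [] acc
      | cons c m' => simpa using ih m' ((b, c) :: acc)
  have := foldl (l := l) (i := fun a => (l' a, [])) (f := fun _ (t : List γ × List (β × γ)) b =>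
    ConservativeCSP.listCases t.1 t fun c r => (r, (b, c) :: t.2)) hl (by fun_prop) (by fun_prop)
    (((PolyBounded.of_polyTime hl).mul (((PolyBounded.of_polyTime hl).add
      (.of_polyTime hl')).add (.const 2))).add (PolyBounded.of_polyTime hl') |>.add (.const 2))
    (fun a m hm => by
      rw [key]
      have h1 : esize (m.zip (l' a)) ≤ (m.zip (l' a)).length *
          (esize (l a) + esize (l' a) + 1 + 1) + 1 := esize_list_le fun ⟨b, c⟩ hbc => by
        have h2 := esize_mem (hm.subset (List.of_mem_zip hbc).1)
        have h3 := esize_mem (List.of_mem_zip hbc).2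
        simp; omega
      have h2 := (length_lt_esize m).trans_le (esize_sublist hm.sublist)
      have h3 : (m.zip (l' a)).length ≤ esize (l a) := by simp; omega
      have h4 := esize_sublist (List.drop_sublist m.length (l' a))
      have h5 := Nat.mul_le_mul_right (esize (l a) + esize (l' a) + 2) h3
      simp only [esize_prod, List.append_nil, esize_reverse]
      rw [show esize (l a) + esize (l' a) + 1 + 1 = esize (l a) + esize (l' a) + 2 from rfl] at h1
      omega)
  have h2 := this.snd.listReverse
  simpa [key] using h2

@[fun_prop]
theorem listZipWith {l : α → List β} {l' : α → List γ} {f : α → β → γ → δ} (hl : PolyTime l)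
    (hl' : PolyTime l') (hf : PolyTime fun p : α × β × γ => f p.1 p.2.1 p.2.2) :
    PolyTime fun a => (l a).zipWith (f a) (l' a) := by
  have h : PolyTime fun a => ((l a).zip (l' a)).map fun p => f a p.1 p.2 := by fun_prop
  convert h using 2 with a
  simp [List.zip, List.map_zipWith]

@[fun_prop]
theorem listReplicate {n : α → ℕ} {b : α → β} (hn : PolyTime n) (hb : PolyTime b) :
    PolyTime fun a => List.replicate (n a) (b a) := by
  have : PolyTime fun a => (List.range (n a)).map fun _ => b a := by fun_prop
  simpa using this

/-- Maps of fixed length: each entry is computed by its own program. -/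
theorem mapConst {ι : Type} (l : List ι) {f : α → ι → β} (hf : ∀ i, PolyTime fun a => f a i) :
    PolyTime fun a => l.map (f a) := by
  induction l with
  | nil => simpa using const _
  | cons i l ih => simpa using (hf i).listCons ih

theorem flatMapConst {ι : Type} (l : List ι) {f : α → ι → List β}
    (hf : ∀ i, PolyTime fun a => f a i) : PolyTime fun a => l.flatMap (f a) := by
  simp only [List.flatMap_def]
  have := mapConst l hf
  fun_prop

/-- Functions of boundedly many bits. -/
theorem boolFun (k : ℕ) (Q : List Bool → β) {l : α → List Bool} (hl : PolyTime l) :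
    PolyTime fun a => Q ((List.range k).map fun i => (l a).getD i false) := by
  induction k generalizing Q l with
  | zero => simpa using const _
  | succ k ih =>
    -- A decision tree of depth `k`: the first bit selects one of two functions of `k` bits.
    have h1 := ih (fun m => Q (true :: m)) hl.listTail
    have h2 := ih (fun m => Q (false :: m)) hl.listTail
    have h3 : PolyTime fun a => (l a).headD false := by fun_prop
    convert h3.boolCond h1 h2 using 2 with a
    rw [List.range_succ_eq_map]
    have h4 : ∀ i, (l a).getD (i + 1) false = (l a).tail.getD i false := by cases l a <;> simp
    rcases l a with _ | ⟨_ | _, m⟩ <;> simp [Function.comp_def]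

end PolyTime

/-! ### Equality tests and arithmetic -/

/-- Equality can be decided in polynomial time. -/
class EncEq (α : Type) [Enc α] [DecidableEq α] : Prop where
  polyTime : PolyTime fun p : α × α => decide (p.1 = p.2)

@[fun_prop]
theorem PolyTime.decideEq [DecidableEq β] [EncEq β] {f g : α → β} (hf : PolyTime f)
    (hg : PolyTime g) : PolyTime fun a => decide (f a = g a) :=
  EncEq.polyTime.comp' (hf.prodMk hg)

instance : EncEq ℕ where
  polyTime := by
    have : PolyTime fun p : ℕ × ℕ => ((List.replicate p.1 ()).drop p.2).isEmpty &&
      ((List.replicate p.2 ()).drop p.1).isEmpty := by fun_prop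
    convert this using 2 with p
    rw [Bool.eq_iff_iff]
    simp
    omega

instance [DecidableEq α] [DecidableEq β] [EncEq α] [EncEq β] : EncEq (α × β) where
  polyTime := by
    have : PolyTime fun p : (α × β) × α × β => decide (p.1.1 = p.2.1) && decide (p.1.2 = p.2.2) := by
      fun_prop
    convert this using 2 with p
    rw [Bool.eq_iff_iff]
    simp [Prod.ext_iff]

instance [DecidableEq α] [EncEq α] : EncEq (List α) where
  polyTime := by
    have : PolyTime fun p : List α × List α => decide (p.1.length = p.2.length) &&
      (p.1.zip p.2).all fun q => decide (q.1 = q.2) := by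
      fun_prop
    convert this using 2 with p
    obtain ⟨l, m⟩ := p
    rw [Bool.eq_iff_iff]
    induction l generalizing m with
    | nil => cases m <;> simp
    | cons a l ih =>
      cases m with
      | nil => simp
      | cons b m =>
        have := ih m
        simp at *
        grind

@[fun_prop]
theorem PolyTime.decideMem [DecidableEq β] [EncEq β] {f : α → β} {g : α → List β} (hf : PolyTime f)
    (hg : PolyTime g) : PolyTime fun a => decide (f a ∈ g a) := by
  have : PolyTime fun a => (g a).any fun b => decide (f a = b) := by fun_prop
  convert this using 2 with a
  rw [Bool.eq_iff_iff]
  simp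

namespace PolyTime

@[fun_prop]
theorem natAdd {m n : α → ℕ} (hm : PolyTime m) (hn : PolyTime n) :
    PolyTime fun a => m a + n a := by
  have key : ∀ j k : ℕ, (fun t => t + 1)^[j] k = k + j := by
    intro j k
    induction j with
    | zero => rfl
    | succ j ih => rw [Function.iterate_succ_apply', ih, add_assoc]
  have := natIterate (f := fun _ t => t + 1) hn hm (by fun_prop)
    ((PolyBounded.of_polyTime hm).add (.of_polyTime hn)) (fun a j hj => by
      rw [key]; simp; omega)
  simpa [key] using this

@[fun_prop]
theorem natMul {m n : α → ℕ} (hm : PolyTime m) (hn : PolyTime n) :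
    PolyTime fun a => m a * n a := by
  have key : ∀ i j : ℕ, (fun t => t + i)^[j] 0 = i * j := by
    intro i j
    induction j with
    | zero => rfl
    | succ j ih => rw [Function.iterate_succ_apply', ih, Nat.mul_succ]
  have := natIterate (i := fun _ => 0) (f := fun a t => t + m a) hn (const _) (by fun_prop)
    ((PolyBounded.of_polyTime hm).mul (.of_polyTime hn)) (fun a j hj => by
      rw [key]
      have := Nat.mul_le_mul_left (m a) hj
      simp; nlinarith)
  simpa [key] using this

@[fun_prop]
theorem polynomialEval (P : Polynomial ℕ) {n : α → ℕ} (hn : PolyTime n) :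
    PolyTime fun a => P.eval (n a) := by
  induction P using Polynomial.induction_on with
  | C k => simpa using const _
  | add P Q hP hQ => simpa using hP.natAdd hQ
  | monomial k c h =>
    have := h.natMul hn
    simpa [pow_succ, mul_assoc] using this

end PolyTime

/-! ### Measuring trees and simulating programs under a clock -/

/-- Whether a tree is a leaf. -/
def Data.isNil : Data → Bool
  | .nil => true
  | .cons _ _ => false

@[fun_prop]
theorem PolyTime.dataHead' {f : α → Data} (hf : PolyTime f) : PolyTime fun a => (f a).head :=
  dataHead.comp' hf

@[fun_prop]
theorem PolyTime.dataTail' {f : α → Data} (hf : PolyTime f) : PolyTime fun a => (f a).tail :=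
  dataTail.comp' hf

@[fun_prop]
theorem PolyTime.isNil {f : α → Data} (hf : PolyTime f) : PolyTime fun a => (f a).isNil := by
  have : PolyTime Data.isNil :=
    cond_enc (γ := Data × Data × Data) id (const true) (const false)
      (fun a h => by subst h; rfl) (fun a x y h => ⟨(a, x, y), rfl, by subst h; rfl⟩)
  exact this.comp' hf

/-- One step of a traversal of a stack of trees. -/
def popTree (s : List Data) : List Data :=
  listCases s [] fun x r => bif x.isNil then r else x.head :: x.tail :: r

theorem PolyTime.popTree : PolyTime popTree := by
  unfold ConservativeCSP.popTree
  fun_prop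

/-- The total size of a stack of trees. -/
def stackSize (s : List Data) : ℕ := (s.map Data.size).sum

/-- A step either drops a leaf or replaces a node by its two children, so it removes exactly one
node. Counting steps therefore measures a tree. -/
theorem stackSize_popTree (s : List Data) : stackSize (popTree s) = stackSize s - 1 := by
  rcases s with _ | ⟨_ | ⟨x, y⟩, r⟩
  · rfl
  · simp [stackSize, popTree, Data.isNil, Data.size]
  · simp [stackSize, popTree, Data.isNil, Data.size, Data.head, Data.tail]
    omega

theorem stackSize_iterate (s : List Data) (n : ℕ) :
    stackSize (popTree^[n] s) = stackSize s - n := by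
  induction n with
  | zero => rfl
  | succ n ih => rw [Function.iterate_succ_apply', stackSize_popTree, ih]; omega

theorem isEmpty_iff_stackSize (s : List Data) : s.isEmpty = true ↔ stackSize s = 0 := by
  rcases s with _ | ⟨x, r⟩
  · simp [stackSize]
  · have := x.size_pos
    simp [stackSize]
    omega

theorem esize_le_stackSize (s : List Data) : esize s ≤ 2 * stackSize s + 1 := by
  induction s with
  | nil => simp
  | cons x s ih =>
    have := x.size_pos
    have h : esize x = x.size := rfl
    simp only [stackSize, esize_cons, List.map_cons, List.sum_cons] at *
    omega

/-- Whether the size of a tree is at most the given number. -/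
def sizeLe (n : ℕ) (x : Data) : Bool := (popTree^[n] [x]).isEmpty

theorem sizeLe_iff {n : ℕ} {x : Data} : sizeLe n x = true ↔ x.size ≤ n := by
  rw [sizeLe, isEmpty_iff_stackSize, stackSize_iterate]
  simp [stackSize, Nat.sub_eq_zero_iff_le]

@[fun_prop]
theorem PolyTime.sizeLe {n : α → ℕ} {f : α → Data} (hn : PolyTime n) (hf : PolyTime f) :
    PolyTime fun a => sizeLe (n a) (f a) := by
  have := natIterate (i := fun a => [f a]) (f := fun _ t => ConservativeCSP.popTree t) hn
    (by fun_prop) (PolyTime.popTree.comp' (by fun_prop))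
    (((PolyBounded.const 2).mul (PolyBounded.of_polyTime hf)).add (.const 1)) (fun a j hj => by
      refine (esize_le_stackSize _).trans ?_
      rw [stackSize_iterate]
      simp [stackSize, esize, enc])
  exact this.listIsEmpty

-- The number of pops that empty the stack is the size. It has to be computable in order to set the
-- clock of a simulation from the input.
@[fun_prop]
theorem PolyTime.esize' {f : α → β} (hf : PolyTime f) : PolyTime fun a => esize (f a) := by
  have hit : ∀ j (s : List Data) n, (fun q : List Data × ℕ => (ConservativeCSP.popTree q.1, q.2 + 1))^[j] (s, n) =
      (ConservativeCSP.popTree^[j] s, n + j) := by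
    intro j
    induction j with
    | zero => simp
    | succ j ih => intro s n; simp [ih]; omega
  have hp : PolyTime fun q : List Data × ℕ => ConservativeCSP.popTree q.1 :=
    PolyTime.popTree.comp' (by fun_prop)
  have := iterate (c := fun q : List Data × ℕ => !q.1.isEmpty)
    (s := fun q => (ConservativeCSP.popTree q.1, q.2 + 1))
    (i := fun x : Data => ([x], 0)) (n := Data.size) (B := fun x => 4 * x.size + 3) (by fun_prop)
    (by fun_prop) (by fun_prop) (PolyBounded.of_polyTime id)
    (((PolyBounded.const 4).mul (PolyBounded.of_polyTime id)).add (.const 3))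
    (fun a j hj => by
      rw [hit]
      have := esize_le_stackSize (ConservativeCSP.popTree^[j] [a])
      rw [stackSize_iterate] at this
      simp [stackSize] at *
      omega)
    (fun a j hj => by
      rw [hit, Bool.not_eq_true', ← Bool.not_eq_true, isEmpty_iff_stackSize, stackSize_iterate]
      simp [stackSize]
      omega)
    (fun a => by
      rw [hit, Bool.not_eq_false', isEmpty_iff_stackSize, stackSize_iterate]
      simp [stackSize])
  have h2 := (this.comp' hf.encode).snd
  simp only [hit] at h2
  simpa [esize] using h2

/-- The value of a program, where loops stop after `N` rounds and trees of size more than `N` are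
cut off. -/
def clocked : Prog → ℕ → Data → Data
  | .id, _, x => x
  | .nil, _, _ => .nil
  | .head, _, x => x.head
  | .tail, _, x => x.tail
  | .pair p q, N, x => .cons (clocked p N x) (clocked q N x)
  | .comp p q, N, x => clocked p N (clocked q N x)
  | .cond c p q, N, x => bif (clocked c N x).isNil then clocked q N x else clocked p N x
  | .loop c p, N, x => (fun x => bif (clocked c N x).isNil then x else
      bif sizeLe N (clocked p N x) then clocked p N x else .nil)^[N] x

/-- A run of cost at most `N` has at most `N` rounds in each loop and meets no tree larger than `N`,
so the cut-offs never act. For the induction, loops are treated with any number `k ≥ t` of rounds,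
because `N` stays fixed while the remaining cost shrinks; surplus rounds leave the final tree
unchanged. -/
theorem clocked_eq {p : Prog} {x y : Data} {t N : ℕ} (h : Runs p x y t) (ht : t ≤ N) :
    clocked p N x = y := by
  have key : ∀ {p x y t}, Runs p x y t → t ≤ N → clocked p N x = y ∧ ∀ c q, p = .loop c q →
      ∀ k, t ≤ k → (fun x => bif (clocked c N x).isNil then x else
        bif sizeLe N (clocked q N x) then clocked q N x else .nil)^[k] x = y := by
    intro p x y t h
    induction h with
    | id x => simp [clocked]
    | nil x => simp [clocked]
    | head x => simp [clocked]
    | tail x => simp [clocked]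
    | pair _ _ h1 h2 =>
      intro ht
      simp [clocked, (h1 (by omega)).1, (h2 (by omega)).1]
    | comp _ _ h1 h2 =>
      intro ht
      simp [clocked, (h1 (by omega)).1, (h2 (by omega)).1]
    | cond_true _ _ h1 h2 =>
      intro ht
      simp [clocked, (h1 (by omega)).1, (h2 (by omega)).1, Data.isNil]
    | cond_false _ _ h1 h2 =>
      intro ht
      simp [clocked, (h1 (by omega)).1, (h2 (by omega)).1, Data.isNil]
    | loop_stop _ h1 =>
      rename_i c p x s _
      intro ht
      have h2 : ∀ k, (fun x => bif (clocked c N x).isNil then x else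
          bif sizeLe N (clocked p N x) then clocked p N x else .nil)^[k] x = x := by
        intro k
        apply Function.iterate_fixed
        simp [(h1 (by omega)).1, Data.isNil]
      refine ⟨by rw [clocked]; exact h2 N, ?_⟩
      rintro _ _ ⟨⟩ k _
      exact h2 k
    | @loop_step c p x u v y z r s t _ h4 _ h1 h2 h3 =>
      intro ht
      have h5 : ∀ k, r + s + t + 1 ≤ k → (fun x => bif (clocked c N x).isNil then x else
          bif sizeLe N (clocked p N x) then clocked p N x else .nil)^[k] x = z := by
        intro k hk
        obtain ⟨k, rfl⟩ := Nat.exists_eq_add_one_of_ne_zero (by omega : k ≠ 0)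
        rw [Function.iterate_succ_apply]
        have h6 : sizeLe N y = true := sizeLe_iff.2 (h4.size_le.2.trans (by omega))
        simp only [(h1 (by omega)).1, (h2 (by omega)).1, Data.isNil, h6, cond_true, cond_false]
        exact (h3 (by omega)).2 _ _ rfl k (by omega)
      refine ⟨by rw [clocked]; exact h5 N ht, ?_⟩
      rintro _ _ ⟨⟩ k hk
      exact h5 k hk
  exact (key h ht).1

/-- Only loops are at issue: without the size cut-off, iterating a polynomial-time body could blow
up the state. With it, every state is the initial tree or has size at most `N` or is a leaf. -/
theorem PolyTime.clocked (p : Prog) : PolyTime fun q : ℕ × Data => clocked p q.1 q.2 := by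
  induction p with
  | id => unfold ConservativeCSP.clocked; fun_prop
  | nil => unfold ConservativeCSP.clocked; fun_prop
  | head => unfold ConservativeCSP.clocked; fun_prop
  | tail => unfold ConservativeCSP.clocked; fun_prop
  | pair p q hp hq => unfold ConservativeCSP.clocked; fun_prop
  | comp p q hp hq =>
    unfold ConservativeCSP.clocked
    exact hp.comp' (fst id |>.prodMk hq)
  | cond c p q hc hp hq => unfold ConservativeCSP.clocked; fun_prop
  | loop c p hc hp =>
    unfold ConservativeCSP.clocked
    refine natIterate (n := fun q : ℕ × Data => q.1) (i := fun q => q.2)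
      (f := fun q x => bif (ConservativeCSP.clocked c q.1 x).isNil then x else
        bif ConservativeCSP.sizeLe q.1 (ConservativeCSP.clocked p q.1 x) then
          ConservativeCSP.clocked p q.1 x else .nil) (by fun_prop) (by fun_prop) ?_
      (B := fun q => q.1 + esize q.2 + 1)
      (((PolyBounded.of_polyTime id).add (.const 1)).mono ?_) ?_
    · have h1 := hc.comp' (f := fun q : (ℕ × Data) × Data => (q.1.1, q.2)) (by fun_prop)
      have h2 := hp.comp' (f := fun q : (ℕ × Data) × Data => (q.1.1, q.2)) (by fun_prop)
      fun_prop
    · rintro ⟨n, x⟩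
      simp; omega
    · rintro ⟨n, x⟩ j -
      simp only
      induction j with
      | zero => simp; omega
      | succ j ih =>
        rw [Function.iterate_succ_apply']
        generalize (_)^[j] x = y at ih ⊢
        cases h1 : (ConservativeCSP.clocked c n y).isNil with
        | true => simpa [h1] using ih
        | false =>
          cases h2 : ConservativeCSP.sizeLe n (ConservativeCSP.clocked p n y) with
          | true =>
            have := sizeLe_iff.1 h2
            simp only [cond_true, cond_false]
            simp only [esize, enc] at *
            omega
          | false => simp [esize, enc, Data.size]

/-- A polynomial-time program that answers correctly on some inputs gives a total polynomial-time
function that does. -/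
theorem HasSemiuniformAlgorithm.exists_oracle {M : MaltsevCondition}
    (h : HasSemiuniformAlgorithm M) : ∃ g : Data → Bool, PolyTime g ∧
      ∀ (I : Instance) (F : M.Interpretation (Fin I.d)), M.IsPolymorphismTuple I.language F →
        (g (.cons (encodeInstance I) (encodeInterpretation F)) = true ↔ I.Satisfiable) := by
  obtain ⟨p, P, hp⟩ := h
  -- On promised inputs the clock `P.eval (esize x)` is long enough; on all others some bit is still
  -- returned in polynomial time.
  refine ⟨fun x => !(clocked p (P.eval (esize x)) x).isNil, ?_, fun I F hF => ?_⟩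
  · have := (PolyTime.clocked p).comp' (f := fun x : Data => (P.eval (esize x), x)) (by fun_prop)
    fun_prop
  · obtain ⟨y, t, h1, h2, h3⟩ := hp I F hF
    rw [← h3]
    have := clocked_eq h1 h2
    simp only [esize, enc]
    rw [this]
    cases y <;> simp [Data.isNil]

/-! ### The algorithm -/

/-- The lists of length `k` with entries in a list. -/
def listTuples {α : Type} (l : List α) : ℕ → List (List α)
  | 0 => [[]]
  | k + 1 => l.flatMap fun a => (listTuples l k).map (a :: ·)

/-- The transposes of all choices of `k` rows from `T`, where rows have length `n`. -/
def columns (n : ℕ) (T : List (List ℕ)) : ℕ → List (List (List ℕ))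
  | 0 => [List.replicate n []]
  | k + 1 => T.flatMap fun r => (columns n T k).map fun W => List.zipWith List.cons r W

/-- The index of the first occurrence of an element of a list. -/
def index {α : Type} [DecidableEq α] (l : List α) (a : α) : ℕ := l.findIdx fun b => decide (b = a)

/-- Removal of duplicates. -/
def removeDups {α : Type} [DecidableEq α] (l : List α) : List α :=
  l.foldr (fun a t => if a ∈ t then t else a :: t) []

/-- The value table of a function of `k` arguments from a list, nested to depth `k`. -/
def table {α : Type} (l : List α) : ℕ → (List α → ℕ) → Data
  | 0, f => Data.ofNat (f [])
  | k + 1, f => Data.ofList (l.map fun a => table l k fun t => f (a :: t))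

/-- A cell of an operation table: the number of an operation symbol and a list of arguments. -/
abbrev Cell : Type := ℕ × List ℕ

/-- A constraint between the values of cells: a list of cells and a list of tuples. -/
abbrev CellConstraint : Type := List Cell × List (List ℕ)

/-- A partial assignment of values to cells. -/
abbrev Pins : Type := List (Cell × ℕ)

/-- A constraint language, as the domain size and the list of pairs of an arity and a list of
tuples. -/
abbrev ListLanguage : Type := ℕ × List (ℕ × List (List ℕ))

/-- The cells of all operations on `{0, …, d - 1}`. -/
def cells (M : MaltsevCondition) (d : ℕ) : List Cell :=
  (List.finRange M.m).flatMap fun s =>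
    (listTuples (List.range d) (M.arity s)).map fun x => (s.val, x)

/-- The instance of an identity for an assignment of its variables, as a constraint. -/
def identityConstraint {M : MaltsevCondition} (d : ℕ) (ρ : List ℕ) :
    LinearIdentity M.arity → CellConstraint
  | .opOp f x g y => ([(f.val, (List.ofFn x).map fun i => ρ.getD i 0),
      (g.val, (List.ofFn y).map fun i => ρ.getD i 0)], (List.range d).map fun c => [c, c])
  | .opVar f x v => ([(f.val, (List.ofFn x).map fun i => ρ.getD i 0)], [[ρ.getD v 0]])

/-- The constraints saying that operations are polymorphisms. -/
def polymorphismConstraints (M : MaltsevCondition) (L : ListLanguage) : List CellConstraint :=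
  L.2.flatMap fun R => (List.finRange M.m).flatMap fun s =>
    (columns R.1 R.2 (M.arity s)).map fun W => (W.map fun x => (s.val, x), R.2)

/-- The constraints saying that operations satisfy the identities, in at most `w` variables. -/
def identityConstraints (M : MaltsevCondition) (w d : ℕ) : List CellConstraint :=
  M.identities.flatMap fun e => (listTuples (List.range d) w).map fun ρ => identityConstraint d ρ e

/-- All constraints on the cells of the operations. -/
def cellConstraints (M : MaltsevCondition) (w : ℕ) (L : ListLanguage) : List CellConstraint :=
  polymorphismConstraints M L ++ identityConstraints M w L.1

/-- The value assigned to a cell, if there is one. -/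
def pinOf (A : Pins) (v : Cell) : Option ℕ := (A.find? fun e => decide (e.1 = v)).map Prod.snd

/-- The operation table of a partial assignment: the first projection where it is undefined. -/
def value (A : Pins) (v : Cell) : ℕ := (pinOf A v).getD (v.2.headD 0)

/-- Whether all entries of `x` lie in one of the blocks. -/
def covered (B : List (List ℕ)) (x : List ℕ) : Bool := B.any fun b => x.all fun c => decide (c ∈ b)

/-- Whether a cell is a variable of the instance of `B` and `A`. -/
def isFree (B : List (List ℕ)) (A : Pins) (v : Cell) : Bool := !(pinOf A v).isSome && covered B v.2

/-- Whether a value is allowed in a cell. -/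
def allowed (B : List (List ℕ)) (A : Pins) (v : Cell) (c : ℕ) : Bool :=
  (pinOf A v).elim (!(covered B v.2) || decide (c ∈ v.2)) fun c' => decide (c = c')

/-- The values of the instance: the disjoint union of the covered argument lists. -/
def elements (M : MaltsevCondition) (d : ℕ) (B : List (List ℕ)) : List (List ℕ × ℕ) :=
  removeDups ((cells M d).flatMap fun v =>
    bif covered B v.2 then v.2.map fun c => (v.2, c) else [])

/-- The number that stands for the value `c` of the cell `v`. -/
def code (E : List (List ℕ × ℕ)) (B : List (List ℕ)) (A : Pins) (v : Cell) (c : ℕ) : ℕ :=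
  -- Pinned cells and cells that are neither pinned nor covered get the dummy value 0. A pin acts
  -- only through `allowed`, and the other cells are projected away.
  bif isFree B A v then index E (v.2, c) else 0

/-- The tuples of a constraint of the instance of `B` and `A`. -/
def codedTuples (E : List (List ℕ × ℕ)) (B : List (List ℕ)) (A : Pins) (C : CellConstraint) :
    List (List ℕ) :=
  (C.2.filter fun r => (C.1.zip r).all fun p => allowed B A p.1 p.2).map fun r =>
    List.zipWith (code E B A) C.1 r

/-- The parameters of the algorithm: a model of the condition on two elements, the length of the
blocks, a bound for the variables of the identities, and a program for instances. -/
structure Solver (M : MaltsevCondition) where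
  model : (s : Fin M.m) → (Fin (M.arity s) → Bool) → Bool
  width : ℕ
  vars : ℕ
  oracle : Data → Bool
  polyTime : PolyTime oracle

namespace Solver

variable {M : MaltsevCondition} (S : Solver M)

/-- The instance for the extension of `A` to all cells covered by `B`. -/
def instanceData (L : ListLanguage) (B : List (List ℕ)) (A : Pins) : Data :=
  enc ((cells M L.1).length, (elements M L.1 B).length, (cellConstraints M S.vars L).map fun C =>
    (C.1.map (index (cells M L.1)), C.1.length, codedTuples (elements M L.1 B) B A C))

/-- The component of the disjoint union in which the value of an operation lies. -/
def component (E : List (List ℕ × ℕ)) (s : Fin M.m) (es : List (List ℕ × ℕ)) : List ℕ :=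
  -- The model may reject every component, for instance a majority operation on three different
  -- ones. The fallback depends on `E` only, so both sides of an identity share it.
  ((E.map Prod.fst).find? fun X => S.model s fun i =>
    (es.map fun e => decide (e.1 = X)).getD i false).getD (E.headD ([], 0)).1

/-- The operations on the disjoint union. -/
def operation (E : List (List ℕ × ℕ)) (A : Pins) (s : Fin M.m) (es : List (List ℕ × ℕ)) :
    List ℕ × ℕ :=
  -- Arguments from other components are retracted to the first entry of the selected one.
  (S.component E s es, value A (s.val, es.map fun e =>
    bif decide (e.1 = S.component E s es) then e.2 else (S.component E s es).headD 0))

/-- The tables of the operations on the disjoint union. -/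
def operationData (L : ListLanguage) (B : List (List ℕ)) (A : Pins) : Data :=
  Data.ofList ((List.finRange M.m).map fun s => table (elements M L.1 B) (M.arity s) fun es =>
    index (elements M L.1 B) (S.operation (elements M L.1 B) A s es))

/-- Whether `A'` extends to all cells covered by `B`, given the operations `A` on these. -/
def test (L : ListLanguage) (B : List (List ℕ)) (A A' : Pins) : Bool :=
  S.oracle (.cons (S.instanceData L B A') (S.operationData L B A))

/-- The conservative assignments to the cells over the positions of a block. -/
def patterns : List Pins :=
  ((List.finRange M.m).flatMap fun s => (listTuples (List.range S.width) (M.arity s)).map fun u =>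
    u.map fun j => ((s.val, u), j)).sections

/-- The assignment to the cells over a block that a pattern describes. -/
def _root_.ConservativeCSP.blockPins (b : List ℕ) (g : Pins) : Pins :=
  g.map fun e => ((e.1.1, e.1.2.map fun i => b.getD i 0), b.getD e.2 0)

/-- Assigns a value to a cell if it is covered. -/
def pinCell (L : ListLanguage) (B : List (List ℕ)) (A A' : Pins) (v : Cell) : Pins :=
  bif covered B v.2 then
    (v, (v.2.find? fun c => S.test L B A ((v, c) :: A')).getD (v.2.headD 0)) :: A'
  else A'

/-- Assigns values to all covered cells. -/
def pinAll (L : ListLanguage) (B : List (List ℕ)) (A A' : Pins) : Pins :=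
  (cells M L.1).foldl (S.pinCell L B A) A'

/-- Extends operations on the blocks `st.1` to the block `b`. -/
def step (L : ListLanguage) (st : List (List ℕ) × Pins) (b : List ℕ) :
    Option (List (List ℕ) × Pins) :=
  -- The new pins start from the pattern alone. The old table `st.2` enters only as the source of
  -- polymorphisms for the oracle.
  (S.patterns.find? fun g => S.test L st.1 st.2 (blockPins b g)).map fun g =>
    (b :: st.1, S.pinAll L st.1 st.2 (blockPins b g))

/-- The operations on all blocks from a list. -/
def run (L : ListLanguage) (bs : List (List ℕ)) : Option (List (List ℕ) × Pins) :=
  bs.foldl (fun o b => o.bind fun st => S.step L st b)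
    (some ((List.range L.1).map fun c => [c], []))

/-- The output of the algorithm. -/
def output (L : ListLanguage) : Option Data :=
  (S.run L (listTuples (List.range L.1) S.width)).map fun st =>
    Data.ofList ((List.finRange M.m).map fun s => table (List.range L.1) (M.arity s) fun x =>
      value st.2 (s.val, x))

end Solver

/-! ### Its running time -/

namespace PolyTime

@[fun_prop]
theorem listTuples {l : α → List β} (hl : PolyTime l) (k : ℕ) :
    PolyTime fun a => listTuples (l a) k := by
  have : PolyTime fun l : List β => ConservativeCSP.listTuples l k := by
    induction k with
    | zero => unfold ConservativeCSP.listTuples; fun_prop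
    | succ k ih => unfold ConservativeCSP.listTuples; fun_prop
  exact this.comp' hl

@[fun_prop]
theorem columns {n : α → ℕ} {T : α → List (List ℕ)} (hn : PolyTime n) (hT : PolyTime T) (k : ℕ) :
    PolyTime fun a => columns (n a) (T a) k := by
  have : PolyTime fun p : ℕ × List (List ℕ) => ConservativeCSP.columns p.1 p.2 k := by
    induction k with
    | zero => unfold ConservativeCSP.columns; fun_prop
    | succ k ih =>
      unfold ConservativeCSP.columns
      have h := ih.comp' (f := fun q : (ℕ × List (List ℕ)) × List ℕ => q.1) (by fun_prop)
      fun_prop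
  exact this.comp' (hn.prodMk hT)

@[fun_prop]
theorem index [DecidableEq β] [EncEq β] {l : α → List β} {b : α → β} (hl : PolyTime l)
    (hb : PolyTime b) : PolyTime fun a => index (l a) (b a) := by
  unfold ConservativeCSP.index
  fun_prop

theorem _root_.ConservativeCSP.removeDups_sublist {α : Type} [DecidableEq α] (l : List α) :
    (ConservativeCSP.removeDups l).Sublist l := by
  induction l with
  | nil => exact List.Sublist.slnil
  | cons a l ih =>
    rw [ConservativeCSP.removeDups, List.foldr_cons]
    split_ifs
    · exact ih.cons a
    · exact ih.cons_cons a

@[fun_prop]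
theorem removeDups [DecidableEq β] [EncEq β] {l : α → List β} (hl : PolyTime l) :
    PolyTime fun a => removeDups (l a) :=
  foldr (f := fun _ b (t : List β) => if b ∈ t then t else b :: t) hl (const _) (by fun_prop)
    (PolyBounded.of_polyTime hl) fun a m hm =>
      esize_sublist ((removeDups_sublist m).trans hm.sublist)

@[fun_prop]
theorem dataOfList {l : α → List Data} (hl : PolyTime l) : PolyTime fun a => Data.ofList (l a) := by
  have h2 : PolyTime fun m : List Data => Data.ofList m := of_enc_eq fun m => by
    change _ = Data.ofList (m.map _)
    exact congrArg Data.ofList (List.map_id m).symm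
  exact h2.comp' hl

theorem table (k : ℕ) {l : α → List β} {f : α → List β → ℕ} (hl : PolyTime l)
    (hf : PolyTime fun p : α × List β => f p.1 p.2) : PolyTime fun a => table (l a) k (f a) := by
  induction k generalizing α with
  | zero =>
    unfold ConservativeCSP.table
    have := hf.comp' (f := fun a => (a, [])) (by fun_prop)
    exact (of_enc_eq fun _ => rfl : PolyTime fun n : ℕ => Data.ofNat n).comp' this
  | succ k ih =>
    unfold ConservativeCSP.table
    have h1 : PolyTime fun p : α × β => ConservativeCSP.table (l p.1) k fun t => f p.1 (p.2 :: t) :=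
      ih (l := fun p : α × β => l p.1) (f := fun (p : α × β) t => f p.1 (p.2 :: t)) (by fun_prop)
        (hf.comp' (f := fun q : (α × β) × List β => (q.1.1, q.1.2 :: q.2)) (by fun_prop))
    fun_prop

variable {M : MaltsevCondition}

@[fun_prop]
theorem cells {d : α → ℕ} (hd : PolyTime d) : PolyTime fun a => cells M (d a) := by
  unfold ConservativeCSP.cells
  exact flatMapConst _ fun s => by fun_prop

theorem identityConstraint (e : LinearIdentity M.arity) :
    PolyTime fun p : ℕ × List ℕ => identityConstraint p.1 p.2 e := by
  have h : ∀ l : List ℕ, PolyTime fun p : ℕ × List ℕ => l.map fun i => p.2.getD i 0 :=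
    fun l => mapConst l fun i => by fun_prop
  cases e with
  | opOp f x g y =>
    unfold ConservativeCSP.identityConstraint
    have h1 := h (List.ofFn x)
    have h2 := h (List.ofFn y)
    fun_prop
  | opVar f x v =>
    unfold ConservativeCSP.identityConstraint
    have h1 := h (List.ofFn x)
    fun_prop

@[fun_prop]
theorem cellConstraints {L : α → ListLanguage} (hL : PolyTime L) (w : ℕ) :
    PolyTime fun a => cellConstraints M w (L a) := by
  have h1 : PolyTime fun L : ListLanguage => polymorphismConstraints M L := by
    unfold polymorphismConstraints
    have : PolyTime fun p : ListLanguage × (ℕ × List (List ℕ)) =>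
      (List.finRange M.m).flatMap fun s =>
        (ConservativeCSP.columns p.2.1 p.2.2 (M.arity s)).map fun W =>
          (W.map fun x => (s.val, x), p.2.2) := flatMapConst _ fun s => by fun_prop
    fun_prop
  have h2 : PolyTime fun L : ListLanguage => identityConstraints M w L.1 := by
    unfold identityConstraints
    refine flatMapConst _ fun e => ?_
    have := (identityConstraint e).comp' (f := fun p : ListLanguage × List ℕ => (p.1.1, p.2))
      (by fun_prop)
    fun_prop
  exact (h1.listAppend h2).comp' hL

@[fun_prop]
theorem pinOf {A : α → Pins} {v : α → Cell} (hA : PolyTime A) (hv : PolyTime v) :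
    PolyTime fun a => pinOf (A a) (v a) := by
  unfold ConservativeCSP.pinOf
  fun_prop

@[fun_prop]
theorem value {A : α → Pins} {v : α → Cell} (hA : PolyTime A) (hv : PolyTime v) :
    PolyTime fun a => value (A a) (v a) := by
  unfold ConservativeCSP.value
  fun_prop

@[fun_prop]
theorem covered {B : α → List (List ℕ)} {x : α → List ℕ} (hB : PolyTime B) (hx : PolyTime x) :
    PolyTime fun a => covered (B a) (x a) := by
  unfold ConservativeCSP.covered
  fun_prop

@[fun_prop]
theorem elements {d : α → ℕ} {B : α → List (List ℕ)} (hd : PolyTime d) (hB : PolyTime B) :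
    PolyTime fun a => elements M (d a) (B a) := by
  unfold ConservativeCSP.elements
  fun_prop

@[fun_prop]
theorem code {E : α → List (List ℕ × ℕ)} {B : α → List (List ℕ)} {A : α → Pins} {v : α → Cell}
    {c : α → ℕ} (hE : PolyTime E) (hB : PolyTime B) (hA : PolyTime A) (hv : PolyTime v)
    (hc : PolyTime c) : PolyTime fun a => code (E a) (B a) (A a) (v a) (c a) := by
  unfold ConservativeCSP.code isFree
  fun_prop

@[fun_prop]
theorem codedTuples {E : α → List (List ℕ × ℕ)} {B : α → List (List ℕ)} {A : α → Pins}
    {C : α → CellConstraint} (hE : PolyTime E) (hB : PolyTime B) (hA : PolyTime A)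
    (hC : PolyTime C) : PolyTime fun a => codedTuples (E a) (B a) (A a) (C a) := by
  unfold ConservativeCSP.codedTuples allowed
  fun_prop

end PolyTime

/-! ### Running time of the solver -/

namespace Solver

variable {M : MaltsevCondition} (S : Solver M)

/-- The model is an arbitrary Boolean function, but of a number of bits fixed by `M`, so `boolFun`
applies. -/
theorem polyTime_component (s : Fin M.m) : PolyTime
    fun p : List (List ℕ × ℕ) × List (List ℕ × ℕ) => S.component p.1 s p.2 := by
  unfold component
  have : PolyTime fun q : (List (List ℕ × ℕ) × List (List ℕ × ℕ)) × List ℕ => S.model s fun i =>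
      (q.1.2.map fun e => decide (e.1 = q.2)).getD i false := by
    have := PolyTime.boolFun (M.arity s) (fun m => S.model s fun i => m.getD i false)
      (l := fun q : (List (List ℕ × ℕ) × List (List ℕ × ℕ)) × List ℕ =>
        q.1.2.map fun e => decide (e.1 = q.2)) (by fun_prop)
    convert this using 3 with q
    funext i
    simp [List.getD_eq_getElem?_getD]
  fun_prop

theorem polyTime_operationData : PolyTime
    fun p : ListLanguage × List (List ℕ) × Pins => S.operationData p.1 p.2.1 p.2.2 := by
  unfold operationData
  refine PolyTime.dataOfList (PolyTime.mapConst _ fun s => PolyTime.table _ (by fun_prop) ?_)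
  unfold operation
  have h1 := (S.polyTime_component s).comp'
    (f := fun q : (ListLanguage × List (List ℕ) × Pins) × List (List ℕ × ℕ) =>
      (elements M q.1.1.1 q.1.2.1, q.2)) (by fun_prop)
  have h2 := (S.polyTime_component s).comp'
    (f := fun q : ((ListLanguage × List (List ℕ) × Pins) × List (List ℕ × ℕ)) × List ℕ × ℕ =>
      (elements M q.1.1.1.1 q.1.1.2.1, q.1.2)) (by fun_prop)
  fun_prop

@[fun_prop]
theorem polyTime_test {L : α → ListLanguage} {B : α → List (List ℕ)} {A A' : α → Pins}
    (hL : PolyTime L) (hB : PolyTime B) (hA : PolyTime A) (hA' : PolyTime A') :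
    PolyTime fun a => S.test (L a) (B a) (A a) (A' a) := by
  have h1 := S.polyTime_operationData.comp' (f := fun a => (L a, B a, A a)) (by fun_prop)
  unfold test instanceData
  exact S.polyTime.comp' (by fun_prop)

@[fun_prop]
theorem polyTime_blockPins {b : α → List ℕ} {g : α → Pins} (hb : PolyTime b) (hg : PolyTime g) :
    PolyTime fun a => blockPins (b a) (g a) := by
  unfold blockPins
  fun_prop

@[fun_prop]
theorem polyTime_pinCell {L : α → ListLanguage} {B : α → List (List ℕ)} {A A' : α → Pins}
    {v : α → Cell} (hL : PolyTime L) (hB : PolyTime B) (hA : PolyTime A) (hA' : PolyTime A')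
    (hv : PolyTime v) : PolyTime fun a => S.pinCell (L a) (B a) (A a) (A' a) (v a) := by
  unfold pinCell
  fun_prop

theorem pinCell_value_le (L : ListLanguage) (B : List (List ℕ)) (A A' : Pins) (v : Cell) :
    esize ((v.2.find? fun c => S.test L B A ((v, c) :: A')).getD (v.2.headD 0)) ≤ esize v.2 := by
  have h1 : esize (v.2.headD 0) ≤ esize v.2 := by cases v.2 <;> simp; omega
  cases h : v.2.find? fun c => S.test L B A ((v, c) :: A') with
  | none => exact h1
  | some c => exact (esize_mem (List.mem_of_find?_eq_some h)).le

/-- Each cell adds at most one pin, whose value is no larger than the argument list of the cell,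
whatever the oracle answers. -/
theorem esize_foldl_pinCell (L : ListLanguage) (B : List (List ℕ)) (A : Pins) (l : List Cell)
    (A' : Pins) : esize (l.foldl (S.pinCell L B A) A') ≤ esize A' + 2 * esize l := by
  induction l generalizing A' with
  | nil => simp
  | cons v l ih =>
    refine (ih _).trans ?_
    have : esize (S.pinCell L B A A' v) ≤ esize A' + 2 * esize v + 2 := by
      have := S.pinCell_value_le L B A A' v
      have h : esize v = esize v.1 + esize v.2 + 1 := rfl
      unfold pinCell
      cases covered B v.2
      · simp only [cond_false]; omega
      · simp only [cond_true, esize_cons, esize_prod v] at *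
        omega
    simp only [esize_cons]; omega

@[fun_prop]
theorem polyTime_pinAll {L : α → ListLanguage} {B : α → List (List ℕ)} {A A' : α → Pins}
    (hL : PolyTime L) (hB : PolyTime B) (hA : PolyTime A) (hA' : PolyTime A') :
    PolyTime fun a => S.pinAll (L a) (B a) (A a) (A' a) := by
  have h : PolyTime fun a => cells M (L a).1 := by fun_prop
  exact PolyTime.foldl (f := fun a A' v => S.pinCell (L a) (B a) (A a) A' v) h hA' (by fun_prop)
    ((PolyBounded.of_polyTime hA').add ((PolyBounded.const 2).mul (.of_polyTime h)))
    fun a l hl => (S.esize_foldl_pinCell _ _ _ _ _).trans (by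
      have := esize_sublist hl.sublist
      omega)

@[fun_prop]
theorem polyTime_step {L : α → ListLanguage} {st : α → List (List ℕ) × Pins} {b : α → List ℕ}
    (hL : PolyTime L) (hst : PolyTime st) (hb : PolyTime b) :
    PolyTime fun a => S.step (L a) (st a) (b a) := by
  unfold step
  fun_prop

theorem run_append (L : ListLanguage) (bs : List (List ℕ)) (b : List ℕ) :
    S.run L (bs ++ [b]) = (S.run L bs).bind fun st => S.step L st b := by
  simp [run]

/-- Pins do not accumulate over the blocks: every step restarts from a pattern on one block and then
pins each cell at most once. Only the list of blocks grows, by one per step. The list `all` makes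
the bound independent of the prefix `bs`. -/
theorem esize_run_le (L : ListLanguage) (bs all : List (List ℕ)) (h : ∀ b ∈ bs, b ∈ all) :
    ∀ st, S.run L bs = some st →
      esize st.1 + 1 = esize bs + esize ((List.range L.1).map fun c => [c]) ∧
      esize st.2 ≤ esize (all.flatMap fun b => S.patterns.map fun g => blockPins b g) +
        2 * esize (cells M L.1) := by
  induction bs using List.reverseRecOn with
  | nil =>
    rintro _ ⟨⟩
    have := esize_pos (all.flatMap fun b => S.patterns.map fun g => blockPins b g)
    simp
    omega
  | append_singleton bs b ih =>
    intro st hst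
    rw [run_append, Option.bind_eq_some_iff] at hst
    obtain ⟨st', h1, h2⟩ := hst
    obtain ⟨h3, -⟩ := ih (fun b hb => h b (by simp [hb])) st' h1
    rw [step, Option.map_eq_some_iff] at h2
    obtain ⟨g, h4, rfl⟩ := h2
    refine ⟨?_, (S.esize_foldl_pinCell _ _ _ _ _).trans (Nat.add_le_add_right ?_ _)⟩
    · have := esize_append bs [b]
      simp at *
      omega
    · have : blockPins b g ∈ all.flatMap fun b => S.patterns.map fun g => blockPins b g :=
        List.mem_flatMap.2 ⟨b, h b (by simp), List.mem_map.2
          ⟨g, List.mem_of_find?_eq_some h4, rfl⟩⟩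
      exact (esize_mem this).le

theorem polyTime_output : PolyTime fun L => S.output L := by
  have h1 : PolyTime fun L : ListLanguage => listTuples (List.range L.1) S.width := by fun_prop
  have h2 : PolyTime fun L : ListLanguage => (listTuples (List.range L.1) S.width).flatMap
    fun b => S.patterns.map fun g => blockPins b g := by fun_prop
  have h3 : PolyTime fun L : ListLanguage => cells M L.1 := by fun_prop
  have h4 : PolyTime fun L : ListLanguage => (List.range L.1).map fun c => [c] := by fun_prop
  have hrun : PolyTime fun L => S.run L (listTuples (List.range L.1) S.width) := by
    refine PolyTime.foldl 
      (f := fun L (o : Option (List (List ℕ) × Pins)) b => o.bind fun st => S.step L st b) h1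
      (by fun_prop)
      (by fun_prop) ((PolyBounded.of_polyTime h1).add (.of_polyTime h4) |>.add (.of_polyTime h2)
        |>.add ((PolyBounded.const 2).mul (.of_polyTime h3)) |>.add (.const 3)) ?_
    intro L bs hbs
    have key := S.esize_run_le L bs (listTuples (List.range L.1) S.width) fun b hb => hbs.subset hb
    change esize (S.run L bs) ≤ _
    have := esize_sublist hbs.sublist
    cases h : S.run L bs with
    | none => simp
    | some st =>
      have := key st h
      have h5 : esize st = esize st.1 + esize st.2 + 1 := rfl
      rw [esize_some]
      omega
  unfold output
  refine PolyTime.optionMap hrun (PolyTime.dataOfList (PolyTime.mapConst _ fun s =>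
    PolyTime.table _ (by fun_prop) (by fun_prop)))

end Solver

/-! ### Correctness of the algorithm -/

theorem mem_listTuples {α : Type} {l : List α} {k : ℕ} {x : List α} :
    x ∈ listTuples l k ↔ x.length = k ∧ ∀ c ∈ x, c ∈ l := by
  induction k generalizing x with
  | zero => simp +contextual [listTuples]
  | succ k ih =>
    rcases x with _ | ⟨a, x⟩
    · simp [listTuples]
    · simp [listTuples, ih]
      tauto

theorem mem_cells {M : MaltsevCondition} {d : ℕ} {v : Cell} :
    v ∈ cells M d ↔ ∃ s : Fin M.m, s.val = v.1 ∧ v.2.length = M.arity s ∧ ∀ c ∈ v.2, c < d := by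
  obtain ⟨s, x⟩ := v
  simp only [cells, List.mem_flatMap, List.mem_finRange, true_and, List.mem_map, mem_listTuples,
    List.mem_range, Prod.mk.injEq]
  constructor
  · rintro ⟨s, x, h, rfl, rfl⟩
    exact ⟨s, rfl, h⟩
  · rintro ⟨s, rfl, h⟩
    exact ⟨s, x, h, rfl, rfl⟩

theorem mem_cells_ofFn {M : MaltsevCondition} {d : ℕ} {s : Fin M.m} {y : Fin (M.arity s) → ℕ} :
    (s.val, List.ofFn y) ∈ cells M d ↔ ∀ i, y i < d := by
  rw [mem_cells]
  constructor
  · rintro ⟨-, -, -, h⟩ i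
    exact h _ (by simp)
  · intro h
    exact ⟨s, rfl, by simp, by simpa [List.mem_ofFn] using h⟩

theorem mem_columns {n : ℕ} {T : List (List ℕ)} {k : ℕ} (hT : ∀ r ∈ T, r.length = n)
    {W : List (List ℕ)} : W ∈ columns n T k ↔ ∃ t : Fin k → List ℕ, (∀ i, t i ∈ T) ∧
      W = (List.range n).map fun j => List.ofFn fun i => (t i).getD j 0 := by
  induction k generalizing W with
  | zero =>
    simp [columns]
  | succ k ih =>
    have key : ∀ (r : List ℕ) (t : Fin k → List ℕ), r ∈ T →
        List.zipWith List.cons r ((List.range n).map fun j => List.ofFn fun i => (t i).getD j 0) =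
        (List.range n).map fun j => r.getD j 0 :: List.ofFn fun i => (t i).getD j 0 := by
      intro r t hr
      apply List.ext_getElem
      · simp [hT r hr]
      · intro i h1 h2
        simp at h1 h2
        simp [h1]
    simp only [columns, List.mem_flatMap, List.mem_map, ih]
    constructor
    · rintro ⟨r, hr, _, ⟨t, ht, rfl⟩, rfl⟩
      refine ⟨Fin.cons r t, fun i => Fin.cases hr ht i, ?_⟩
      rw [key r t hr]
      simp [List.ofFn_succ]
    · rintro ⟨t, ht, rfl⟩
      refine ⟨t 0, ht 0, _, ⟨fun i => t i.succ, fun i => ht _, rfl⟩, ?_⟩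
      rw [key _ _ (ht 0)]
      simp [List.ofFn_succ]

section index

variable {α : Type} [DecidableEq α] {l : List α} {a : α}

theorem index_lt (h : a ∈ l) : index l a < l.length :=
  List.findIdx_lt_length_of_exists ⟨a, h, by simp⟩

theorem getElem?_index (h : a ∈ l) : l[index l a]? = some a := by
  have := List.findIdx_getElem (p := fun b => decide (b = a)) (w := index_lt h)
  rw [List.getElem?_eq_getElem (index_lt h)]
  exact congrArg some (of_decide_eq_true this)

theorem index_getElem (hl : l.Nodup) {i : ℕ} (hi : i < l.length) : index l l[i] = i := by
  have h := getElem?_index (List.getElem_mem hi)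
  rw [List.getElem?_eq_getElem (index_lt (List.getElem_mem hi)), Option.some_inj] at h
  exact (List.Nodup.getElem_inj_iff hl).1 h

theorem mem_removeDups : a ∈ removeDups l ↔ a ∈ l := by
  induction l with
  | nil => simp [removeDups]
  | cons b l ih =>
    rw [removeDups, List.foldr_cons]
    change a ∈ (if b ∈ removeDups l then removeDups l else b :: removeDups l) ↔ _
    split_ifs with h
    · rw [ih, List.mem_cons]
      constructor
      · exact Or.inr
      · rintro (rfl | h')
        · exact ih.1 h
        · exact h'
    · rw [List.mem_cons, List.mem_cons, ih]

theorem nodup_removeDups : (removeDups l).Nodup := by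
  induction l with
  | nil => simp [removeDups]
  | cons b l ih =>
    rw [removeDups, List.foldr_cons]
    change (if b ∈ removeDups l then removeDups l else b :: removeDups l).Nodup
    split_ifs with h
    · exact ih
    · exact List.nodup_cons.2 ⟨h, ih⟩

end index

theorem covered_iff {B : List (List ℕ)} {x : List ℕ} :
    covered B x = true ↔ ∃ b ∈ B, ∀ c ∈ x, c ∈ b := by
  simp [covered]

theorem covered_mono {B : List (List ℕ)} {x y : List ℕ} (hx : covered B x = true)
    (h : ∀ c ∈ y, c ∈ x) : covered B y = true := by
  obtain ⟨b, hb, hxb⟩ := covered_iff.1 hx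
  exact covered_iff.2 ⟨b, hb, fun c hc => hxb c (h c hc)⟩

theorem pinOf_cons (v w : Cell) (c : ℕ) (A : Pins) :
    pinOf ((v, c) :: A) w = if v = w then some c else pinOf A w := by
  unfold pinOf
  by_cases h : v = w <;> simp [h]

theorem mem_of_pinOf {A : Pins} {v : Cell} {c : ℕ} (h : pinOf A v = some c) : (v, c) ∈ A := by
  simp only [pinOf, Option.map_eq_some_iff] at h
  obtain ⟨⟨w, c⟩, h1, rfl⟩ := h
  have h2 := List.mem_of_find?_eq_some h1
  have h3 := List.find?_some h1
  simp at h3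
  exact h3 ▸ h2

theorem pinOf_isSome {A : Pins} {v : Cell} : (pinOf A v).isSome = true ↔ ∃ c, (v, c) ∈ A := by
  simp [pinOf]

theorem mem_elements {M : MaltsevCondition} {d : ℕ} {B : List (List ℕ)} {e : List ℕ × ℕ} :
    e ∈ elements M d B ↔ (∃ s, (s, e.1) ∈ cells M d) ∧ covered B e.1 = true ∧ e.2 ∈ e.1 := by
  obtain ⟨X, c⟩ := e
  simp only [elements, mem_removeDups, List.mem_flatMap]
  constructor
  · rintro ⟨⟨s, x⟩, h1, h2⟩
    cases h : covered B x with
    | false => simp [h] at h2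
    | true =>
      simp [h] at h2
      obtain ⟨h2, rfl⟩ := h2
      exact ⟨⟨s, h1⟩, h, h2⟩
  · rintro ⟨⟨s, h1⟩, h2, h3⟩
    exact ⟨(s, X), h1, by simpa [h2] using h3⟩

theorem nodup_elements {M : MaltsevCondition} {d : ℕ} {B : List (List ℕ)} :
    (elements M d B).Nodup := nodup_removeDups

/-- All variables of the identity are less than `w`. -/
def LinearIdentity.VarsLt {m : ℕ} {arity : Fin m → ℕ} (w : ℕ) : LinearIdentity arity → Prop
  | .opOp _ x _ y => (∀ j, x j < w) ∧ ∀ j, y j < w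
  | .opVar _ x v => (∀ j, x j < w) ∧ v < w

/-- The tuples of a listed language have the right length and entries. -/
def ListLanguage.WellFormed (L : ListLanguage) : Prop :=
  ∀ R ∈ L.2, ∀ r ∈ R.2, r.length = R.1 ∧ ∀ c ∈ r, c < L.1

/-! ### The invariant and the preservation of constraints -/

namespace Solver

variable {M : MaltsevCondition} (S : Solver M)

/-- The properties of the parameters that the algorithm relies on. -/
structure Good : Prop where
  pos : ∀ s, 0 < M.arity s
  le_width : ∀ s, M.arity s ≤ S.width
  vars : ∀ e ∈ M.identities, e.VarsLt S.vars
  conservative : ∀ s, IsConservative (S.model s)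
  satisfiedBy : M.SatisfiedBy S.model
  oracle : ∀ (I : Instance) (F : M.Interpretation (Fin I.d)), M.IsPolymorphismTuple I.language F →
    (S.oracle (.cons (encodeInstance I) (encodeInterpretation F)) = true ↔ I.Satisfiable)

/-- The constraint has a tuple that agrees with `h` on all cells from `P`. -/
def _root_.ConservativeCSP.AgreesOn (C : CellConstraint) (P : Cell → Prop) (h : Cell → ℕ) : Prop :=
  ∃ r ∈ C.2, ∀ (j : ℕ) v, C.1[j]? = some v → P v → r[j]? = some (h v)

/-- The table `A` gives conservative operations that satisfy all constraints as far as these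
concern covered cells. -/
structure Inv (L : ListLanguage) (B : List (List ℕ)) (A : Pins) : Prop where
  conservative : ∀ v ∈ cells M L.1, value A v ∈ v.2
  agrees : ∀ C ∈ cellConstraints M S.vars L, AgreesOn C (fun v => covered B v.2 = true) (value A)
  singles : ∀ c < L.1, [c] ∈ B

/-- The partial assignment `A` extends to all covered cells. -/
def Extends (L : ListLanguage) (B : List (List ℕ)) (A : Pins) : Prop :=
  ∃ h : Cell → ℕ, (∀ v ∈ cells M L.1, h v ∈ v.2) ∧ (∀ v c, pinOf A v = some c → h v = c) ∧
    ∀ C ∈ cellConstraints M S.vars L,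
      AgreesOn C (fun v => (pinOf A v).isSome = true ∨ covered B v.2 = true) h

/-- The partial assignment takes values among the arguments. -/
def _root_.ConservativeCSP.PinsConservative (M : MaltsevCondition) (d : ℕ) (A : Pins) : Prop :=
  ∀ e ∈ A, e.1 ∈ cells M d ∧ e.2 ∈ e.1.2

variable {S}

theorem Good.model_const (hS : S.Good) (s : Fin M.m) (b : Bool) : S.model s (fun _ => b) = b :=
  (hS.conservative s _).choose_spec

/-- Set the variables of the left side to true and all others to false. The model returns true on
the left by conservativity, hence also on the right, so a variable of the right side is true. This
makes identities hold on one-element blocks. -/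
theorem Good.exists_mem_of_opOp (hS : S.Good) {f g : Fin M.m} {x : Fin (M.arity f) → ℕ}
    {y : Fin (M.arity g) → ℕ} (h : .opOp f x g y ∈ M.identities) : ∃ i j, x i = y j := by
  classical
  have h1 := hS.satisfiedBy _ h fun n => decide (n ∈ Set.range x)
  have h2 : (fun j => decide (x j ∈ Set.range x)) = fun _ => true := by simp
  rw [h2, hS.model_const] at h1
  obtain ⟨j, hj⟩ := hS.conservative g fun j => decide (y j ∈ Set.range x)
  rw [← h1] at hj
  simp at hj
  obtain ⟨i, hi⟩ := hj
  exact ⟨i, j, hi⟩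

theorem Good.exists_mem_of_opVar (hS : S.Good) {f : Fin M.m} {x : Fin (M.arity f) → ℕ}
    {v : ℕ} (h : .opVar f x v ∈ M.identities) : ∃ i, x i = v := by
  classical
  have h1 := hS.satisfiedBy _ h fun n => decide (n ∈ Set.range x)
  have h2 : (fun j => decide (x j ∈ Set.range x)) = fun _ => true := by simp
  rw [h2, hS.model_const] at h1
  simpa using h1.symm

theorem wellFormed_constraint (hS : S.Good) {L : ListLanguage} (hL : L.WellFormed)
    {C : CellConstraint} (hC : C ∈ cellConstraints M S.vars L) :
    (∀ v ∈ C.1, v ∈ cells M L.1) ∧ ∀ r ∈ C.2, r.length = C.1.length ∧ ∀ c ∈ r, c < L.1 := by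
  rcases List.mem_append.1 hC with hC | hC
  · simp only [polymorphismConstraints, List.mem_flatMap, List.mem_map] at hC
    obtain ⟨R, hR, s, -, W, hW, rfl⟩ := hC
    obtain ⟨t, ht, rfl⟩ := (mem_columns fun r hr => (hL R hR r hr).1).1 hW
    refine ⟨?_, fun r hr => ⟨by simpa using (hL R hR r hr).1, (hL R hR r hr).2⟩⟩
    simp only [List.mem_map, List.mem_range, exists_exists_and_eq_and, forall_exists_index, and_imp,
      forall_apply_eq_imp_iff₂]
    intro j hj
    refine mem_cells_ofFn.2 fun i => (hL R hR _ (ht i)).2 _ ?_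
    rw [List.getD_eq_getElem _ _ (by rwa [(hL R hR _ (ht i)).1])]
    exact List.getElem_mem _
  · simp only [identityConstraints, List.mem_flatMap, List.mem_map, mem_listTuples] at hC
    obtain ⟨e, he, ρ, ⟨hρ, hρ'⟩, rfl⟩ := hC
    have hv := hS.vars e he
    have key : ∀ n < S.vars, ρ.getD n 0 < L.1 := by
      intro n hn
      rw [List.getD_eq_getElem _ _ (by rwa [hρ])]
      exact List.mem_range.1 (hρ' _ (List.getElem_mem _))
    cases e with
    | opOp f x g y =>
      simp only [identityConstraint, List.map_ofFn, List.mem_cons, List.not_mem_nil, or_false,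
        forall_eq_or_imp, forall_eq, mem_cells_ofFn, List.mem_map, List.mem_range,
        forall_exists_index, and_imp, forall_apply_eq_imp_iff₂]
      exact ⟨⟨fun i => key _ (hv.1 i), fun i => key _ (hv.2 i)⟩, fun c hc => ⟨rfl, hc, hc⟩⟩
    | opVar f x v =>
      simp only [identityConstraint, List.map_ofFn, List.mem_cons, List.not_mem_nil, or_false,
        forall_eq, mem_cells_ofFn]
      exact ⟨fun i => key _ (hv.1 i), rfl, key _ hv.2⟩

theorem headD_mem {x : List ℕ} (h : 0 < x.length) (a : ℕ) : x.headD a ∈ x := by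
  cases x with
  | nil => simp at h
  | cons => simp

theorem Good.headD_mem (hS : S.Good) {d : ℕ} {v : Cell} (hv : v ∈ cells M d) (a : ℕ) :
    v.2.headD a ∈ v.2 := by
  obtain ⟨s, -, h, -⟩ := mem_cells.1 hv
  exact Solver.headD_mem (h ▸ hS.pos s) a

/-- Conservativity implies idempotence; this is why pinning a cell to a constant keeps the relations
invariant. -/
theorem Inv.value_replicate {L : ListLanguage} {B : List (List ℕ)} {A : Pins} (h : S.Inv L B A)
    (s : Fin M.m) {c : ℕ} (hc : c < L.1) (y : Fin (M.arity s) → ℕ) (hy : ∀ i, y i = c) :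
    value A (s.val, List.ofFn y) = c := by
  have := h.conservative (s.val, List.ofFn y) (mem_cells_ofFn.2 fun i => by rwa [hy])
  simp only [List.mem_ofFn] at this
  obtain ⟨i, hi⟩ := this
  rw [← hi, hy]

/-- The relations of all constraints are preserved as far as covered columns are concerned. -/
theorem Inv.exists_tuple (hS : S.Good) {L : ListLanguage} (hL : L.WellFormed)
    {B : List (List ℕ)} {A : Pins} (h : S.Inv L B A) {C : CellConstraint}
    (hC : C ∈ cellConstraints M S.vars L) (s : Fin M.m) (t : Fin (M.arity s) → List ℕ)
    (ht : ∀ i, t i ∈ C.2) : ∃ r ∈ C.2, ∀ j < C.1.length,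
      covered B (List.ofFn fun i => (t i).getD j 0) = true →
        r[j]? = some (value A (s.val, List.ofFn fun i => (t i).getD j 0)) := by
  rcases List.mem_append.1 hC with hC | hC
  · simp only [polymorphismConstraints, List.mem_flatMap, List.mem_map] at hC
    obtain ⟨R, hR, s', -, W, hW, rfl⟩ := hC
    have hn : ∀ r ∈ R.2, r.length = R.1 := fun r hr => (hL R hR r hr).1
    obtain ⟨t', ht', rfl⟩ := (mem_columns hn).1 hW
    -- The symbol in `C` may differ from `s`. The rows `t` and the symbol `s` give another
    -- constraint of the list with the same relation, and the invariant is applied to that one.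
    have hW2 := (mem_columns (k := M.arity s) hn).2 ⟨t, ht, rfl⟩
    have hC2 : (((List.range R.1).map fun j => List.ofFn fun i => (t i).getD j 0).map
        fun x => (s.val, x), R.2) ∈ cellConstraints M S.vars L := by
      refine List.mem_append_left _ ?_
      simp only [polymorphismConstraints, List.mem_flatMap, List.mem_map]
      exact ⟨R, hR, s, List.mem_finRange _, _, hW2, rfl⟩
    obtain ⟨r, hr, hr'⟩ := h.agrees _ hC2
    refine ⟨r, hr, fun j hj hcov => hr' j _ ?_ hcov⟩
    simp at hj
    simp [hj]
  · simp only [identityConstraints, List.mem_flatMap, List.mem_map, mem_listTuples] at hC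
    obtain ⟨e, he, ρ, ⟨hρ, hρ'⟩, rfl⟩ := hC
    cases e with
    | opOp f x g y =>
      simp only [identityConstraint, List.mem_map, List.mem_range] at ht ⊢
      choose c hc hct using ht
      -- The relation is equality, so both columns coincide; conservativity keeps the result in the
      -- domain.
      have hmem := h.conservative (s.val, List.ofFn c) (mem_cells_ofFn.2 hc)
      simp only [List.mem_ofFn] at hmem
      obtain ⟨i, hi⟩ := hmem
      refine ⟨_, ⟨_, hc i, rfl⟩, fun j hj _ => ?_⟩
      simp at hj
      interval_cases j <;> simp [← hct, hi]
    | opVar f x v =>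
      simp only [identityConstraint, List.mem_singleton] at ht ⊢
      refine ⟨_, rfl, fun j hj _ => ?_⟩
      simp at hj
      subst hj
      have hv := (hS.vars _ he).2
      have hlt : ρ.getD v 0 < L.1 := by
        rw [List.getD_eq_getElem _ _ (by rwa [hρ])]
        exact List.mem_range.1 (hρ' _ (List.getElem_mem _))
      rw [h.value_replicate s hlt]
      · simp
      · simp [ht]

end Solver

/-! ### From lists of numbers to typed tuples and operations -/

theorem exists_tuple_of_list {k n : ℕ} {l : List ℕ} (hl : l.length = k) (h : ∀ c ∈ l, c < n) :
    ∃ t : Fin k → Fin n, (List.ofFn fun i => (t i).val) = l := by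
  subst hl
  exact ⟨fun i => ⟨l[i], h _ (List.getElem_mem _)⟩, by simp⟩

theorem exists_tuples_of_lists {k n : ℕ} {T : List (List ℕ)}
    (h : ∀ l ∈ T, l.length = k ∧ ∀ c ∈ l, c < n) :
    ∃ ts : List (Fin k → Fin n), (ts.map fun t => List.ofFn fun i => (t i).val) = T := by
  induction T with
  | nil => exact ⟨[], rfl⟩
  | cons l T ih =>
    obtain ⟨ts, hts⟩ := ih fun l hl => h l (by simp [hl])
    obtain ⟨t, ht⟩ := exists_tuple_of_list (h l (by simp)).1 (h l (by simp)).2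
    exact ⟨t :: ts, by simp [ht, hts]⟩

theorem encodeTuple_eq {k n : ℕ} (t : Fin k → Fin n) :
    encodeTuple t = enc (List.ofFn fun i => (t i).val) := by
  simp only [encodeTuple, enc, List.map_ofFn]
  rfl

theorem encodeRelation_eq {d : ℕ} (R : TableRelation d) :
    encodeRelation R = enc (R.arity, R.tuples.map fun t => List.ofFn fun i => (t i).val) := by
  simp only [encodeRelation]
  have : R.tuples.map encodeTuple =
      (R.tuples.map fun t => List.ofFn fun i => (t i).val).map enc := by
    simp [encodeTuple_eq]
  rw [this]
  rfl

theorem mem_tuples_iff {k n : ℕ} {ts : List (Fin k → Fin n)} {t : Fin k → Fin n} :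
    t ∈ ts ↔ (List.ofFn fun i => (t i).val) ∈ ts.map fun t => List.ofFn fun i => (t i).val := by
  rw [List.mem_map_of_injective]
  intro t t' h
  have := List.ofFn_injective h
  funext i
  exact Fin.ext (congrFun this i)

/-- Positions in `l` stand for the elements of `Fin d`; induction on the arity compares the two
nested arrays. -/
theorem encodeOperation_eq {α : Type} {l : List α} {d : ℕ} (hd : l.length = d) {a : ℕ}
    (F : (Fin a → Fin d) → Fin d) (g : List α → ℕ)
    (h : ∀ y, (F y).val = g (List.ofFn fun i => l[(y i).val]'(hd ▸ (y i).isLt))) :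
    encodeOperation F = table l a g := by
  induction a generalizing g with
  | zero =>
    simp only [encodeOperation, table]
    rw [h]
    simp
  | succ a ih =>
    simp only [encodeOperation, table]
    congr 1
    subst hd
    apply List.ext_getElem (by simp)
    intro i h1 h2
    simp only [List.getElem_ofFn, List.getElem_map]
    apply ih
    intro y
    rw [h]
    simp [List.ofFn_succ]

/-! ### Operations on the disjoint union -/

namespace Solver

variable {M : MaltsevCondition} {S : Solver M} {L : ListLanguage} {B : List (List ℕ)} {A A' : Pins}

/-- The model sees constant bits and is idempotent, so it accepts exactly the common component. -/
theorem component_eq (hS : S.Good) {E : List (List ℕ × ℕ)} (s : Fin M.m) {X : List ℕ}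
    (c : Fin (M.arity s) → ℕ) (hX : ∃ b, (X, b) ∈ E) :
    S.component E s (List.ofFn fun i => (X, c i)) = X := by
  have h1 : ∀ Y, (S.model s fun i => ((List.ofFn fun i => (X, c i)).map
      fun e => decide (e.1 = Y)).getD i false) = decide (X = Y) := by
    intro Y
    rw [← hS.model_const s (decide (X = Y))]
    congr 1
    funext i
    simp [List.getD_eq_getElem?_getD]
  unfold component
  simp only [h1]
  have h2 : (E.map Prod.fst).find? (fun Y => decide (X = Y)) = some X := by
    cases h : (E.map Prod.fst).find? (fun Y => decide (X = Y)) with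
    | none =>
      obtain ⟨b, hb⟩ := hX
      have := List.find?_eq_none.1 h X (List.mem_map.2 ⟨_, hb, rfl⟩)
      simp at this
    | some Y =>
      have := List.find?_some h
      simp at this
      rw [this]
  rw [h2]
  rfl

theorem operation_eq (hS : S.Good) {E : List (List ℕ × ℕ)} (s : Fin M.m) {X : List ℕ}
    (c : Fin (M.arity s) → ℕ) (hX : ∃ b, (X, b) ∈ E) :
    S.operation E A s (List.ofFn fun i => (X, c i)) = (X, value A (s.val, List.ofFn c)) := by
  unfold operation
  rw [component_eq hS s c hX]
  simp [List.map_ofFn, Function.comp_def]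

theorem component_mem {E : List (List ℕ × ℕ)} (hE : E ≠ []) (s : Fin M.m)
    (es : List (List ℕ × ℕ)) : ∃ b, (S.component E s es, b) ∈ E := by
  unfold component
  cases h : (E.map Prod.fst).find? fun X => S.model s fun i =>
    (es.map fun e => decide (e.1 = X)).getD i false with
  | none =>
    cases E with
    | nil => simp at hE
    | cons e E => exact ⟨e.2, by simp⟩
  | some X =>
    obtain ⟨e, he, rfl⟩ := List.mem_map.1 (List.mem_of_find?_eq_some h)
    exact ⟨e.2, he⟩

/-- Replacing elements of other components keeps us in the component `X`. -/
theorem retract_mem (hS : S.Good) {d : ℕ} {X : List ℕ} (hX : ∃ b, (X, b) ∈ elements M d B)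
    {e : List ℕ × ℕ} (he : e ∈ elements M d B) :
    (bif decide (e.1 = X) then e.2 else X.headD 0) ∈ X := by
  by_cases h : e.1 = X
  · simpa [h] using h ▸ (mem_elements.1 he).2.2
  · obtain ⟨b, hb⟩ := hX
    obtain ⟨⟨s, hs⟩, -⟩ := mem_elements.1 hb
    simpa [h] using hS.headD_mem hs 0

theorem lt_of_mem_element {d : ℕ} {X : List ℕ} (hX : ∃ b, (X, b) ∈ elements M d B)
    {c : ℕ} (hc : c ∈ X) : c < d := by
  obtain ⟨b, hb⟩ := hX
  obtain ⟨⟨s, hs⟩, -⟩ := mem_elements.1 hb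
  obtain ⟨-, -, -, h⟩ := mem_cells.1 hs
  exact h c hc

theorem Inv.operation_mem (hS : S.Good) (h : S.Inv L B A) (s : Fin M.m)
    (es : Fin (M.arity s) → List ℕ × ℕ) (hes : ∀ i, es i ∈ elements M L.1 B) :
    S.operation (elements M L.1 B) A s (List.ofFn es) ∈ elements M L.1 B := by
  have hne : elements M L.1 B ≠ [] := List.ne_nil_of_mem (hes ⟨0, hS.pos s⟩)
  have hX := component_mem (S := S) hne s (List.ofFn es)
  obtain ⟨b, hb⟩ := hX
  obtain ⟨hb1, hb2, -⟩ := mem_elements.1 hb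
  refine mem_elements.2 ⟨hb1, hb2, ?_⟩
  simp only [operation, List.map_ofFn]
  -- After retraction all arguments lie in the selected component, and a conservative value stays
  -- there.
  have hr := fun i => retract_mem hS ⟨b, hb⟩ (hes i)
  have := h.conservative (s.val, List.ofFn fun i =>
    bif decide ((es i).1 = S.component (elements M L.1 B) s (List.ofFn es)) then (es i).2 else
      (S.component (elements M L.1 B) s (List.ofFn es)).headD 0)
    (mem_cells_ofFn.2 fun i => lt_of_mem_element ⟨b, hb⟩ (hr i))
  simp only [List.mem_ofFn] at this
  obtain ⟨i, hi⟩ := this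
  have h2 := hr i
  rw [hi] at h2
  exact h2

/-- The operations on the values of the instance. -/
def Inv.interpretation (hS : S.Good) (h : S.Inv L B A) :
    M.Interpretation (Fin (elements M L.1 B).length) := fun s y =>
  ⟨index (elements M L.1 B) (S.operation (elements M L.1 B) A s
    (List.ofFn fun i => (elements M L.1 B)[y i])),
    index_lt (h.operation_mem hS s _ fun _ => List.getElem_mem _)⟩

theorem Inv.encodeInterpretation_eq (hS : S.Good) (h : S.Inv L B A) :
    encodeInterpretation (h.interpretation hS) = S.operationData L B A := by
  unfold encodeInterpretation operationData
  rw [List.ofFn_eq_map]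
  congr 1
  apply List.map_congr_left
  intro s _
  exact encodeOperation_eq rfl _ _ fun y => rfl

/-- The model turns the two sides of an identity into equal selections of components. Retracting the
assignment into the selected `X` gives an instance of the same identity over `X`; its cells are
covered, so `A` satisfies it. -/
theorem Inv.satisfiedBy (hS : S.Good) (h : S.Inv L B A) :
    M.SatisfiedBy (h.interpretation hS) := by
  intro e he
  have hq := hS.satisfiedBy e he
  have hv := hS.vars e he
  set E := elements M L.1 B with hE
  have hcomp : ∀ (s : Fin M.m) (x : Fin (M.arity s) → ℕ) (ρ : ℕ → Fin E.length) (X : List ℕ),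
      (S.model s fun i => ((List.ofFn fun i => E[ρ (x i)]).map
        fun e => decide (e.1 = X)).getD i false) = S.model s fun i => decide (E[ρ (x i)].1 = X) := by
    intro s x ρ X
    congr 1
    funext i
    simp [List.getD_eq_getElem?_getD]
  -- The retracted assignment takes values in `X`, so its identity instance is among the listed
  -- constraints.
  have hinst : ∀ (ρ : ℕ → Fin E.length) (X : List ℕ), (∃ b, (X, b) ∈ E) →
      identityConstraint L.1 ((List.range S.vars).map fun n =>
        bif decide (E[ρ n].1 = X) then E[ρ n].2 else X.headD 0) e ∈ cellConstraints M S.vars L := by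
    intro ρ X hX
    refine List.mem_append_right _ ?_
    simp only [identityConstraints, List.mem_flatMap, List.mem_map, mem_listTuples]
    refine ⟨e, he, _, ⟨by simp, ?_⟩, rfl⟩
    simp only [List.mem_map, List.mem_range, forall_exists_index, and_imp,
      forall_apply_eq_imp_iff₂]
    exact fun n _ => lt_of_mem_element hX (retract_mem hS hX (List.getElem_mem _))
  have hget : ∀ {a : ℕ} (x : Fin a → ℕ) (hx : ∀ i, x i < S.vars) (f : ℕ → ℕ),
      ((List.ofFn x).map fun i => ((List.range S.vars).map f).getD i 0) =
        List.ofFn fun i => f (x i) := by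
    intro a x hx f
    simp only [List.map_ofFn]
    congr 1
    funext i
    simp [List.getD_eq_getElem?_getD, hx]
  have hcov : ∀ (ρ : ℕ → Fin E.length) (X : List ℕ), (∃ b, (X, b) ∈ E) → ∀ {a : ℕ}
      (x : Fin a → ℕ), covered B (List.ofFn fun i =>
        bif decide (E[ρ (x i)].1 = X) then E[ρ (x i)].2 else X.headD 0) = true := by
    intro ρ X hX a x
    obtain ⟨b, hb⟩ := hX
    refine covered_mono (mem_elements.1 hb).2.1 ?_
    simp only [List.mem_ofFn, forall_exists_index, forall_apply_eq_imp_iff]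
    exact fun i => retract_mem hS ⟨b, hb⟩ (List.getElem_mem _)
  cases e with
  | opOp f x g y =>
    intro ρ
    apply Fin.ext
    change index E (S.operation E A f (List.ofFn fun i => E[ρ (x i)])) =
      index E (S.operation E A g (List.ofFn fun i => E[ρ (y i)]))
    have hX : S.component E f (List.ofFn fun i => E[ρ (x i)]) =
        S.component E g (List.ofFn fun i => E[ρ (y i)]) := by
      unfold component
      simp only [hcomp]
      congr 2
      funext X
      exact hq fun n => decide (E[ρ n].1 = X)
    have hXE := component_mem (S := S) (List.ne_nil_of_mem (List.getElem_mem (ρ 0).isLt)) f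
      (List.ofFn fun i => E[ρ (x i)])
    unfold operation
    rw [← hX]
    generalize S.component E f (List.ofFn fun i => E[ρ (x i)]) = X at hXE
    obtain ⟨r, hr, hr'⟩ := h.agrees _ (hinst ρ X hXE)
    simp only [identityConstraint, hget x hv.1, hget y hv.2] at hr hr'
    obtain ⟨c, -, rfl⟩ := List.mem_map.1 hr
    have h1 := hr' 0 _ rfl (hcov ρ X hXE x)
    have h2 := hr' 1 _ rfl (hcov ρ X hXE y)
    simp only [List.getElem?_cons_zero, List.getElem?_cons_succ, Option.some_inj] at h1 h2
    simp only [List.map_ofFn, Function.comp_def]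
    rw [← h1, ← h2]
  | opVar f x v =>
    intro ρ
    apply Fin.ext
    change index E (S.operation E A f (List.ofFn fun i => E[ρ (x i)])) = (ρ v).val
    have hXE : ∃ b, (E[ρ v].1, b) ∈ E := ⟨E[ρ v].2, List.getElem_mem _⟩
    have hX : S.component E f (List.ofFn fun i => E[ρ (x i)]) = E[ρ v].1 := by
      -- By the identity in the model, the accepted component is that of the variable on the right;
      -- no fallback occurs and this variable is not moved by the retraction.
      have h1 : ∀ X, (S.model f fun i => decide (E[ρ (x i)].1 = X)) = decide (E[ρ v].1 = X) :=
        fun X => hq fun n => decide (E[ρ n].1 = X)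
      have h2 := component_eq hS f (fun _ => 0) hXE
      rw [← h2]
      unfold component
      simp only [hcomp, h1]
      congr 2
      funext X
      rw [← hS.model_const f (decide (E[ρ v].1 = X))]
      congr 1
      funext i
      simp [List.getD_eq_getElem?_getD]
    unfold operation
    rw [hX]
    obtain ⟨r, hr, hr'⟩ := h.agrees _ (hinst ρ _ hXE)
    simp only [identityConstraint, hget x hv.1, List.mem_singleton] at hr hr'
    have h1 := hr' 0 _ rfl (hcov ρ _ hXE x)
    simp only [hr, List.getElem?_cons_zero, Option.some_inj] at h1
    simp only [List.map_ofFn, Function.comp_def]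
    rw [← h1]
    have h2 : ((List.range S.vars).map fun n =>
        bif decide (E[ρ n].1 = E[ρ v].1) then E[ρ n].2 else E[ρ v].1.headD 0).getD v 0 =
          E[ρ v].2 := by
      simp [List.getD_eq_getElem?_getD, hv.2]
    rw [h2]
    exact index_getElem nodup_elements (ρ v).isLt

end Solver

/-! ### The oracle's instance and its meaning -/

namespace Solver

variable {M : MaltsevCondition} {S : Solver M} {L : ListLanguage} {B : List (List ℕ)} {A A' : Pins}

/-- Ensures that the dummy value 0 exists. The witness is a constant argument list, covered by a
one-element block. -/
theorem Good.elements_pos (hS : S.Good) {d : ℕ} (hB : ∀ c < d, [c] ∈ B) {v : Cell}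
    (hv : v ∈ cells M d) : 0 < (elements M d B).length := by
  have h1 := hS.headD_mem hv 0
  obtain ⟨s, -, -, h2⟩ := mem_cells.1 hv
  have h3 := h2 _ h1
  refine List.length_pos_of_mem (a := (List.ofFn fun _ : Fin (M.arity s) => v.2.headD 0,
    v.2.headD 0)) (mem_elements.2 ⟨⟨s, mem_cells_ofFn.2 fun _ => h3⟩, ?_, ?_⟩)
  · refine covered_iff.2 ⟨_, hB _ h3, ?_⟩
    simp
  · rw [List.mem_ofFn]
    exact ⟨⟨0, hS.pos s⟩, rfl⟩

theorem mem_elements_of_isFree {d : ℕ} {v : Cell} {c : ℕ} (hv : v ∈ cells M d)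
    (hf : isFree B A v = true) (hc : c ∈ v.2) : (v.2, c) ∈ elements M d B := by
  simp only [isFree, Bool.and_eq_true] at hf
  exact mem_elements.2 ⟨⟨v.1, hv⟩, hf.2, hc⟩

theorem mem_of_allowed {v : Cell} {c : ℕ} (hf : isFree B A v = true)
    (hc : allowed B A v c = true) : c ∈ v.2 := by
  simp only [isFree, Bool.and_eq_true] at hf
  cases h : pinOf A v with
  | some c' => simp [h] at hf
  | none => simpa [allowed, h, hf.2] using hc

theorem code_lt (hS : S.Good) {d : ℕ} (hB : ∀ c < d, [c] ∈ B) {v : Cell} {c : ℕ}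
    (hv : v ∈ cells M d) (hc : allowed B A v c = true) :
    code (elements M d B) B A v c < (elements M d B).length := by
  unfold code
  cases hf : isFree B A v with
  | false => exact hS.elements_pos hB hv
  | true => exact index_lt (mem_elements_of_isFree hv hf (mem_of_allowed hf hc))

theorem mem_codedTuples {E : List (List ℕ × ℕ)} {C : CellConstraint} {l : List ℕ} :
    l ∈ codedTuples E B A C ↔ ∃ r ∈ C.2, (∀ (j : ℕ) v c, C.1[j]? = some v → r[j]? = some c →
      allowed B A v c = true) ∧ List.zipWith (code E B A) C.1 r = l := by
  simp only [codedTuples, List.mem_map, List.mem_filter, List.all_eq_true, and_assoc]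
  refine exists_congr fun r => and_congr_right fun _ => and_congr_left fun _ => ?_
  constructor
  · intro h j v c hv hc
    exact h (v, c) (List.mem_of_getElem? (List.getElem?_zip_eq_some.2 ⟨hv, hc⟩))
  · rintro h ⟨v, c⟩ hvc
    obtain ⟨j, hj⟩ := List.mem_iff_getElem?.1 hvc
    obtain ⟨h1, h2⟩ := List.getElem?_zip_eq_some.1 hj
    exact h j v c h1 h2

theorem codedTuples_bounds (hS : S.Good) (hL : L.WellFormed) (hB : ∀ c < L.1, [c] ∈ B)
    {C : CellConstraint} (hC : C ∈ cellConstraints M S.vars L) :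
    ∀ l ∈ codedTuples (elements M L.1 B) B A C,
      l.length = C.1.length ∧ ∀ c ∈ l, c < (elements M L.1 B).length := by
  obtain ⟨h1, h2⟩ := wellFormed_constraint hS hL hC
  intro l hl
  obtain ⟨r, hr, hall, rfl⟩ := mem_codedTuples.1 hl
  refine ⟨by simp [(h2 r hr).1], fun c hc => ?_⟩
  obtain ⟨j, hj⟩ := List.mem_iff_getElem?.1 hc
  rw [List.getElem?_zipWith_eq_some] at hj
  obtain ⟨v, c', hv, hc', rfl⟩ := hj
  exact code_lt hS hB (h1 v (List.mem_of_getElem? hv)) (hall j v c' hv hc')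

/-- The constraint of the instance that a constraint on cells gives rise to. -/
structure Codes (L : ListLanguage) (B : List (List ℕ)) (A : Pins) (C : CellConstraint)
    (c : Constraint (cells M L.1).length (elements M L.1 B).length) : Prop where
  arity : c.rel.arity = C.1.length
  scope : (List.ofFn fun i => (c.scope i).val) = C.1.map (index (cells M L.1))
  tuples : (c.rel.tuples.map fun t => List.ofFn fun i => (t i).val) =
    codedTuples (elements M L.1 B) B A C

theorem exists_codes (hS : S.Good) (hL : L.WellFormed) (hB : ∀ c < L.1, [c] ∈ B)
    {C : CellConstraint} (hC : C ∈ cellConstraints M S.vars L) :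
    ∃ c : Constraint (cells M L.1).length (elements M L.1 B).length, Codes L B A C c := by
  obtain ⟨ts, hts⟩ := exists_tuples_of_lists (codedTuples_bounds (A := A) hS hL hB hC)
  obtain ⟨sc, hsc⟩ := exists_tuple_of_list (k := C.1.length) (n := (cells M L.1).length)
    (l := C.1.map (index (cells M L.1))) (by simp) (by
      simp only [List.mem_map, forall_exists_index, and_imp, forall_apply_eq_imp_iff₂]
      exact fun v hv => index_lt ((wellFormed_constraint hS hL hC).1 v hv))
  exact ⟨⟨⟨C.1.length, ts⟩, sc⟩, rfl, hsc, hts⟩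

theorem exists_instance (hS : S.Good) (hL : L.WellFormed) (hB : ∀ c < L.1, [c] ∈ B) (A : Pins) :
    ∃ cs : List (Constraint (cells M L.1).length (elements M L.1 B).length),
      List.Forall₂ (Codes L B A) (cellConstraints M S.vars L) cs := by
  have key : ∀ l : List CellConstraint, (∀ C ∈ l, C ∈ cellConstraints M S.vars L) →
      ∃ cs : List (Constraint (cells M L.1).length (elements M L.1 B).length),
        List.Forall₂ (Codes L B A) l cs := by
    intro l hl
    induction l with
    | nil => exact ⟨[], .nil⟩
    | cons C l ih =>
      obtain ⟨cs, hcs⟩ := ih fun C hC => hl C (by simp [hC])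
      obtain ⟨c, hc⟩ := exists_codes (A := A) hS hL hB (hl C (by simp))
      exact ⟨c :: cs, .cons hc hcs⟩
  exact key _ fun _ h => h

/-- The tree written by the algorithm is the code of a genuine typed instance, so the guarantee on
the oracle applies to it. -/
theorem encodeInstance_eq
    {cs : List (Constraint (cells M L.1).length (elements M L.1 B).length)}
    (h : List.Forall₂ (Codes L B A) (cellConstraints M S.vars L) cs) :
    encodeInstance ⟨_, _, cs⟩ = S.instanceData L B A := by
  have h1 : cs.map encodeConstraint = ((cellConstraints M S.vars L).map fun C =>
      (C.1.map (index (cells M L.1)), C.1.length,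
        codedTuples (elements M L.1 B) B A C)).map enc := by
    generalize cellConstraints M S.vars L = l at h
    induction h with
    | nil => rfl
    | cons hc _ ih =>
      simp only [List.map_cons, ih]
      congr 1
      rw [encodeConstraint, encodeTuple_eq, encodeRelation_eq, hc.scope, hc.tuples, hc.arity]
      rfl
  rw [encodeInstance, h1]
  rfl

theorem forall₂_exists_left {α β : Type} {R : α → β → Prop} {l : List α} {m : List β}
    (h : List.Forall₂ R l m) {b : β} (hb : b ∈ m) : ∃ a ∈ l, R a b := by
  induction h with
  | nil => simp at hb
  | cons h _ ih =>
    rcases List.mem_cons.1 hb with rfl | hb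
    · exact ⟨_, by simp, h⟩
    · obtain ⟨a, ha, hab⟩ := ih hb
      exact ⟨a, by simp [ha], hab⟩

theorem forall₂_exists_right {α β : Type} {R : α → β → Prop} {l : List α} {m : List β}
    (h : List.Forall₂ R l m) {a : α} (ha : a ∈ l) : ∃ b ∈ m, R a b :=
  forall₂_exists_left h.flip ha

theorem ofFn_eq_zipWith {k : ℕ} {y : Fin k → ℕ} {vs : List Cell} {r : List ℕ}
    {f : Cell → ℕ → ℕ} (hk : k = vs.length) (hr : r.length = vs.length)
    (h : ∀ (i : Fin k) v c, vs[i.val]? = some v → r[i.val]? = some c → y i = f v c) :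
    List.zipWith f vs r = List.ofFn y := by
  subst hk
  apply List.ext_getElem
  · simp [hr]
  · intro i h1 h2
    simp only [List.length_ofFn] at h2
    simp only [List.getElem_zipWith, List.getElem_ofFn]
    refine (h ⟨i, h2⟩ _ _ ?_ ?_).symm
    · simp [h2]
    · simp [hr, h2]

/-- Lift the coded tuples to rows of the original relation and take the row `r'` that `A` produces
on covered columns. At a pinned cell the column is constant and `A` fixes it; at a free cell the
column lies in the covered list of the cell; elsewhere only the dummy value occurs. So `r'` is
allowed and its code is the componentwise result. The pins `A'` need not come from `A`. -/
theorem Inv.interpretation_mem (hS : S.Good) (hL : L.WellFormed) (h : S.Inv L B A)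
    {cs : List (Constraint (cells M L.1).length (elements M L.1 B).length)}
    (hcs : List.Forall₂ (Codes L B A') (cellConstraints M S.vars L) cs) (s : Fin M.m)
    {c : Constraint (cells M L.1).length (elements M L.1 B).length} (hc : c ∈ cs)
    (t : Fin (M.arity s) → Fin c.rel.arity → Fin (elements M L.1 B).length)
    (ht : ∀ i, t i ∈ c.rel.tuples) :
    (fun j => h.interpretation hS s fun i => t i j) ∈ c.rel.tuples := by
  obtain ⟨C, hC, hCc⟩ := forall₂_exists_left hcs hc
  obtain ⟨hC1, hC2⟩ := wellFormed_constraint hS hL hC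
  have ht' : ∀ i, ∃ r ∈ C.2, (∀ (j : ℕ) v c, C.1[j]? = some v → r[j]? = some c →
      allowed B A' v c = true) ∧ List.zipWith (code (elements M L.1 B) B A') C.1 r =
        List.ofFn fun j => (t i j).val := by
    intro i
    have := mem_tuples_iff.1 (ht i)
    rw [hCc.tuples] at this
    exact mem_codedTuples.1 this
  choose r hr hall hzip using ht'
  obtain ⟨r', hr', hval⟩ := h.exists_tuple hS hL hC s r hr
  rw [mem_tuples_iff, hCc.tuples, mem_codedTuples]
  have hcoord : ∀ (j : Fin c.rel.arity) v, C.1[j.val]? = some v →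
      (covered B (List.ofFn fun i => (r i).getD j 0) = true → r'[j.val]? =
        some (value A (s.val, List.ofFn fun i => (r i).getD j 0))) ∧
      (∀ i, (r i)[j.val]? = some ((r i).getD j 0) ∧ (r i).getD j 0 < L.1 ∧
        allowed B A' v ((r i).getD j 0) = true ∧
        (t i j).val = code (elements M L.1 B) B A' v ((r i).getD j 0)) := by
    intro j v hv
    have hj : j.val < C.1.length := by rw [← hCc.arity]; exact j.isLt
    refine ⟨hval j hj, fun i => ?_⟩
    have hlen := (hC2 _ (hr i)).1
    have h1 : (r i)[j.val]? = some ((r i).getD j 0) := by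
      simp [List.getD_eq_getElem?_getD, hlen, hj]
    refine ⟨h1, (hC2 _ (hr i)).2 _ (List.mem_of_getElem? h1), hall i j v _ hv h1, ?_⟩
    have h2 := congrArg (fun l => l[j.val]?) (hzip i)
    simp only [List.getElem?_zipWith, hv, h1, List.getElem?_ofFn, j.isLt, dif_pos,
      Option.some_inj] at h2
    exact h2.symm
  have i0 : Fin (M.arity s) := ⟨0, hS.pos s⟩
  -- A constant column is covered only thanks to the one-element blocks kept in `B`.
  have hpin : ∀ (j : Fin c.rel.arity) v c', C.1[j.val]? = some v → pinOf A' v = some c' →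
      r'[j.val]? = some c' := by
    intro j v c' hv hp
    obtain ⟨h1, h2⟩ := hcoord j v hv
    have h3 : ∀ i, (r i).getD j 0 = c' := by
      intro i
      simpa [allowed, hp] using (h2 i).2.2.1
    have hc' : c' < L.1 := h3 i0 ▸ (h2 i0).2.1
    rw [h1 ?_, h.value_replicate s hc' _ h3]
    refine covered_iff.2 ⟨_, h.singles c' hc', ?_⟩
    simp only [List.mem_ofFn, forall_exists_index, forall_apply_eq_imp_iff]
    intro i
    rw [h3]
    simp
  -- The column is a tuple over the arguments of `v`, so the block covering `v` covers it too.
  have hfree : ∀ (j : Fin c.rel.arity) v, C.1[j.val]? = some v → isFree B A' v = true →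
      r'[j.val]? = some (value A (s.val, List.ofFn fun i => (r i).getD j 0)) ∧
      value A (s.val, List.ofFn fun i => (r i).getD j 0) ∈ v.2 := by
    intro j v hv hf
    obtain ⟨h1, h2⟩ := hcoord j v hv
    have h3 : ∀ i, (r i).getD j 0 ∈ v.2 := fun i => mem_of_allowed hf (h2 i).2.2.1
    have h4 := h.conservative (s.val, List.ofFn fun i => (r i).getD j 0)
      (mem_cells_ofFn.2 fun i => (h2 i).2.1)
    simp only [List.mem_ofFn] at h4
    obtain ⟨i, hi⟩ := h4
    rw [← hi]
    refine ⟨?_, h3 i⟩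
    rw [hi]
    refine h1 (covered_mono (x := v.2) ?_ ?_)
    · simp only [isFree, Bool.and_eq_true] at hf
      exact hf.2
    · simp only [List.mem_ofFn, forall_exists_index, forall_apply_eq_imp_iff]
      exact h3
  refine ⟨r', hr', ?_, ofFn_eq_zipWith hCc.arity (hC2 r' hr').1 ?_⟩
  · intro j v c' hv hc'
    have hj : j < c.rel.arity := by
      rw [hCc.arity]
      exact (List.getElem?_eq_some_iff.1 hv).1
    unfold allowed
    cases hp : pinOf A' v with
    | some c'' =>
      have := hpin ⟨j, hj⟩ v c'' hv hp
      simp only [hc', Option.some_inj] at this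
      simp [this]
    | none =>
      cases hcov : covered B v.2 with
      | false => simp
      | true =>
        obtain ⟨h1, h2⟩ := hfree ⟨j, hj⟩ v hv (by simp [isFree, hp, hcov])
        simp only [hc', Option.some_inj] at h1
        simpa [h1] using h2
  · intro j v c' hv hc'
    obtain ⟨-, h2⟩ := hcoord j v hv
    have hvM := hC1 v (List.mem_of_getElem? hv)
    change index (elements M L.1 B) (S.operation (elements M L.1 B) A s
      (List.ofFn fun i => (elements M L.1 B)[(t i j).val])) = _
    cases hf : isFree B A' v with
    | true =>
      have h3 : ∀ i, (v.2, (r i).getD j 0) ∈ elements M L.1 B := fun i =>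
        mem_elements_of_isFree hvM hf (mem_of_allowed hf (h2 i).2.2.1)
      have h4 : ∀ i, (elements M L.1 B)[(t i j).val] = (v.2, (r i).getD j 0) := by
        intro i
        have h5 := (h2 i).2.2.2
        simp only [code, hf, cond_true] at h5
        have h6 := getElem?_index (h3 i)
        rw [← h5, List.getElem?_eq_getElem (t i j).isLt, Option.some_inj] at h6
        exact h6
      simp only [h4]
      rw [operation_eq hS s _ ⟨_, h3 i0⟩]
      have h7 := (hfree j v hv hf).1
      rw [hc', Option.some_inj] at h7
      simp [code, hf, h7]
    | false =>
      -- All entries are the dummy element, and the operation is idempotent on it.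
      have hpos := hS.elements_pos h.singles hvM
      have h4 : ∀ i, (elements M L.1 B)[(t i j).val] = (elements M L.1 B)[0] := by
        intro i
        have h5 := (h2 i).2.2.2
        simp only [code, hf, cond_false] at h5
        simp [h5]
      simp only [h4]
      have h5 : ((elements M L.1 B)[0].1, (elements M L.1 B)[0].2) ∈ elements M L.1 B :=
        List.getElem_mem hpos
      have h6 := operation_eq (A := A) hS s (fun _ => (elements M L.1 B)[0].2) ⟨_, h5⟩
      rw [h.value_replicate s (lt_of_mem_element ⟨_, h5⟩ (mem_elements.1 h5).2.2) _
        fun _ => rfl] at h6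
      rw [h6]
      simpa [code, hf] using index_getElem nodup_elements hpos

theorem Inv.isPolymorphism (hS : S.Good) (hL : L.WellFormed) (h : S.Inv L B A)
    {cs : List (Constraint (cells M L.1).length (elements M L.1 B).length)}
    (hcs : List.Forall₂ (Codes L B A') (cellConstraints M S.vars L) cs) (s : Fin M.m) :
    IsPolymorphism (Instance.language ⟨_, _, cs⟩) (h.interpretation hS s) := by
  rintro _ ⟨R, hR, rfl⟩ t ht
  obtain ⟨c, hc, rfl⟩ := List.mem_map.1 hR
  exact h.interpretation_mem hS hL hcs s hc t ht

/-- Satisfying assignments and extensions are decoded into each other. Membership in a coded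
relation forces a free cell into its own component and a pinned cell to its pin, and demands nothing
of the remaining cells. -/
theorem Inv.satisfiable_iff (hS : S.Good) (hL : L.WellFormed) (h : S.Inv L B A)
    (hA' : PinsConservative M L.1 A')
    {cs : List (Constraint (cells M L.1).length (elements M L.1 B).length)}
    (hcs : List.Forall₂ (Codes L B A') (cellConstraints M S.vars L) cs) :
    Instance.Satisfiable ⟨_, _, cs⟩ ↔ S.Extends L B A' := by
  have hscope : ∀ {C : CellConstraint}
      {c : Constraint (cells M L.1).length (elements M L.1 B).length}, Codes L B A' C c →
      ∀ (j : Fin c.rel.arity) v, C.1[j.val]? = some v →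
        (c.scope j).val = index (cells M L.1) v := by
    intro C c hCc j v hv
    have := congrArg (fun l => l[j.val]?) hCc.scope
    simpa [hv] using this
  constructor
  · rintro ⟨φ, hφ⟩
    let e : Cell → List ℕ × ℕ := fun v =>
      if hv : index (cells M L.1) v < (cells M L.1).length then
        (elements M L.1 B)[φ ⟨_, hv⟩] else ([], 0)
    -- Pins take precedence. A decoded element in a foreign component can occur only at a cell that
    -- no constraint controls; the first argument then serves as a conservative value.
    refine ⟨fun v => (pinOf A' v).getD (if (e v).1 = v.2 then (e v).2 else v.2.headD 0), ?_, ?_, ?_⟩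
    · intro v hv
      beta_reduce
      cases hp : pinOf A' v with
      | some c => exact (hA' _ (mem_of_pinOf hp)).2
      | none =>
        simp only [Option.getD_none]
        split_ifs with he
        · have : e v = (elements M L.1 B)[φ ⟨_, index_lt hv⟩] := dif_pos (index_lt hv)
          have h2 : e v ∈ elements M L.1 B := this ▸ List.getElem_mem _
          exact he ▸ (mem_elements.1 h2).2.2
        · exact hS.headD_mem hv 0
    · intro v c hp
      simp [hp]
    · intro C hC
      obtain ⟨hC1, hC2⟩ := wellFormed_constraint hS hL hC
      obtain ⟨c, hc, hCc⟩ := forall₂_exists_right hcs hC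
      have h1 := mem_tuples_iff.1 (hφ c hc)
      rw [hCc.tuples, mem_codedTuples] at h1
      obtain ⟨r, hr, hall, hzip⟩ := h1
      refine ⟨r, hr, fun j v hv hP => ?_⟩
      have hj : j < C.1.length := (List.getElem?_eq_some_iff.1 hv).1
      have hvM := hC1 v (List.mem_of_getElem? hv)
      have hrj : r[j]? = some (r.getD j 0) := by
        simp [List.getD_eq_getElem?_getD, (hC2 r hr).1, hj]
      have ha := hall j v _ hv hrj
      rw [hrj, Option.some_inj]
      cases hp : pinOf A' v with
      | some c' => simpa [allowed, hp] using ha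
      | none =>
        have hf : isFree B A' v = true := by simpa [isFree, hp] using hP
        have h2 := mem_elements_of_isFree hvM hf (mem_of_allowed hf ha)
        have h3 := congrArg (fun l => l[j]?) hzip
        have hj' : j < c.rel.arity := by rwa [hCc.arity]
        simp only [List.getElem?_zipWith, hv, hrj, List.getElem?_ofFn, hj', dif_pos,
          Option.some_inj, code, hf, cond_true] at h3
        have h4 : e v = (v.2, r.getD j 0) := by
          have h5 := getElem?_index h2
          have h6 : c.scope ⟨j, hj'⟩ = ⟨_, index_lt hvM⟩ := Fin.ext (hscope hCc ⟨j, hj'⟩ v hv)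
          rw [h6] at h3
          rw [h3, List.getElem?_eq_getElem (Fin.isLt _), Option.some_inj] at h5
          exact (dif_pos (index_lt hvM)).trans h5
        simp [h4, hp]
  · rintro ⟨g, hg1, hg2, hg3⟩
    have hlt : ∀ v ∈ cells M L.1, (bif isFree B A' v then
        index (elements M L.1 B) (v.2, g v) else 0) < (elements M L.1 B).length := by
      intro v hv
      cases hf : isFree B A' v with
      | true => exact index_lt (mem_elements_of_isFree hv hf (hg1 v hv))
      | false => exact hS.elements_pos h.singles hv
    refine ⟨fun i => ⟨_, hlt _ (List.getElem_mem i.isLt)⟩, fun c hc => ?_⟩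
    obtain ⟨C, hC, hCc⟩ := forall₂_exists_left hcs hc
    obtain ⟨hC1, hC2⟩ := wellFormed_constraint hS hL hC
    obtain ⟨r, hr, hr'⟩ := hg3 C hC
    rw [mem_tuples_iff, hCc.tuples, mem_codedTuples]
    refine ⟨r, hr, fun j v c' hv hc' => ?_, ofFn_eq_zipWith hCc.arity (hC2 r hr).1 ?_⟩
    · have h1 := hr' j v hv
      rw [hc', Option.some_inj] at h1
      have hvM := hC1 v (List.mem_of_getElem? hv)
      unfold allowed
      cases hp : pinOf A' v with
      | some c'' => simp [h1 (by simp [hp]), hg2 v _ hp]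
      | none =>
        cases hcov : covered B v.2 with
        | false => simp
        | true => simpa [h1 (by simp [hcov])] using hg1 v hvM
    · intro j v c' hv hc'
      have hvM := hC1 v (List.mem_of_getElem? hv)
      have h1 : (cells M L.1)[(c.scope j).val] = v := by
        have h2 := getElem?_index hvM
        rw [← hscope hCc j v hv, List.getElem?_eq_getElem (Fin.isLt _), Option.some_inj] at h2
        exact h2
      simp only [h1, code]
      cases hf : isFree B A' v with
      | false => rfl
      | true =>
        have h2 := hr' j v hv (Or.inr (by
          simp only [isFree, Bool.and_eq_true] at hf
          exact hf.2))
        rw [hc', Option.some_inj] at h2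
        rw [h2]

/-- The invariant supplies exactly the promise of the semiuniform algorithm: operations on the
disjoint union that satisfy `M` and preserve the instance. They come from `A`, while the question
concerns `A'`. -/
theorem Inv.test_iff (hS : S.Good) (hL : L.WellFormed) (h : S.Inv L B A)
    (hA' : PinsConservative M L.1 A') : S.test L B A A' = true ↔ S.Extends L B A' := by
  obtain ⟨cs, hcs⟩ := exists_instance hS hL h.singles A'
  rw [← h.satisfiable_iff hS hL hA' hcs, ← hS.oracle ⟨_, _, cs⟩ (h.interpretation hS)
    ⟨h.isPolymorphism hS hL hcs, h.satisfiedBy hS⟩, test, encodeInstance_eq hcs,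
    h.encodeInterpretation_eq hS]

end Solver

/-! ### Self-reduction and extension by a block -/

namespace Solver

variable {M : MaltsevCondition} {S : Solver M} {L : ListLanguage} {B : List (List ℕ)} {A A' : Pins}

/-- An extension of `A'` gives `v` some value among its arguments, so one of the tests succeeds. A
cell pinned before may receive a new value, since the newest pin counts; therefore only pinnedness
and extendability are asserted to persist. -/
theorem pinCell_spec (hS : S.Good) (hL : L.WellFormed) (h : S.Inv L B A)
    (hA' : PinsConservative M L.1 A') (hE : S.Extends L B A') {v : Cell} (hv : v ∈ cells M L.1) :
    PinsConservative M L.1 (S.pinCell L B A A' v) ∧ S.Extends L B (S.pinCell L B A A' v) ∧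
      (∀ w, (pinOf A' w).isSome = true → (pinOf (S.pinCell L B A A' v) w).isSome = true) ∧
      (covered B v.2 = true → (pinOf (S.pinCell L B A A' v) v).isSome = true) := by
  unfold pinCell
  cases hcov : covered B v.2 with
  | false => exact ⟨hA', hE, fun _ h => h, fun h => by simp at h⟩
  | true =>
    have hpc : ∀ c ∈ v.2, PinsConservative M L.1 ((v, c) :: A') := by
      intro c hc e he
      rcases List.mem_cons.1 he with rfl | he
      · exact ⟨hv, hc⟩
      · exact hA' e he
    obtain ⟨c, hc⟩ : ∃ c, v.2.find? (fun c => S.test L B A ((v, c) :: A')) = some c := by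
      rw [← Option.isSome_iff_exists, List.find?_isSome]
      obtain ⟨g, hg1, hg2, hg3⟩ := hE
      refine ⟨g v, hg1 v hv, (h.test_iff hS hL (hpc _ (hg1 v hv))).2 ⟨g, hg1, ?_, ?_⟩⟩
      · intro w c hw
        rw [pinOf_cons] at hw
        split_ifs at hw with hvw
        · rw [← hvw]
          exact Option.some_inj.1 hw
        · exact hg2 w c hw
      · intro C hC
        obtain ⟨r, hr, hr'⟩ := hg3 C hC
        refine ⟨r, hr, fun j w hw hP => hr' j w hw ?_⟩
        beta_reduce at hP ⊢
        rw [pinOf_cons] at hP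
        split_ifs at hP with hvw
        · rw [← hvw]
          exact Or.inr hcov
        · exact hP
    have hmem := List.mem_of_find?_eq_some hc
    have htest := List.find?_some hc
    rw [h.test_iff hS hL (hpc c hmem)] at htest
    simp only [hc, Option.getD_some, cond_true]
    refine ⟨hpc c hmem, htest, fun w hw => ?_, fun _ => ?_⟩
    · rw [pinOf_cons]
      split_ifs
      · rfl
      · exact hw
    · rw [pinOf_cons, if_pos rfl]
      rfl

theorem pinAll_spec (hS : S.Good) (hL : L.WellFormed) (h : S.Inv L B A)
    (hA' : PinsConservative M L.1 A') (hE : S.Extends L B A') :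
    PinsConservative M L.1 (S.pinAll L B A A') ∧ S.Extends L B (S.pinAll L B A A') ∧
      (∀ w, (pinOf A' w).isSome = true → (pinOf (S.pinAll L B A A') w).isSome = true) ∧
      ∀ v ∈ cells M L.1, covered B v.2 = true → (pinOf (S.pinAll L B A A') v).isSome = true := by
  have key : ∀ l : List Cell, (∀ v ∈ l, v ∈ cells M L.1) → ∀ A', PinsConservative M L.1 A' →
      S.Extends L B A' → PinsConservative M L.1 (l.foldl (S.pinCell L B A) A') ∧
      S.Extends L B (l.foldl (S.pinCell L B A) A') ∧
      (∀ w, (pinOf A' w).isSome = true →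
        (pinOf (l.foldl (S.pinCell L B A) A') w).isSome = true) ∧
      ∀ v ∈ l, covered B v.2 = true →
        (pinOf (l.foldl (S.pinCell L B A) A') v).isSome = true := by
    intro l
    induction l with
    | nil => exact fun _ A' h1 h2 => ⟨h1, h2, fun _ h => h, by simp⟩
    | cons v l ih =>
      intro hl A' h1 h2
      obtain ⟨h3, h4, h5, h6⟩ := pinCell_spec hS hL h h1 h2 (hl v (by simp))
      obtain ⟨h7, h8, h9, h10⟩ := ih (fun v hv => hl v (by simp [hv])) _ h3 h4
      refine ⟨h7, h8, fun w hw => h9 w (h5 w hw), fun w hw hcov => ?_⟩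
      rcases List.mem_cons.1 hw with rfl | hw
      · exact h9 _ (h6 hcov)
      · exact h10 w hw hcov
  exact key _ (fun _ h => h) A' hA' hE

variable {b : List ℕ}

theorem patterns_spec {g : Pins} (hg : g ∈ S.patterns) :
    (∀ e ∈ g, e.2 ∈ e.1.2 ∧ e.1 ∈ cells M S.width) ∧
      ∀ v ∈ cells M S.width, ∃ j, (v, j) ∈ g := by
  have h := List.mem_sections.1 hg
  constructor
  · intro e he
    obtain ⟨m, hm, hem⟩ := forall₂_exists_right h he
    simp only [List.mem_flatMap, List.mem_map] at hm
    obtain ⟨s, hs, u, hu, rfl⟩ := hm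
    obtain ⟨j, hj, rfl⟩ := List.mem_map.1 hem
    exact ⟨hj, List.mem_flatMap.2 ⟨s, hs, List.mem_map.2 ⟨u, hu, rfl⟩⟩⟩
  · intro v hv
    obtain ⟨s, hs, hv⟩ := List.mem_flatMap.1 hv
    obtain ⟨u, hu, rfl⟩ := List.mem_map.1 hv
    obtain ⟨e, he, hem⟩ := forall₂_exists_left h (b := u.map fun j => ((s.val, u), j))
      (List.mem_flatMap.2 ⟨s, hs, List.mem_map.2 ⟨u, hu, rfl⟩⟩)
    obtain ⟨j, -, rfl⟩ := List.mem_map.1 hem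
    exact ⟨j, he⟩

/-- The cell over a block at the given positions. -/
theorem map_mem_cells {d : ℕ} (hb : b.length = S.width) (hbd : ∀ c ∈ b, c < d) {v : Cell}
    (hv : v ∈ cells M S.width) : (v.1, v.2.map fun i => b.getD i 0) ∈ cells M d := by
  obtain ⟨s, hs, hl, h⟩ := mem_cells.1 hv
  refine mem_cells.2 ⟨s, hs, by simpa using hl, ?_⟩
  simp only [List.mem_map, forall_exists_index, and_imp, forall_apply_eq_imp_iff₂]
  intro i hi
  have := h i hi
  rw [List.getD_eq_getElem _ _ (by rwa [hb])]
  exact hbd _ (List.getElem_mem _)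

theorem blockPins_conservative {d : ℕ} (hb : b.length = S.width) (hbd : ∀ c ∈ b, c < d) {g : Pins}
    (hg : g ∈ S.patterns) : PinsConservative M d (blockPins b g) := by
  intro e he
  obtain ⟨e', he', rfl⟩ := List.mem_map.1 he
  obtain ⟨h1, h2⟩ := (patterns_spec hg).1 e' he'
  exact ⟨map_mem_cells hb hbd h2, List.mem_map.2 ⟨_, h1, rfl⟩⟩

theorem pinOf_blockPins {d : ℕ} (hb : b.length = S.width) {g : Pins} (hg : g ∈ S.patterns)
    {v : Cell} (hv : v ∈ cells M d) (hvb : ∀ c ∈ v.2, c ∈ b) :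
    (pinOf (blockPins b g) v).isSome = true := by
  obtain ⟨s, hs, hl, -⟩ := mem_cells.1 hv
  obtain ⟨u, hu⟩ : ∃ u : List ℕ, (∀ i ∈ u, i < S.width) ∧ u.map (fun i => b.getD i 0) = v.2 := by
    -- A block may repeat elements; first occurrences are a choice of positions.
    refine ⟨v.2.map (index b), ?_, ?_⟩
    · simp only [List.mem_map, forall_exists_index, and_imp, forall_apply_eq_imp_iff₂]
      exact fun c hc => hb ▸ index_lt (hvb c hc)
    · rw [List.map_map]
      conv_rhs => rw [← List.map_id v.2]
      refine List.map_congr_left fun c hc => ?_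
      simp [List.getD_eq_getElem?_getD, getElem?_index (hvb c hc)]
  obtain ⟨j, hj⟩ := (patterns_spec hg).2 (v.1, u)
    (mem_cells.2 ⟨s, hs, by rw [← hl, ← hu.2]; simp, hu.1⟩)
  refine pinOf_isSome.2 ⟨b.getD j 0, List.mem_map.2 ⟨_, hj, ?_⟩⟩
  simp only [hu.2]

/-- After `pinAll`, cells over `b` are pinned by the pattern and cells over earlier blocks by
self-reduction. An extension of the pins agrees with the table on all these cells, so the
constraints it satisfies pass to the table. -/
theorem step_spec (hS : S.Good) (hL : L.WellFormed) (h : S.Inv L B A)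
    (hb : b.length = S.width) (hbd : ∀ c ∈ b, c < L.1) {st : List (List ℕ) × Pins}
    (hst : S.step L (B, A) b = some st) : S.Inv L st.1 st.2 ∧ st.1 = b :: B := by
  simp only [step, Option.map_eq_some_iff] at hst
  obtain ⟨g, hg, rfl⟩ := hst
  refine ⟨?_, rfl⟩
  have hgp := List.mem_of_find?_eq_some hg
  have hpc := blockPins_conservative hb hbd hgp
  have htest := List.find?_some hg
  rw [h.test_iff hS hL hpc] at htest
  obtain ⟨h1, h2, h3, h4⟩ := pinAll_spec hS hL h hpc htest
  obtain ⟨f, hf1, hf2, hf3⟩ := h2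
  refine ⟨fun v hv => ?_, fun C hC => ?_, fun c hc => List.mem_cons_of_mem _ (h.singles c hc)⟩
  · unfold value
    cases hp : pinOf (S.pinAll L B A (blockPins b g)) v with
    | none => exact hS.headD_mem hv 0
    | some c => exact (h1 _ (mem_of_pinOf hp)).2
  · obtain ⟨r, hr, hr'⟩ := hf3 C hC
    refine ⟨r, hr, fun j v hv hcov => ?_⟩
    have hvM := (wellFormed_constraint hS hL hC).1 v (List.mem_of_getElem? hv)
    have hp : (pinOf (S.pinAll L B A (blockPins b g)) v).isSome = true := by
      obtain ⟨b', hb', hvb⟩ := covered_iff.1 hcov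
      rcases List.mem_cons.1 hb' with rfl | hb'
      · exact h3 v (pinOf_blockPins hb hgp hvM hvb)
      · exact h4 v hvM (covered_iff.2 ⟨b', hb', hvb⟩)
    rw [hr' j v hv (Or.inl hp)]
    obtain ⟨c, hc⟩ := Option.isSome_iff_exists.1 hp
    rw [hf2 v c hc, value, hc, Option.getD_some]

/-- Conservative operations that satisfy all constraints. -/
def Solution (S : Solver M) (L : ListLanguage) (h : Cell → ℕ) : Prop :=
  (∀ v ∈ cells M L.1, h v ∈ v.2) ∧
    ∀ C ∈ cellConstraints M S.vars L, AgreesOn C (fun _ => True) h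

/-- The restriction of a solution to `b` is one of the patterns, and the solution itself witnesses
that it extends. Earlier choices play no part. -/
theorem step_isSome (hS : S.Good) (hL : L.WellFormed) (h : S.Inv L B A)
    (hb : b.length = S.width) (hbd : ∀ c ∈ b, c < L.1) {f : Cell → ℕ} (hf : S.Solution L f) :
    (S.step L (B, A) b).isSome = true := by
  simp only [step, Option.isSome_map, List.find?_isSome]
  -- By conservativity the value of `f` at a cell over `b` is one of its arguments, so it comes from
  -- a position `j` of the pattern.
  have hj : ∀ v ∈ cells M S.width, ∃ j ∈ v.2,
      b.getD j 0 = f (v.1, v.2.map fun i => b.getD i 0) := by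
    intro v hv
    exact List.mem_map.1 (hf.1 _ (map_mem_cells hb hbd hv))
  choose! j hj1 hj2 using hj
  refine ⟨(cells M S.width).map fun v => (v, j v), ?_, ?_⟩
  · refine List.mem_sections.2 ?_
    unfold cells
    rw [List.map_flatMap]
    simp only [List.map_map, Function.comp_def]
    have key : ∀ l : List (Fin M.m), List.Forall₂ (· ∈ ·)
        (l.flatMap fun s => (listTuples (List.range S.width) (M.arity s)).map fun u =>
          ((s.val, u), j (s.val, u)))
        (l.flatMap fun s => (listTuples (List.range S.width) (M.arity s)).map fun u =>
          u.map fun i => ((s.val, u), i)) := by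
      intro l
      induction l with
      | nil => exact .nil
      | cons s l ih =>
        simp only [List.flatMap_cons]
        refine List.rel_append ?_ ih
        rw [List.forall₂_map_left_iff, List.forall₂_map_right_iff, List.forall₂_same]
        intro u hu
        exact List.mem_map.2 ⟨_, hj1 (s.val, u) (List.mem_flatMap.2 ⟨s, List.mem_finRange _,
          List.mem_map.2 ⟨u, hu, rfl⟩⟩), rfl⟩
    exact key _
  · have hpins : ∀ e ∈ blockPins b ((cells M S.width).map fun v => (v, j v)),
        e.1 ∈ cells M L.1 ∧ e.2 = f e.1 := by
      intro e he
      simp only [blockPins, List.map_map, List.mem_map] at he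
      obtain ⟨v, hv, rfl⟩ := he
      exact ⟨map_mem_cells hb hbd hv, hj2 v hv⟩
    refine (h.test_iff hS hL ?_).2 ⟨f, hf.1, fun v c hv => ?_, fun C hC => ?_⟩
    · intro e he
      obtain ⟨h1, h2⟩ := hpins e he
      exact ⟨h1, h2 ▸ hf.1 _ h1⟩
    · exact (hpins _ (mem_of_pinOf hv)).2.symm
    · obtain ⟨r, hr, hr'⟩ := hf.2 C hC
      exact ⟨r, hr, fun j v hv _ => hr' j v hv trivial⟩

/-- A cell covered by a one-element block has equal arguments, and any projection gives their common
value. So a row of the relation serves as its own image on covered columns, and an identity holds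
because its two sides share a variable. -/
theorem inv_init (hS : S.Good) (hL : L.WellFormed) :
    S.Inv L ((List.range L.1).map fun c => [c]) [] := by
  have hcov : ∀ {x : List ℕ}, covered ((List.range L.1).map fun c => [c]) x = true →
      ∃ c, ∀ a ∈ x, a = c := by
    intro x hx
    obtain ⟨b, hb, hxb⟩ := covered_iff.1 hx
    obtain ⟨c, -, rfl⟩ := List.mem_map.1 hb
    exact ⟨c, fun a ha => by simpa using hxb a ha⟩
  have hval : ∀ (s : Fin M.m) (x : Fin (M.arity s) → ℕ) (i : Fin (M.arity s)),
      covered ((List.range L.1).map fun c => [c]) (List.ofFn x) = true →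
        value [] (s.val, List.ofFn x) = x i := by
    intro s x i hx
    obtain ⟨c, hc⟩ := hcov hx
    have h1 : (List.ofFn x).headD 0 ∈ List.ofFn x := Solver.headD_mem (by simpa using hS.pos s) 0
    exact (hc _ h1).trans (hc _ (List.mem_ofFn.2 ⟨i, rfl⟩)).symm
  refine ⟨fun v hv => hS.headD_mem hv 0, fun C hC => ?_, fun c hc => List.mem_map.2
    ⟨c, List.mem_range.2 hc, rfl⟩⟩
  obtain ⟨hC1, hC2⟩ := wellFormed_constraint hS hL hC
  rcases List.mem_append.1 hC with hC | hC
  · simp only [polymorphismConstraints, List.mem_flatMap, List.mem_map] at hC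
    obtain ⟨R, hR, s, -, W, hW, rfl⟩ := hC
    obtain ⟨t, ht, rfl⟩ := (mem_columns fun r hr => (hL R hR r hr).1).1 hW
    refine ⟨t ⟨0, hS.pos s⟩, ht _, fun j v hv hP => ?_⟩
    simp only [List.map_map, List.getElem?_map, Option.map_eq_some_iff] at hv
    obtain ⟨a, ha, rfl⟩ := hv
    obtain ⟨hj, rfl⟩ := List.getElem?_eq_some_iff.1 ha
    simp only [List.length_range] at hj
    simp only [List.getElem_range, Function.comp_apply] at hP ⊢
    rw [hval s _ ⟨0, hS.pos s⟩ hP]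
    simp [List.getD_eq_getElem?_getD, (hL R hR _ (ht _)).1, hj]
  · simp only [identityConstraints, List.mem_flatMap, List.mem_map, mem_listTuples] at hC
    obtain ⟨e, he, ρ, ⟨hρ, hρ'⟩, rfl⟩ := hC
    have hvars := hS.vars e he
    cases e with
    | opOp f x g y =>
      obtain ⟨i, i', hi⟩ := hS.exists_mem_of_opOp he
      simp only [identityConstraint, List.map_ofFn] at hC1 ⊢
      refine ⟨[ρ.getD (x i) 0, ρ.getD (x i) 0], List.mem_map.2 ⟨_, List.mem_range.2 ?_, rfl⟩,
        fun j v hv hP => ?_⟩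
      · exact mem_cells_ofFn.1 (hC1 _ (List.mem_cons_self)) i
      · match j with
        | 0 =>
          simp only [List.getElem?_cons_zero, Option.some_inj] at hv
          subst hv
          rw [hval f _ i hP]
          rfl
        | 1 =>
          simp only [List.getElem?_cons_succ, List.getElem?_cons_zero, Option.some_inj] at hv
          subst hv
          rw [hval g _ i' hP]
          simp [hi]
        | j + 2 => simp at hv
    | opVar f x v =>
      obtain ⟨i, hi⟩ := hS.exists_mem_of_opVar he
      simp only [identityConstraint, List.map_ofFn] at hC1 ⊢
      refine ⟨_, List.mem_singleton.2 rfl, fun j v hv hP => ?_⟩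
      match j with
      | 0 =>
        simp only [List.getElem?_cons_zero, Option.some_inj] at hv
        subst hv
        rw [hval f _ i hP]
        simp [hi]
      | j + 1 => simp at hv

theorem run_spec (hS : S.Good) (hL : L.WellFormed) (bs : List (List ℕ))
    (hbs : ∀ b ∈ bs, b.length = S.width ∧ ∀ c ∈ b, c < L.1) :
    (∀ st, S.run L bs = some st → S.Inv L st.1 st.2 ∧ ∀ b ∈ bs, b ∈ st.1) ∧
      ∀ f, S.Solution L f → (S.run L bs).isSome = true := by
  induction bs using List.reverseRecOn with
  | nil =>
    refine ⟨?_, fun _ _ => rfl⟩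
    rintro _ ⟨⟩
    exact ⟨inv_init hS hL, by simp⟩
  | append_singleton bs b ih =>
    obtain ⟨ih1, ih2⟩ := ih fun b hb => hbs b (by simp [hb])
    obtain ⟨hb, hbd⟩ := hbs b (by simp)
    rw [run_append]
    constructor
    · intro st hst
      obtain ⟨⟨B, A⟩, h1, h2⟩ := Option.bind_eq_some_iff.1 hst
      obtain ⟨h3, h4⟩ := ih1 _ h1
      obtain ⟨h5, h6⟩ := step_spec hS hL h3 hb hbd h2
      refine ⟨h5, fun b' hb' => ?_⟩
      rw [h6]
      rcases List.mem_append.1 hb' with hb' | hb'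
      · exact List.mem_cons_of_mem _ (h4 b' hb')
      · simp at hb'
        simp [hb']
    · intro f hf
      obtain ⟨⟨B, A⟩, h1⟩ := Option.isSome_iff_exists.1 (ih2 f hf)
      rw [h1]
      exact step_isSome hS hL (ih1 _ h1).1 hb hbd hf

/-- The result of the algorithm: operation tables that solve all constraints, if there are any. -/
theorem output_spec (hS : S.Good) (hL : L.WellFormed) :
    (∀ y, S.output L = some y → ∃ f, S.Solution L f ∧ y = Data.ofList ((List.finRange M.m).map
      fun s => table (List.range L.1) (M.arity s) fun x => f (s.val, x))) ∧
      ∀ f, S.Solution L f → (S.output L).isSome = true := by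
  obtain ⟨h1, h2⟩ := run_spec hS hL (listTuples (List.range L.1) S.width) fun b hb => by
    simpa using mem_listTuples.1 hb
  unfold output
  constructor
  · intro y hy
    obtain ⟨st, hst, rfl⟩ := Option.map_eq_some_iff.1 hy
    obtain ⟨h3, h4⟩ := h1 st hst
    refine ⟨value st.2, ⟨h3.conservative, fun C hC => ?_⟩, rfl⟩
    obtain ⟨r, hr, hr'⟩ := h3.agrees C hC
    refine ⟨r, hr, fun j v hv _ => hr' j v hv ?_⟩
    have hvM := (wellFormed_constraint hS hL hC).1 v (List.mem_of_getElem? hv)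
    obtain ⟨s, -, hlen, hlt⟩ := mem_cells.1 hvM
    -- Argument lists shorter than a block are padded with their first entry; the padded list is one
    -- of the processed blocks.
    refine covered_iff.2 ⟨v.2 ++ List.replicate (S.width - v.2.length) (v.2.headD 0),
      h4 _ (mem_listTuples.2 ⟨?_, fun c hc => List.mem_range.2 ?_⟩), fun c hc => by simp [hc]⟩
    · have := hS.le_width s
      simp
      omega
    · rcases List.mem_append.1 hc with hc | hc
      · exact hlt c hc
      · rw [(List.mem_replicate.1 hc).2]
        exact hlt _ (hS.headD_mem hvM 0)
  · intro f hf
    simpa using h2 f hf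

end Solver

/-! ### Languages and interpretations in terms of cells -/

/-- A constraint language in list form. -/
def toListLanguage {d : ℕ} (G : List (TableRelation d)) : ListLanguage :=
  (d, G.map fun R => (R.arity, R.tuples.map fun t => List.ofFn fun i => (t i).val))

theorem encodeLanguage_eq {d : ℕ} (G : List (TableRelation d)) :
    encodeLanguage G = enc (toListLanguage G) := by
  have : G.map encodeRelation = (G.map fun R =>
      (R.arity, R.tuples.map fun t => List.ofFn fun i => (t i).val)).map enc := by
    simp [encodeRelation_eq]
  rw [encodeLanguage, this]
  rfl

theorem wellFormed_toListLanguage {d : ℕ} (G : List (TableRelation d)) :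
    (toListLanguage G).WellFormed := by
  intro R hR r hr
  obtain ⟨R, -, rfl⟩ := List.mem_map.1 hR
  obtain ⟨t, -, rfl⟩ := List.mem_map.1 hr
  refine ⟨by simp, fun c hc => ?_⟩
  obtain ⟨i, rfl⟩ := List.mem_ofFn.1 hc
  exact (t i).isLt

/-- The set of the given arguments is itself a unary relation of the extension. -/
theorem isConservative_of_conservativeExtension {D : Type} {L : ConstraintLanguage D} {a : ℕ}
    {f : (Fin a → D) → D} (h : IsPolymorphism (conservativeExtension L) f) : IsConservative f := by
  intro x
  obtain ⟨j, hj⟩ := h ⟨1, {t | ∃ j, t 0 = x j}⟩ (Or.inr rfl) (fun j _ => x j) fun j => ⟨j, rfl⟩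
  exact ⟨j, hj⟩

theorem LinearIdentity.VarsLt.mono {m : ℕ} {arity : Fin m → ℕ} {e : LinearIdentity arity}
    {w w' : ℕ} (h : e.VarsLt w) (hw : w ≤ w') : e.VarsLt w' := by
  cases e with
  | opOp => exact ⟨fun j => (h.1 j).trans_le hw, fun j => (h.2 j).trans_le hw⟩
  | opVar => exact ⟨fun j => (h.1 j).trans_le hw, h.2.trans_le hw⟩

theorem LinearIdentity.exists_varsLt {m : ℕ} {arity : Fin m → ℕ} (e : LinearIdentity arity) :
    ∃ w, e.VarsLt w := by
  have key : ∀ {a : ℕ} (x : Fin a → ℕ), ∀ j, x j < (∑ i, x i) + 1 := fun x j =>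
    Nat.lt_succ_of_le (Finset.single_le_sum (fun _ _ => Nat.zero_le _) (Finset.mem_univ j))
  cases e with
  | opOp f x g y =>
    refine ⟨(∑ i, x i) + (∑ i, y i) + 1, fun j => ?_, fun j => ?_⟩
    · have := key x j
      omega
    · have := key y j
      omega
  | opVar f x v =>
    refine ⟨(∑ i, x i) + v + 1, fun j => ?_, by omega⟩
    have := key x j
    omega

theorem MaltsevCondition.exists_varsLt (M : MaltsevCondition) :
    ∃ w, ∀ e ∈ M.identities, e.VarsLt w := by
  induction M.identities with
  | nil => exact ⟨0, by simp⟩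
  | cons e l ih =>
    obtain ⟨w, hw⟩ := ih
    obtain ⟨w', hw'⟩ := e.exists_varsLt
    refine ⟨w + w', ?_⟩
    simp only [List.mem_cons, forall_eq_or_imp]
    exact ⟨hw'.mono (by omega), fun e he => (hw e he).mono (by omega)⟩

/-- The values of operations, as a function on cells. -/
def cellFunction {M : MaltsevCondition} {d : ℕ} (F : M.Interpretation (Fin d)) (v : Cell) : ℕ :=
  if hs : v.1 < M.m then
    -- The remainder modulo `d` only makes the function total; on actual cells the entries are
    -- already smaller than `d`.
    if hd : 0 < d then (F ⟨v.1, hs⟩ fun i => ⟨v.2.getD i 0 % d, Nat.mod_lt _ hd⟩).val else 0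
  else 0

theorem cellFunction_eq {M : MaltsevCondition} {d : ℕ} (F : M.Interpretation (Fin d)) (s : Fin M.m)
    (hs : 0 < M.arity s) (y : Fin (M.arity s) → Fin d) :
    cellFunction F (s.val, List.ofFn fun i => (y i).val) = (F s y).val := by
  have hd : 0 < d := (Nat.zero_le _).trans_lt (y ⟨0, hs⟩).isLt
  simp only [cellFunction, s.isLt, hd, dif_pos]
  congr 2
  funext i
  apply Fin.ext
  simp [List.getD_eq_getElem?_getD, Nat.mod_eq_of_lt]

theorem exists_ofFn_fin {d k : ℕ} {x : List ℕ} (hx : x.length = k) (h : ∀ c ∈ x, c < d) :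
    ∃ y : Fin k → Fin d, x = List.ofFn fun i => (y i).val := by
  obtain ⟨t, ht⟩ := exists_tuple_of_list hx h
  exact ⟨t, ht.symm⟩

namespace Solver

variable {M : MaltsevCondition} {S : Solver M} {d : ℕ} {G : List (TableRelation d)}

theorem solution_of_isPolymorphismTuple (hS : S.Good) {F : M.Interpretation (Fin d)}
    (hF : ∀ s, IsConservative (F s)) (hF' : M.IsPolymorphismTuple (languageOf G) F) :
    S.Solution (toListLanguage G) (cellFunction F) := by
  constructor
  · intro v hv
    obtain ⟨s, hs, hl, hlt⟩ := mem_cells.1 hv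
    obtain ⟨y, hy⟩ := exists_ofFn_fin (d := d) hl hlt
    obtain ⟨s', x⟩ := v
    subst hs hy
    rw [cellFunction_eq F s (hS.pos s)]
    obtain ⟨j, hj⟩ := hF s y
    exact List.mem_ofFn.2 ⟨j, by rw [hj]⟩
  · intro C hC
    obtain ⟨hC1, -⟩ := wellFormed_constraint hS (wellFormed_toListLanguage G) hC
    rcases List.mem_append.1 hC with hC | hC
    · simp only [polymorphismConstraints, List.mem_flatMap, List.mem_map] at hC
      obtain ⟨R, hR, s, -, W, hW, rfl⟩ := hC
      obtain ⟨t, ht, rfl⟩ := (mem_columns fun r hr =>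
        (wellFormed_toListLanguage G R hR r hr).1).1 hW
      obtain ⟨R, hRG, rfl⟩ := List.mem_map.1 hR
      choose u hu hut using fun i => List.mem_map.1 (ht i)
      have h1 := hF'.1 s R.toRelation ⟨R, hRG, rfl⟩ u hu
      refine ⟨_, List.mem_map.2 ⟨_, h1, rfl⟩, fun j v hv _ => ?_⟩
      simp only [List.map_map, List.getElem?_map, Option.map_eq_some_iff] at hv
      obtain ⟨a, ha, rfl⟩ := hv
      obtain ⟨hj, rfl⟩ := List.getElem?_eq_some_iff.1 ha
      simp only [List.length_range] at hj
      have h2 : (List.ofFn fun i => (t i).getD j 0) = List.ofFn fun i => (u i ⟨j, hj⟩).val := by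
        congr 1
        funext i
        rw [← hut i]
        simp [List.getD_eq_getElem?_getD, hj]
      simp only [List.getElem_range, Function.comp_apply, h2]
      rw [cellFunction_eq F s (hS.pos s)]
      simp [hj]
    · simp only [identityConstraints, List.mem_flatMap, List.mem_map, mem_listTuples] at hC
      obtain ⟨e, he, ρ, ⟨hρ, hρ'⟩, rfl⟩ := hC
      have hvars := hS.vars e he
      have hid := hF'.2 e he
      have hlt : ∀ n < S.vars, ρ.getD n 0 < d := by
        intro n hn
        rw [List.getD_eq_getElem _ _ (by rwa [hρ])]
        exact List.mem_range.1 (hρ' _ (List.getElem_mem _))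
      have hd : ∀ {s : Fin M.m} {x : Fin (M.arity s) → ℕ}, (∀ i, x i < S.vars) → 0 < d :=
        fun {s x} hx => (Nat.zero_le _).trans_lt (hlt _ (hx ⟨0, hS.pos s⟩))
      have hval : ∀ (s : Fin M.m) (x : Fin (M.arity s) → ℕ) (hd : 0 < d), (∀ i, x i < S.vars) →
          cellFunction F (s.val, List.ofFn fun i => ρ.getD (x i) 0) =
            (F s fun i => ⟨ρ.getD (x i) 0 % d, Nat.mod_lt _ hd⟩).val := by
        intro s x hd hx
        rw [← cellFunction_eq F s (hS.pos s)]
        congr 3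
        funext i
        exact (Nat.mod_eq_of_lt (hlt _ (hx i))).symm
      cases e with
      | opOp f x g y =>
        have hd := hd hvars.1
        have h1 := hid fun n => ⟨ρ.getD n 0 % d, Nat.mod_lt _ hd⟩
        simp only [identityConstraint, List.map_ofFn] at hC1 ⊢
        refine ⟨_, List.mem_map.2 ⟨cellFunction F (f.val, List.ofFn fun i => ρ.getD (x i) 0),
          List.mem_range.2 ?_, rfl⟩, fun j v hv _ => ?_⟩
        · rw [hval f x hd hvars.1]
          exact Fin.isLt _
        · match j with
          | 0 =>
            simp only [List.getElem?_cons_zero, Option.some_inj] at hv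
            subst hv
            rfl
          | 1 =>
            simp only [List.getElem?_cons_succ, List.getElem?_cons_zero, Option.some_inj] at hv
            subst hv
            simp only [List.getElem?_cons_succ, List.getElem?_cons_zero, Function.comp_def]
            rw [hval f x hd hvars.1, hval g y hd hvars.2, h1]
          | j + 2 => simp at hv
      | opVar f x v =>
        have hd := hd hvars.1
        have h1 := hid fun n => ⟨ρ.getD n 0 % d, Nat.mod_lt _ hd⟩
        simp only [identityConstraint, List.map_ofFn] at hC1 ⊢
        refine ⟨_, List.mem_singleton.2 rfl, fun j w hw _ => ?_⟩
        match j with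
        | 0 =>
          simp only [List.getElem?_cons_zero, Option.some_inj] at hw
          subst hw
          simp only [List.getElem?_cons_zero, Function.comp_def]
          rw [hval f x hd hvars.1, h1]
          simp only [Nat.mod_eq_of_lt (hlt v hvars.2)]
        | j + 1 => simp at hw

theorem Solution.exists_interpretation (hS : S.Good) {f : Cell → ℕ}
    (hf : S.Solution (toListLanguage G) f) : ∃ F : M.Interpretation (Fin d),
      (∀ s, IsConservative (F s)) ∧ M.IsPolymorphismTuple (languageOf G) F ∧
        encodeInterpretation F = Data.ofList ((List.finRange M.m).map
          fun s => table (List.range d) (M.arity s) fun x => f (s.val, x)) := by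
  have hcons : ∀ (s : Fin M.m) (y : Fin (M.arity s) → Fin d), ∃ j,
      (y j).val = f (s.val, List.ofFn fun i => (y i).val) := fun s y =>
    List.mem_ofFn.1 (hf.1 _ (mem_cells_ofFn.2 fun i => (y i).isLt))
  refine ⟨fun s y => ⟨f (s.val, List.ofFn fun i => (y i).val), ?_⟩, fun s y => ?_,
    ⟨fun s => ?_, fun e he => ?_⟩, ?_⟩
  · obtain ⟨j, hj⟩ := hcons s y
    exact hj ▸ (y j).isLt
  · obtain ⟨j, hj⟩ := hcons s y
    exact ⟨j, Fin.ext hj.symm⟩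
  · rintro _ ⟨R, hR, rfl⟩ t ht
    have hRL : (R.arity, R.tuples.map fun t => List.ofFn fun i => (t i).val) ∈
        (toListLanguage G).2 := List.mem_map.2 ⟨R, hR, rfl⟩
    have hn := fun r hr => (wellFormed_toListLanguage G _ hRL r hr).1
    have hW := (mem_columns (k := M.arity s) hn).2
      ⟨fun i => List.ofFn fun j => (t i j).val, fun i => List.mem_map.2 ⟨t i, ht i, rfl⟩, rfl⟩
    obtain ⟨r, hr, hr'⟩ := hf.2 _ (List.mem_append_left _ (List.mem_flatMap.2 ⟨_, hRL,
      List.mem_flatMap.2 ⟨s, List.mem_finRange _, List.mem_map.2 ⟨_, hW, rfl⟩⟩⟩))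
    obtain ⟨u, hu, rfl⟩ := List.mem_map.1 hr
    have key : (fun i => (⟨f (s.val, List.ofFn fun j => (t j i).val), by
        obtain ⟨j, hj⟩ := hcons s fun j => t j i
        exact hj ▸ (t j i).isLt⟩ : Fin d)) = u := by
      funext i
      apply Fin.ext
      have h1 := hr' i.val (s.val, List.ofFn fun j => (t j i).val) (by
        have h2 : i.val < R.arity := i.isLt
        simp [h2, List.getD_eq_getElem?_getD]) trivial
      have h2 : i.val < R.arity := i.isLt
      simp only [List.getElem?_ofFn, h2, dif_pos, Option.some_inj] at h1
      exact h1.symm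
    exact key ▸ hu
  · have hvars := hS.vars e he
    have hinst : ∀ ρ : ℕ → Fin d, identityConstraint d
        ((List.range S.vars).map fun n => (ρ n).val) e ∈
          cellConstraints M S.vars (toListLanguage G) := by
      intro ρ
      refine List.mem_append_right _ (List.mem_flatMap.2 ⟨e, he, List.mem_map.2
        ⟨_, mem_listTuples.2 ⟨by simp, ?_⟩, rfl⟩⟩)
      simp only [List.mem_map, forall_exists_index, and_imp, forall_apply_eq_imp_iff₂,
        List.mem_range]
      exact fun n _ => (ρ n).isLt
    have hget : ∀ {a : ℕ} (x : Fin a → ℕ) (hx : ∀ i, x i < S.vars) (ρ : ℕ → Fin d),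
        ((List.ofFn x).map fun i => ((List.range S.vars).map fun n => (ρ n).val).getD i 0) =
          List.ofFn fun i => (ρ (x i)).val := by
      intro a x hx ρ
      simp only [List.map_ofFn]
      congr 1
      funext i
      simp [List.getD_eq_getElem?_getD, hx]
    cases e with
    | opOp g x g' y =>
      intro ρ
      apply Fin.ext
      obtain ⟨r, hr, hr'⟩ := hf.2 _ (hinst ρ)
      simp only [identityConstraint, hget x hvars.1, hget y hvars.2] at hr hr'
      obtain ⟨c, -, rfl⟩ := List.mem_map.1 hr
      have h1 := hr' 0 _ rfl trivial
      have h2 := hr' 1 _ rfl trivial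
      simp only [List.getElem?_cons_zero, List.getElem?_cons_succ, Option.some_inj] at h1 h2
      exact h1.symm.trans h2
    | opVar g x v =>
      intro ρ
      apply Fin.ext
      obtain ⟨r, hr, hr'⟩ := hf.2 _ (hinst ρ)
      simp only [identityConstraint, hget x hvars.1, List.mem_singleton] at hr hr'
      have h1 := hr' 0 _ rfl trivial
      simp only [hr, List.getElem?_cons_zero, Option.some_inj] at h1
      refine h1.symm.trans ?_
      simp [List.getD_eq_getElem?_getD, hvars.2]
  · unfold encodeInterpretation
    rw [List.ofFn_eq_map]
    congr 1
    refine List.map_congr_left fun s _ => encodeOperation_eq List.length_range _ _ fun y => ?_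
    simp

end Solver

/-! ### The metaproblem and its degenerate cases -/

/-- The specification of an algorithm for conservative polymorphisms that satisfy `M`. -/
def SolvesMetaproblem (M : MaltsevCondition) (out : ListLanguage → Option Data) : Prop :=
  ∀ (d : ℕ) (G : List (TableRelation d)),
    (∀ y, out (toListLanguage G) = some y → ∃ F : M.Interpretation (Fin d),
      (∀ i, IsConservative (F i)) ∧ M.IsPolymorphismTuple (languageOf G) F ∧
        y = encodeInterpretation F) ∧
    (LanguageSatisfies (conservativeExtension (languageOf G)) M →
      (out (toListLanguage G)).isSome = true)

theorem LanguageSatisfies.exists_conservative {M : MaltsevCondition} {D : Type}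
    {L : ConstraintLanguage D} (h : LanguageSatisfies (conservativeExtension L) M) :
    ∃ F : M.Interpretation D, (∀ i, IsConservative (F i)) ∧ M.IsPolymorphismTuple L F := by
  obtain ⟨F, h1, h2⟩ := h
  exact ⟨F, fun i => isConservative_of_conservativeExtension (h1 i),
    fun i R hR => h1 i R (Or.inl hR), h2⟩

theorem languageSatisfies_conservativeExtension {M : MaltsevCondition} {D : Type}
    {L : ConstraintLanguage D} {F : M.Interpretation D} (hF : ∀ i, IsConservative (F i))
    (h : M.IsPolymorphismTuple L F) : LanguageSatisfies (conservativeExtension L) M := by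
  refine ⟨F, fun i => ?_, h.2⟩
  rintro ⟨k, R⟩ (hR | hR) t ht
  · exact h.1 i _ hR t ht
  · obtain rfl : k = 1 := hR
    obtain ⟨j, hj⟩ := hF i fun j => t j 0
    have : (fun a => F i fun j => t j a) = t j := by
      funext a
      rw [Subsingleton.elim a 0]
      exact hj
    exact this ▸ ht j

/-- Conservative operations on at least two elements restrict to a model on two elements. -/
theorem exists_bool_model {M : MaltsevCondition} {d : ℕ} (hd : 2 ≤ d)
    {F : M.Interpretation (Fin d)} (hF : ∀ i, IsConservative (F i)) (hM : M.SatisfiedBy F) :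
    ∃ q : M.Interpretation Bool, (∀ s, IsConservative (q s)) ∧ M.SatisfiedBy q := by
  let ι : Bool → Fin d := fun b => if b then ⟨1, hd⟩ else ⟨0, by omega⟩
  have hι : Function.Injective ι := by
    intro a b
    cases a <;> cases b <;> simp [ι]
  have hex : ∀ (s : Fin M.m) (x : Fin (M.arity s) → Bool), ∃ b,
      (∃ j, b = x j) ∧ ι b = F s fun i => ι (x i) := by
    intro s x
    obtain ⟨j, hj⟩ := hF s fun i => ι (x i)
    exact ⟨x j, ⟨j, rfl⟩, hj.symm⟩
  choose q hq1 hq2 using hex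
  refine ⟨q, hq1, fun e he => ?_⟩
  have h := hM e he
  cases e with
  | opOp f x g y =>
    intro ρ
    apply hι
    rw [hq2, hq2]
    exact h fun n => ι (ρ n)
  | opVar f x v =>
    intro ρ
    apply hι
    rw [hq2]
    exact h fun n => ι (ρ n)

/-- The solver needs positive arities and a conservative two-element model. Whether these exist
depends on `M` alone, so the remaining cases may use separate algorithms. -/
theorem exists_solvesMetaproblem {M : MaltsevCondition} (hM : HasSemiuniformAlgorithm M) :
    ∃ out, PolyTime out ∧ SolvesMetaproblem M out := by
  by_cases hpos : ∀ s, 0 < M.arity s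
  · by_cases hq : ∃ q : M.Interpretation Bool, (∀ s, IsConservative (q s)) ∧ M.SatisfiedBy q
    · obtain ⟨q, hq1, hq2⟩ := hq
      obtain ⟨g, hg1, hg2⟩ := hM.exists_oracle
      obtain ⟨w, hw⟩ := M.exists_varsLt
      -- Any upper bound for the arities could be the block length; the sum is one.
      let S : Solver M := ⟨q, ∑ s, M.arity s, w, g, hg1⟩
      have hS : S.Good := ⟨hpos, fun s => Finset.single_le_sum (f := M.arity)
        (fun _ _ => Nat.zero_le _) (Finset.mem_univ s), hw, hq1, hq2, hg2⟩
      refine ⟨S.output, S.polyTime_output, fun d G => ?_⟩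
      obtain ⟨h1, h2⟩ := Solver.output_spec hS (wellFormed_toListLanguage G)
      constructor
      · intro y hy
        obtain ⟨f, hf, rfl⟩ := h1 y hy
        obtain ⟨F, hF1, hF2, hF3⟩ := hf.exists_interpretation hS
        exact ⟨F, hF1, hF2, hF3.symm⟩
      · intro h
        obtain ⟨F, hF1, hF2⟩ := h.exists_conservative
        exact h2 _ (Solver.solution_of_isPolymorphismTuple hS hF1 hF2)
    -- Without a two-element model the answer is negative for `d ≥ 2`; for `d ≤ 1` all identities
    -- are trivial and projections do.
    · let F : ∀ d, M.Interpretation (Fin d) := fun d s y => y ⟨0, hpos s⟩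
      refine ⟨fun L => if L.1 = 0 then some (encodeInterpretation (F 0)) else
        if L.1 = 1 then some (encodeInterpretation (F 1)) else none, by fun_prop, fun d G => ?_⟩
      have hF : ∀ d, d ≤ 1 → ∀ G : List (TableRelation d), (∀ i, IsConservative (F d i)) ∧
          M.IsPolymorphismTuple (languageOf G) (F d) := by
        intro d hd G
        have : Subsingleton (Fin d) := by
          rw [Fin.subsingleton_iff_le_one]
          exact hd
        refine ⟨fun i x => ⟨_, rfl⟩, fun i R hR t ht => ht _, fun e he => ?_⟩
        cases e with
        | opOp => exact fun ρ => Subsingleton.elim _ _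
        | opVar => exact fun ρ => Subsingleton.elim _ _
      simp only [toListLanguage]
      by_cases h0 : d = 0
      · subst h0
        simpa using ⟨F 0, (hF 0 (by omega) G).1, (hF 0 (by omega) G).2, rfl⟩
      · by_cases h1 : d = 1
        · subst h1
          simpa using ⟨F 1, (hF 1 (by omega) G).1, (hF 1 (by omega) G).2, rfl⟩
        · simp only [h0, h1, if_false]
          refine ⟨by simp, fun h => ?_⟩
          obtain ⟨F, hF1, hF2⟩ := h.exists_conservative
          exact absurd (exists_bool_model (by omega) hF1 hF2.2) hq
  -- A nullary operation has no argument to return, so it is never conservative.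
  · refine ⟨fun _ => none, PolyTime.const _, fun d G => ⟨by simp, fun h => ?_⟩⟩
    obtain ⟨F, hF1, -⟩ := h.exists_conservative
    obtain ⟨s, hs⟩ := not_forall.1 hpos
    have : IsEmpty (Fin (M.arity s)) := by
      rw [Nat.eq_zero_of_not_pos hs]
      infer_instance
    obtain ⟨j, -⟩ := hF1 s isEmptyElim
    exact isEmptyElim j

end ConservativeCSP

theorem mainTheorem2 (M : MaltsevCondition) (hM : HasSemiuniformAlgorithm M) :
    ∃ (p : Prog) (P : Polynomial ℕ), ∀ (d : ℕ) (G : List (TableRelation d)),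
      ∃ (y : Data) (t : ℕ),
        Runs p (encodeLanguage G) y t ∧
        t ≤ P.eval (encodeLanguage G).size ∧
        (LanguageSatisfies (conservativeExtension (languageOf G)) M →
          ∃ F : M.Interpretation (Fin d),
            (∀ i, IsConservative (F i)) ∧
            M.IsPolymorphismTuple (languageOf G) F ∧
            y = .cons .nil (encodeInterpretation F)) ∧
        (¬ LanguageSatisfies (conservativeExtension (languageOf G)) M → y = .nil) := by
  obtain ⟨out, ⟨p, P, hp⟩, hout⟩ := exists_solvesMetaproblem hM
  refine ⟨p, P, fun d G => ?_⟩
  obtain ⟨t, h1, h2⟩ := hp (toListLanguage G)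
  obtain ⟨h3, h4⟩ := hout d G
  rw [esize, ← encodeLanguage_eq] at h2
  rw [← encodeLanguage_eq] at h1
  refine ⟨_, t, h1, h2, fun h => ?_, fun h => ?_⟩
  · obtain ⟨y, hy⟩ := Option.isSome_iff_exists.1 (h4 h)
    obtain ⟨F, hF1, hF2, rfl⟩ := h3 y hy
    -- The code of `some y` is a node with left child `nil`, and that of `none` is `nil`; this is
    -- the required output format.
    exact ⟨F, hF1, hF2, by rw [hy]; rfl⟩
  · cases hy : out (toListLanguage G) with
    | none => rfl
    | some y =>
      obtain ⟨F, hF1, hF2, -⟩ := h3 y hy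
      exact absurd (languageSatisfies_conservativeExtension hF1 hF2) h
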